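/- Let $k$ be a commutative ring with unit. Let $\mathrm{Alg}^u_k$ be the category of unital (associative, not necessarily commutative) $k$-algebras and non-unital ($k$-linear, multiplicative) homomorphisms. For $n\ge 0$ let $\mathrm{Mtr}_n(A,B)=\mathrm{Hom}_k(A,M_{2^n}(B))$ be the set of non-unital homomorphisms, pointed at $0$. Index the rows and columns of $2^n\times 2^n$-matrices by words of length $n$ in two letters, the first letter being the outermost one, so that inserting $2^q\times 2^q$-matrices into the entries of a $2^p\times 2^p$-matrix, $M_{2^p}(M_{2^q}(B))\cong M_{2^{p+q}}(B)$, is concatenation of words. For a finite pointed set $K$ put $A\odot K=\prod_{K\setminus *}A$; a pointed map $\varphi:K\to K'$ induces $A\odot K'\to A\odot K$, $a\mapsto (a_{\varphi(x)})_x$, where $a_*=0$. Let $S^1=\Delta[1]/\partial\Delta[1]$ and $S^n=S^1\wedge\cdots\wedge S^1$, with $\Sigma_n$ permuting the factors. For unital $k$-algebras $A,B$ let $\mathrm{Mtrc}_n(A,B)$ be the pointed simplicial set with $\ell$-simplices $\mathrm{Mtr}_n(A\odot S^n_\ell,B)$. The group $\Sigma_n$ acts on it by conjugation, through its action on the factors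 of $S^n$ and its action on $M_{2^n}(B)$ that permutes the letters of the words. The structure map $\mathrm{Mtrc}_m(A,B)\wedge S^1\to\mathrm{Mtrc}_{m+1}(A,B)$ sends $(f,x)$ to $$A\odot S^{m+1}_\ell\xrightarrow{\mathrm{proj}_x}A\odot S^m_\ell\xrightarrow{\ f\ }M_{2^m}(B)\to M_{2^{m+1}}(B),$$ whose last map puts each matrix entry in the upper left corner of a $2\times 2$-matrix. Then $\mathrm{Mtrc}_*(A,B)=(\mathrm{Mtrc}_n(A,B))_{n\ge 0}$ is a symmetric $S^1$-spectrum. **Theorem.** There is a category enriched over the symmetric monoidal category of symmetric spectra (with the smash product $\wedge$ and the sphere spectrum $\mathbb S$ as unit), that is, a spectral category $\mathrm{Mtrc}_*(k)$, whose objects are the unital $k$-algebras, whose morphism objects are the symmetric spectra $\mathrm{Mtrc}_*(A,B)$, and such that: 1. the unit $\mathbf 1:\mathbb S\to\mathrm{Mtrc}_*(A,A)$ sends the non-basepoint of $S^0$ to $\mathrm{id}_A$; 2. the composition $\mathrm{Mtrc}_*(A,B)\wedge\mathrm{Mtrc}_*(B,C)\to\mathrm{Mtrc}_*(A,C)$ is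 given by the maps $\mathrm{Mtrc}_p(A,B)\wedge\mathrm{Mtrc}_q(B,C)\to\mathrm{Mtrc}_{p+q}(A,C)$ that send $(f,g)$ to $$A\odot S^{p+q}\xrightarrow{f\odot S^q}M_{2^p}(B)\odot S^q\cong M_{2^p}(B\odot S^q)\xrightarrow{M_{2^p}(g)}M_{2^p}(M_{2^q}(C))\cong M_{2^{p+q}}(C);$$ 3. the underlying category of $\mathrm{Mtrc}_*(k)$ is $\mathrm{Alg}^u_k$: sending a map $\mathbb S\to\mathrm{Mtrc}_*(A,B)$ to the image of the non-basepoint of $S^0$ is a bijection onto the set of non-unital homomorphisms $A\to B$, compatible with composition. Moreover, the spectral category $\mathrm{Mtrc}_*(k)$ is symmetric monoidal with respect to the tensor product of algebras, with unit object $k$: there are maps $$\mathrm{Mtrc}_*(A,A')\wedge\mathrm{Mtrc}_*(B,B')\to\mathrm{Mtrc}_*(A\otimes_k B,A'\otimes_k B'),$$ given in levels $p,q$ by sending $(f,g)$ to $$(A\otimes_k B)\odot S^{p+q}\cong(A\odot S^p)\otimes_k(B\odot S^q)\xrightarrow{f\otimes g}M_{2^p}(A')\otimes_k M_{2^q}(B')\cong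 M_{2^{p+q}}(A'\otimes_k B'),$$ (with $A\odot S^p$, $B\odot S^q$ and $(A\otimes_kB)\odot S^{p+q}$ taken in each simplicial degree) that form a spectral functor of two variables, and the usual associativity, unit and symmetry isomorphisms of tensor products of algebras are natural in the enriched sense and satisfy the pentagon, triangle, hexagon and symmetry axioms. -/

import Mathlib

open CategoryTheory MonoidalCategory

universe u

/-- The category `Σ` of symmetric groups: objects are the natural numbers, morphisms `n ⟶ m` are
the bijections `{0, …, n-1} ≃ {0, …, m-1}` (so there are none unless `n = m`, and the endomorphisms
of `n` form the symmetric group `Σ_n`). -/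
structure SymIdx : Type where
  /-- the underlying natural number -/
  card : ℕ

instance : Category SymIdx where
  Hom n m := Fin n.card ≃ Fin m.card
  id n := Equiv.refl _
  comp e f := e.trans f

/-- Pointed simplicial sets. -/
abbrev PSSet : Type (u + 1) := SimplicialObject Pointed.{u}

/-- Symmetric sequences of pointed simplicial sets. -/
abbrev SymSeq : Type (u + 1) := SymIdx ⥤ PSSet.{u}

namespace SymSeq

variable (F : SymSeq.{u}) {n m l : ℕ} {ℓ ℓ₁ ℓ₂ : SimplexCategoryᵒᵖ}

/-- The set of `ℓ`-simplices in level `n`. -/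
abbrev El (n : ℕ) (ℓ : SimplexCategoryᵒᵖ) : Type u := ((F.obj ⟨n⟩).obj ℓ).X

/-- The basepoint. -/
def pt (n : ℕ) (ℓ : SimplexCategoryᵒᵖ) : F.El n ℓ := ((F.obj ⟨n⟩).obj ℓ).point

/-- The action of bijections (in particular, of the symmetric group `Σ_n` on level `n`). -/
def act (e : Fin n ≃ Fin m) (x : F.El n ℓ) : F.El m ℓ :=
  Pointed.Hom.toFun ((F.map (X := ⟨n⟩) (Y := ⟨m⟩) e).app ℓ) x

/-- The simplicial structure. -/
def res (θ : ℓ₁ ⟶ ℓ₂) (x : F.El n ℓ₁) : F.El n ℓ₂ :=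
  Pointed.Hom.toFun ((F.obj ⟨n⟩).map θ) x

@[simp] lemma act_pt (e : Fin n ≃ Fin m) : F.act e (F.pt n ℓ) = F.pt m ℓ :=
  Pointed.Hom.map_point ((F.map (X := ⟨n⟩) (Y := ⟨m⟩) e).app ℓ)

@[simp] lemma res_pt (θ : ℓ₁ ⟶ ℓ₂) : F.res θ (F.pt n ℓ₁) = F.pt n ℓ₂ :=
  Pointed.Hom.map_point ((F.obj ⟨n⟩).map θ)

lemma act_refl (x : F.El n ℓ) : F.act (Equiv.refl _) x = x := by
  have h := F.map_id ⟨n⟩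
  exact congrFun (congrArg (fun t => Pointed.Hom.toFun (NatTrans.app t ℓ)) h) x

@[simp] lemma act_act (e : Fin n ≃ Fin m) (e₁ : Fin m ≃ Fin l) (x : F.El n ℓ) :
    F.act e₁ (F.act e x) = F.act (e.trans e₁) x := by
  have h := F.map_comp (X := ⟨n⟩) (Y := ⟨m⟩) (Z := ⟨l⟩) e e₁
  exact (congrFun (congrArg (fun t => Pointed.Hom.toFun (NatTrans.app t ℓ)) h) x).symm

@[simp] lemma res_id (x : F.El n ℓ) : F.res (𝟙 ℓ) x = x :=
  congrFun (congrArg Pointed.Hom.toFun ((F.obj ⟨n⟩).map_id ℓ)) x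

lemma res_comp (θ : ℓ ⟶ ℓ₁) (η : ℓ₁ ⟶ ℓ₂) (x : F.El n ℓ) :
    F.res (θ ≫ η) x = F.res η (F.res θ x) :=
  congrFun (congrArg Pointed.Hom.toFun ((F.obj ⟨n⟩).map_comp θ η)) x

lemma res_act (θ : ℓ₁ ⟶ ℓ₂) (e : Fin n ≃ Fin m) (x : F.El n ℓ₁) :
    F.res θ (F.act e x) = F.act e (F.res θ x) := by
  have h := (F.map (X := ⟨n⟩) (Y := ⟨m⟩) e).naturality θ
  exact (congrFun (congrArg Pointed.Hom.toFun h) x).symm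

/-- Symmetric sequences from elementwise data. -/
@[reducible] def ofData (El : ℕ → SimplexCategoryᵒᵖ → Type u) (pt : ∀ n ℓ, El n ℓ)
    (act : ∀ {n m : ℕ} {ℓ}, (Fin n ≃ Fin m) → El n ℓ → El m ℓ)
    (res : ∀ {n : ℕ} {ℓ₁ ℓ₂ : SimplexCategoryᵒᵖ}, (ℓ₁ ⟶ ℓ₂) → El n ℓ₁ → El n ℓ₂)
    (act_pt : ∀ {n m : ℕ} {ℓ} (e : Fin n ≃ Fin m), act e (pt n ℓ) = pt m ℓ)
    (act_refl : ∀ {n : ℕ} {ℓ} (x : El n ℓ), act (Equiv.refl _) x = x)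
    (act_act : ∀ {n m l : ℕ} {ℓ} (e : Fin n ≃ Fin m) (e₁ : Fin m ≃ Fin l) (x : El n ℓ),
      act e₁ (act e x) = act (e.trans e₁) x)
    (res_pt : ∀ {n : ℕ} {ℓ₁ ℓ₂ : SimplexCategoryᵒᵖ} (θ : ℓ₁ ⟶ ℓ₂), res θ (pt n ℓ₁) = pt n ℓ₂)
    (res_id : ∀ {n : ℕ} {ℓ} (x : El n ℓ), res (𝟙 ℓ) x = x)
    (res_comp : ∀ {n : ℕ} {ℓ ℓ₁ ℓ₂ : SimplexCategoryᵒᵖ} (θ : ℓ ⟶ ℓ₁) (η : ℓ₁ ⟶ ℓ₂) (x : El n ℓ),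
      res (θ ≫ η) x = res η (res θ x))
    (res_act : ∀ {n m : ℕ} {ℓ₁ ℓ₂ : SimplexCategoryᵒᵖ} (θ : ℓ₁ ⟶ ℓ₂) (e : Fin n ≃ Fin m)
      (x : El n ℓ₁), res θ (act e x) = act e (res θ x)) : SymSeq.{u} where
  obj n :=
    { obj := fun ℓ => ⟨El n.card ℓ, pt n.card ℓ⟩
      map := fun θ => ⟨res θ, res_pt θ⟩
      map_id := fun _ => Pointed.Hom.ext (funext fun x => res_id x)
      map_comp := fun θ η => Pointed.Hom.ext (funext fun x => res_comp θ η x) }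
  map {n m} e :=
    { app := fun ℓ => ⟨act (n := n.card) (m := m.card) e, act_pt (n := n.card) (m := m.card) e⟩
      naturality := fun _ _ θ => Pointed.Hom.ext (funext fun x =>
        (res_act (n := n.card) (m := m.card) θ e x).symm) }
  map_id n := by
    apply NatTrans.ext; funext ℓ
    exact Pointed.Hom.ext (funext fun x => act_refl x)
  map_comp {n m l} e e₁ := by
    apply NatTrans.ext; funext ℓ
    exact Pointed.Hom.ext (funext fun x =>
      (act_act (n := n.card) (m := m.card) (l := l.card) e e₁ x).symm)

end SymSeq

/-! The simplicial circle and the simplicial spheres -/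

/-- A simplex of `Δ[1]`, i.e. a monotone map `[ℓ] → [1]`, lies in the boundary `∂Δ[1]` iff it is
constant. -/
def IsBdry {ℓ : SimplexCategory} (f : ℓ ⟶ SimplexCategory.mk 1) : Prop :=
  ∃ c : Fin 2, ∀ i, f.toOrderHom i = c

lemma IsBdry.comp {ℓ ℓ₁ : SimplexCategory} (θ : ℓ ⟶ ℓ₁) {f : ℓ₁ ⟶ SimplexCategory.mk 1}
    (hf : IsBdry f) : IsBdry (θ ≫ f) := by
  obtain ⟨c, hc⟩ := hf
  exact ⟨c, fun i => hc _⟩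

/-- The pointed simplicial circle `S¹ = Δ[1] / ∂Δ[1]`. -/
def circle : PSSet.{0} where
  obj ℓ := ⟨Quot fun f g : ℓ.unop ⟶ SimplexCategory.mk 1 => IsBdry f ∧ IsBdry g,
    Quot.mk _ (SimplexCategory.const _ _ 0)⟩
  map θ := ⟨Quot.map (fun f => θ.unop ≫ f) fun _ _ h => ⟨h.1.comp _, h.2.comp _⟩,
    Quot.sound ⟨⟨0, fun _ => rfl⟩, ⟨0, fun _ => rfl⟩⟩⟩
  map_id ℓ := by
    apply Pointed.Hom.ext; funext x; induction x using Quot.ind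
    exact congrArg (Quot.mk _) (Category.id_comp _)
  map_comp θ η := by
    apply Pointed.Hom.ext; funext x; induction x using Quot.ind
    exact congrArg (Quot.mk _) (Category.assoc _ _ _)

/-- The `ℓ`-simplices of the circle. -/
abbrev S1 (ℓ : SimplexCategoryᵒᵖ) : Type := (circle.obj ℓ).X

/-- The basepoint of the circle. -/
def S1.pt (ℓ : SimplexCategoryᵒᵖ) : S1 ℓ := (circle.obj ℓ).point

/-- The simplicial structure of the circle. -/
def S1.res {ℓ₁ ℓ₂ : SimplexCategoryᵒᵖ} (θ : ℓ₁ ⟶ ℓ₂) (s : S1 ℓ₁) : S1 ℓ₂ :=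
  Pointed.Hom.toFun (circle.map θ) s

@[simp] lemma S1.res_pt {ℓ₁ ℓ₂ : SimplexCategoryᵒᵖ} (θ : ℓ₁ ⟶ ℓ₂) :
    S1.res θ (S1.pt ℓ₁) = S1.pt ℓ₂ :=
  Pointed.Hom.map_point (circle.map θ)

@[simp] lemma S1.res_id {ℓ : SimplexCategoryᵒᵖ} (s : S1 ℓ) : S1.res (𝟙 ℓ) s = s :=
  congrFun (congrArg Pointed.Hom.toFun (circle.map_id ℓ)) s

lemma S1.res_comp {ℓ ℓ₁ ℓ₂ : SimplexCategoryᵒᵖ} (θ : ℓ ⟶ ℓ₁) (η : ℓ₁ ⟶ ℓ₂) (s : S1 ℓ) :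
    S1.res (θ ≫ η) s = S1.res η (S1.res θ s) :=
  congrFun (congrArg Pointed.Hom.toFun (circle.map_comp θ η)) s

/-- The relation that collapses the tuples with a coordinate at the basepoint to the basepoint
`none`. -/
inductive SphereRel (n : ℕ) (ℓ : SimplexCategoryᵒᵖ) :
    Option (Fin n → S1 ℓ) → Option (Fin n → S1 ℓ) → Prop
  | collapse (t : Fin n → S1 ℓ) (i : Fin n) (h : t i = S1.pt ℓ) : SphereRel n ℓ (some t) none

/-- The `ℓ`-simplices of the sphere `Sⁿ = S¹ ∧ ⋯ ∧ S¹` (`n` factors; `S⁰` is two points): tuples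
`t₁ ∧ ⋯ ∧ tₙ`, together with a basepoint, modulo identification of all tuples having a coordinate at
the basepoint with the basepoint. -/
def Sph (n : ℕ) (ℓ : SimplexCategoryᵒᵖ) : Type := Quot (SphereRel n ℓ)

namespace Sph

variable {n m p q r : ℕ} {ℓ ℓ₁ ℓ₂ : SimplexCategoryᵒᵖ}

/-- The basepoint. -/
def pt (n : ℕ) (ℓ : SimplexCategoryᵒᵖ) : Sph n ℓ := Quot.mk _ none

/-- The simplex `t₁ ∧ ⋯ ∧ tₙ`. -/
def mk (t : Fin n → S1 ℓ) : Sph n ℓ := Quot.mk _ (some t)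

lemma mk_eq_pt (t : Fin n → S1 ℓ) (i : Fin n) (h : t i = S1.pt ℓ) : mk t = pt n ℓ :=
  Quot.sound (.collapse t i h)

lemma ind {P : Sph n ℓ → Prop} (h0 : P (pt n ℓ)) (h1 : ∀ t, P (mk t)) (x : Sph n ℓ) : P x := by
  induction x using Quot.ind with
  | mk a => cases a with
    | none => exact h0
    | some t => exact h1 t

/-- Maps out of `Sⁿ` that send the basepoint to `b`. -/
def lift {α : Type*} (b : α) (f : (Fin n → S1 ℓ) → α)
    (h : ∀ t i, t i = S1.pt ℓ → f t = b) : Sph n ℓ → α :=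
  Quot.lift (fun o => o.elim b f) (by
    rintro _ _ ⟨t, i, hi⟩
    exact h t i hi)

@[simp] lemma lift_pt {α : Type*} (b : α) (f : (Fin n → S1 ℓ) → α) (h) :
    lift b f h (pt n ℓ) = b := rfl

@[simp] lemma lift_mk {α : Type*} (b : α) (f : (Fin n → S1 ℓ) → α) (h) (t) :
    lift b f h (mk t) = f t := rfl

/-- Bijections act on spheres by permuting the smash factors: the factor in position `i` is moved
to position `e i`. -/
def act (e : Fin n ≃ Fin m) : Sph n ℓ → Sph m ℓ :=
  lift (pt m ℓ) (fun t => mk (t ∘ e.symm)) fun t i h => mk_eq_pt _ (e i) (by simpa using h)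

@[simp] lemma act_pt (e : Fin n ≃ Fin m) : act e (pt n ℓ) = pt m ℓ := rfl
@[simp] lemma act_mk (e : Fin n ≃ Fin m) (t : Fin n → S1 ℓ) : act e (mk t) = mk (t ∘ e.symm) := rfl

/-- The simplicial structure of `Sⁿ`. -/
def res (θ : ℓ₁ ⟶ ℓ₂) : Sph n ℓ₁ → Sph n ℓ₂ :=
  lift (pt n ℓ₂) (fun t => mk (S1.res θ ∘ t)) fun t i h => mk_eq_pt _ i (by simp [h])

@[simp] lemma res_pt (θ : ℓ₁ ⟶ ℓ₂) : res θ (pt n ℓ₁) = pt n ℓ₂ := rfl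
@[simp] lemma res_mk (θ : ℓ₁ ⟶ ℓ₂) (t : Fin n → S1 ℓ₁) : res θ (mk t) = mk (S1.res θ ∘ t) := rfl

/-- The smash product `(x, t₁ ∧ ⋯ ∧ t_q) ↦ x ∧ t₁ ∧ ⋯ ∧ t_q`, as a map `S^p → S^{p+q}`. -/
def smashTuple (t : Fin q → S1 ℓ) : Sph p ℓ → Sph (p + q) ℓ :=
  lift (pt _ ℓ) (fun u => mk (Fin.append u t)) fun u i h =>
    mk_eq_pt _ (Fin.castAdd q i) (by simpa using h)

@[simp] lemma smashTuple_pt (t : Fin q → S1 ℓ) : smashTuple t (pt p ℓ) = pt _ ℓ := rfl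
@[simp] lemma smashTuple_mk (t : Fin q → S1 ℓ) (u : Fin p → S1 ℓ) :
    smashTuple t (mk u) = mk (Fin.append u t) := rfl

/-- The smash product `S^p ∧ S^q → S^{p+q}`. -/
def smash (x : Sph p ℓ) : Sph q ℓ → Sph (p + q) ℓ :=
  lift (pt _ ℓ) (fun t => smashTuple t x) fun t i h => by
    induction x using ind with
    | h0 => rfl
    | h1 u => exact mk_eq_pt _ (Fin.natAdd p i) (by simpa using h)

@[simp] lemma smash_pt (x : Sph p ℓ) : smash x (pt q ℓ) = pt _ ℓ := rfl
@[simp] lemma pt_smash (y : Sph q ℓ) : smash (pt p ℓ) y = pt _ ℓ := by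
  induction y using ind <;> rfl
@[simp] lemma mk_smash_mk (u : Fin p → S1 ℓ) (t : Fin q → S1 ℓ) :
    smash (mk u) (mk t) = mk (Fin.append u t) := rfl

end Sph

/-! Symmetric spectra -/

/-- Iteration of structure maps: from maps `σ : F_m ∧ S¹ → F_{m+1}` one obtains
`(x, t₁, …, t_k) ↦ σ (⋯ σ (x, t₁) ⋯, t_k)`. -/
def iterStr (F : SymSeq.{u}) (str : ∀ {m : ℕ} {ℓ}, F.El m ℓ → S1 ℓ → F.El (m + 1) ℓ)
    {m : ℕ} {ℓ} (x : F.El m ℓ) : ∀ {k : ℕ}, (Fin k → S1 ℓ) → F.El (m + k) ℓ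
  | 0, _ => x
  | k + 1, t => str (iterStr F str x (k := k) (fun i => t i.castSucc)) (t (Fin.last k))

/-- Symmetric `S¹`-spectra of pointed simplicial sets: a symmetric sequence with maps
`F_m ∧ S¹ → F_{m+1}` of pointed simplicial sets whose iterations `F_m ∧ S^k → F_{m+k}` are
equivariant for `Σ_m × Σ_k`. A map out of a smash product is written as a map of two variables that
sends `(*, s)` and `(x, *)` to the basepoint. -/
structure SymmetricSpectrum : Type (u + 1) where
  /-- the underlying symmetric sequence -/
  seq : SymSeq.{u}
  /-- the structure maps -/
  str : ∀ {m : ℕ} {ℓ : SimplexCategoryᵒᵖ}, seq.El m ℓ → S1 ℓ → seq.El (m + 1) ℓ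
  str_pt_left : ∀ {m : ℕ} {ℓ : SimplexCategoryᵒᵖ} (s : S1 ℓ), str (seq.pt m ℓ) s = seq.pt _ ℓ
  str_pt_right : ∀ {m : ℕ} {ℓ : SimplexCategoryᵒᵖ} (x : seq.El m ℓ),
    str x (S1.pt ℓ) = seq.pt _ ℓ
  res_str : ∀ {m : ℕ} {ℓ₁ ℓ₂ : SimplexCategoryᵒᵖ} (θ : ℓ₁ ⟶ ℓ₂) (x : seq.El m ℓ₁) (s : S1 ℓ₁),
    seq.res θ (str x s) = str (seq.res θ x) (S1.res θ s)
  act_iterStr : ∀ {m n k j : ℕ} {ℓ : SimplexCategoryᵒᵖ} (τ : Fin m ≃ Fin n) (ρ : Fin k ≃ Fin j)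
    (x : seq.El m ℓ) (t : Fin k → S1 ℓ),
    seq.act (finSumFinEquiv.symm.trans ((Equiv.sumCongr τ ρ).trans finSumFinEquiv))
      (iterStr seq str x t) = iterStr seq str (seq.act τ x) (t ∘ ρ.symm)

namespace SymmetricSpectrum

/-- Morphisms of symmetric spectra: morphisms of symmetric sequences that commute with the structure
maps. -/
@[ext] structure Hom (X Y : SymmetricSpectrum.{u}) : Type u where
  /-- the underlying morphism of symmetric sequences -/
  toSeq : X.seq ⟶ Y.seq
  map_str : ∀ {m : ℕ} {ℓ : SimplexCategoryᵒᵖ} (x : X.seq.El m ℓ) (s : S1 ℓ),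
    Pointed.Hom.toFun ((toSeq.app ⟨m + 1⟩).app ℓ) (X.str x s) =
      Y.str (Pointed.Hom.toFun ((toSeq.app ⟨m⟩).app ℓ) x) s

instance : Category SymmetricSpectrum.{u} where
  Hom := Hom
  id X := ⟨𝟙 _, fun _ _ => rfl⟩
  comp f g := ⟨f.toSeq ≫ g.toSeq, fun x s => by
    have h1 := f.map_str x s
    have h2 := g.map_str (Pointed.Hom.toFun ((f.toSeq.app ⟨_⟩).app _) x) s
    rw [← h1] at h2
    exact h2⟩

variable {X Y Z W : SymmetricSpectrum.{u}}

/-- The map on `ℓ`-simplices of level `n`. -/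
def ap (f : X ⟶ Y) {n : ℕ} {ℓ : SimplexCategoryᵒᵖ} (x : X.seq.El n ℓ) : Y.seq.El n ℓ :=
  Pointed.Hom.toFun ((f.toSeq.app ⟨n⟩).app ℓ) x

lemma hom_ext' {f g : X ⟶ Y} (h : ∀ {n ℓ} (x : X.seq.El n ℓ), ap f x = ap g x) : f = g := by
  apply Hom.ext
  apply NatTrans.ext; funext n
  apply NatTrans.ext; funext ℓ
  exact Pointed.Hom.ext (funext fun x => h (n := n.card) x)

@[simp] lemma ap_id {n : ℕ} {ℓ} (x : X.seq.El n ℓ) : ap (𝟙 X) x = x := rfl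
@[simp] lemma ap_comp (f : X ⟶ Y) (g : Y ⟶ Z) {n : ℕ} {ℓ} (x : X.seq.El n ℓ) :
    ap (f ≫ g) x = ap g (ap f x) := rfl
@[simp] lemma ap_pt (f : X ⟶ Y) {n : ℕ} {ℓ} : ap f (X.seq.pt n ℓ) = Y.seq.pt n ℓ :=
  Pointed.Hom.map_point ((f.toSeq.app ⟨n⟩).app ℓ)
lemma ap_act (f : X ⟶ Y) {n m : ℕ} {ℓ} (e : Fin n ≃ Fin m) (x : X.seq.El n ℓ) :
    ap f (X.seq.act e x) = Y.seq.act e (ap f x) := by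
  have h := f.toSeq.naturality (X := ⟨n⟩) (Y := ⟨m⟩) e
  exact congrFun (congrArg (fun t => Pointed.Hom.toFun (NatTrans.app t ℓ)) h) x
lemma ap_res (f : X ⟶ Y) {n : ℕ} {ℓ₁ ℓ₂} (θ : ℓ₁ ⟶ ℓ₂) (x : X.seq.El n ℓ₁) :
    ap f (X.seq.res θ x) = Y.seq.res θ (ap f x) := by
  have h := (f.toSeq.app ⟨n⟩).naturality θ
  exact congrFun (congrArg Pointed.Hom.toFun h) x
@[simp] lemma ap_str (f : X ⟶ Y) {n : ℕ} {ℓ} (x : X.seq.El n ℓ) (s : S1 ℓ) :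
    ap f (X.str x s) = Y.str (ap f x) s := f.map_str x s

/-- Morphisms of symmetric spectra from elementwise data. -/
def homMk (f : ∀ {n : ℕ} {ℓ}, X.seq.El n ℓ → Y.seq.El n ℓ)
    (f_pt : ∀ n ℓ, f (X.seq.pt n ℓ) = Y.seq.pt n ℓ)
    (f_act : ∀ {n m : ℕ} {ℓ} (e : Fin n ≃ Fin m) (x : X.seq.El n ℓ),
      f (X.seq.act e x) = Y.seq.act e (f x))
    (f_res : ∀ {n : ℕ} {ℓ₁ ℓ₂} (θ : ℓ₁ ⟶ ℓ₂) (x : X.seq.El n ℓ₁),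
      f (X.seq.res θ x) = Y.seq.res θ (f x))
    (f_str : ∀ {n : ℕ} {ℓ} (x : X.seq.El n ℓ) (s : S1 ℓ), f (X.str x s) = Y.str (f x) s) :
    X ⟶ Y :=
  Hom.mk
    { app := fun n =>
        { app := fun ℓ => ⟨f (n := n.card), f_pt n.card ℓ⟩
          naturality := fun _ _ θ => Pointed.Hom.ext (funext fun x => f_res (n := n.card) θ x) }
      naturality := fun n m e => by
        apply NatTrans.ext; funext ℓ
        exact Pointed.Hom.ext (funext fun x => f_act (n := n.card) (m := m.card) e x) }
    f_str

@[simp] lemma ap_homMk (f : ∀ {n : ℕ} {ℓ}, X.seq.El n ℓ → Y.seq.El n ℓ) (h1 h2 h3 h4)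
    {n : ℕ} {ℓ} (x : X.seq.El n ℓ) : ap (homMk (X := X) (Y := Y) f h1 h2 h3 h4) x = f x := rfl

end SymmetricSpectrum

namespace SymmetricSpectrum

variable {X Y Z W : SymmetricSpectrum.{u}} {m n p q r k j l : ℕ} {ℓ ℓ₁ ℓ₂ : SimplexCategoryᵒᵖ}

/-- Iterated structure maps of a symmetric spectrum. -/
def iter (X : SymmetricSpectrum.{u}) (x : X.seq.El m ℓ) (t : Fin k → S1 ℓ) : X.seq.El (m + k) ℓ :=
  iterStr X.seq X.str x t

lemma iter_zero (x : X.seq.El m ℓ) (t : Fin 0 → S1 ℓ) : X.iter x t = x := rfl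

lemma iter_succ (x : X.seq.El m ℓ) (t : Fin (k + 1) → S1 ℓ) :
    X.iter x t = X.str (X.iter x fun i => t i.castSucc) (t (Fin.last k)) := rfl

lemma act_iter (τ : Fin m ≃ Fin n) (ρ : Fin k ≃ Fin j) (x : X.seq.El m ℓ) (t : Fin k → S1 ℓ) :
    X.seq.act (finSumFinEquiv.symm.trans ((Equiv.sumCongr τ ρ).trans finSumFinEquiv))
      (X.iter x t) = X.iter (X.seq.act τ x) (t ∘ ρ.symm) := X.act_iterStr τ ρ x t

lemma iter_pt (t : Fin k → S1 ℓ) : X.iter (X.seq.pt m ℓ) t = X.seq.pt _ ℓ := by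
  induction k with
  | zero => rfl
  | succ k ih => rw [iter_succ, ih, str_pt_left]; rfl

lemma iter_eq_pt (x : X.seq.El m ℓ) (t : Fin k → S1 ℓ) (i : Fin k) (h : t i = S1.pt ℓ) :
    X.iter x t = X.seq.pt _ ℓ := by
  induction k with
  | zero => exact i.elim0
  | succ k ih =>
    rw [iter_succ]
    refine Fin.lastCases (fun h => ?_) (fun i h => ?_) i h
    · rw [h, str_pt_right]; rfl
    · rw [ih _ i h, str_pt_left]; rfl

lemma res_iter (θ : ℓ₁ ⟶ ℓ₂) (x : X.seq.El m ℓ₁) (t : Fin k → S1 ℓ₁) :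
    X.seq.res θ (X.iter x t) = X.iter (X.seq.res θ x) (S1.res θ ∘ t) := by
  induction k with
  | zero => rfl
  | succ k ih =>
    rw [iter_succ, iter_succ]
    exact (X.res_str θ _ _).trans (by rw [ih]; rfl)

lemma ap_iter (f : X ⟶ Y) (x : X.seq.El m ℓ) (t : Fin k → S1 ℓ) :
    ap f (X.iter x t) = Y.iter (ap f x) t := by
  induction k with
  | zero => rfl
  | succ k ih =>
    rw [iter_succ, iter_succ, ← ih]
    exact ap_str f _ _

lemma act_str (τ : Fin m ≃ Fin n) (x : X.seq.El m ℓ) (s : S1 ℓ) :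
    X.seq.act (finSumFinEquiv.symm.trans
      ((Equiv.sumCongr τ (Equiv.refl (Fin 1))).trans finSumFinEquiv)) (X.str x s) =
      X.str (X.seq.act τ x) s :=
  X.act_iter τ (Equiv.refl (Fin 1)) x fun _ => s

/-- Coordinate-free iterated structure maps. -/
def lam (X : SymmetricSpectrum.{u}) (e : Fin m ⊕ Fin k ≃ Fin n) (x : X.seq.El m ℓ)
    (t : Fin k → S1 ℓ) : X.seq.El n ℓ :=
  X.seq.act (finSumFinEquiv.symm.trans e) (X.iter x t)

lemma act_lam (e : Fin m ⊕ Fin k ≃ Fin n) (e₁ : Fin n ≃ Fin l) (x : X.seq.El m ℓ)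
    (t : Fin k → S1 ℓ) : X.seq.act e₁ (X.lam e x t) = X.lam (e.trans e₁) x t := by
  simp [lam, Equiv.trans_assoc]

lemma lam_act (e : Fin n ⊕ Fin j ≃ Fin l) (τ : Fin m ≃ Fin n) (ρ : Fin k ≃ Fin j)
    (x : X.seq.El m ℓ) (t : Fin k → S1 ℓ) :
    X.lam e (X.seq.act τ x) (t ∘ ρ.symm) = X.lam ((Equiv.sumCongr τ ρ).trans e) x t := by
  rw [lam, ← act_iter, SymSeq.act_act, lam]
  congr 1
  ext z
  simp

lemma lam_pt (e : Fin m ⊕ Fin k ≃ Fin n) (t : Fin k → S1 ℓ) :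
    X.lam e (X.seq.pt m ℓ) t = X.seq.pt n ℓ := by
  rw [lam, iter_pt, SymSeq.act_pt]

lemma lam_eq_pt (e : Fin m ⊕ Fin k ≃ Fin n) (x : X.seq.El m ℓ) (t : Fin k → S1 ℓ) (i : Fin k)
    (h : t i = S1.pt ℓ) : X.lam e x t = X.seq.pt n ℓ := by
  rw [lam, iter_eq_pt x t i h, SymSeq.act_pt]

lemma res_lam (θ : ℓ₁ ⟶ ℓ₂) (e : Fin m ⊕ Fin k ≃ Fin n) (x : X.seq.El m ℓ₁) (t : Fin k → S1 ℓ₁) :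
    X.seq.res θ (X.lam e x t) = X.lam e (X.seq.res θ x) (S1.res θ ∘ t) := by
  rw [lam, SymSeq.res_act, res_iter, lam]

lemma ap_lam (f : X ⟶ Y) (e : Fin m ⊕ Fin k ≃ Fin n) (x : X.seq.El m ℓ) (t : Fin k → S1 ℓ) :
    ap f (X.lam e x t) = Y.lam e (ap f x) t := by
  rw [lam, ap_act, ap_iter, lam]

lemma lam_zero (e : Fin m ⊕ Fin 0 ≃ Fin n) (x : X.seq.El m ℓ) (t : Fin 0 → S1 ℓ) :
    X.lam e x t = X.seq.act ((Equiv.sumEmpty (Fin m) (Fin 0)).symm.trans e) x := by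
  rw [lam, iter_zero]
  congr 1
  exact Equiv.ext fun z => congrArg e (finSumFinEquiv_symm_apply_castAdd (n := 0) z)

lemma str_eq_lam (x : X.seq.El m ℓ) (s : S1 ℓ) :
    X.str x s = X.lam finSumFinEquiv x (fun _ : Fin 1 => s) := by
  rw [lam, Equiv.symm_trans_self, SymSeq.act_refl]
  rfl

lemma iter_iter (x : X.seq.El m ℓ) (t : Fin k → S1 ℓ) (u : Fin j → S1 ℓ) :
    X.seq.act (finCongr (Nat.add_assoc m k j)) (X.iter (X.iter x t) u) =
      X.iter x (Fin.append t u) := by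
  induction j with
  | zero =>
    have : (finCongr (Nat.add_assoc m k 0)) = Equiv.refl _ := rfl
    rw [this, SymSeq.act_refl, iter_zero]
    have h : (Fin.append t u : Fin k → S1 ℓ) = t := funext fun i => Fin.append_left t u i
    exact (congrArg (X.iter x) h).symm
  | succ j ih =>
    rw [iter_succ (X.iter x t)]
    have h1 := X.act_str (finCongr (Nat.add_assoc m k j))
      (X.iter (X.iter x t) fun i => u i.castSucc) (u (Fin.last j))
    rw [ih] at h1
    have h2 : X.iter x (Fin.append t u) =
        X.str (X.iter x (Fin.append t fun i : Fin j => u i.castSucc)) (u (Fin.last j)) := by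
      refine (iter_succ (k := k + j) x (Fin.append (m := k) (n := j + 1) t u)).trans ?_
      congr 1
      · congr 1
        ext i
        refine Fin.addCases (fun i => ?_) (fun i => ?_) i
        · rw [Fin.append_left]; exact Fin.append_left t u i
        · rw [Fin.append_right]; exact Fin.append_right t u i.castSucc
      · exact Fin.append_right t u (Fin.last j)
    rw [h2, ← h1]
    congr 1
    refine Equiv.ext fun z => ?_
    refine Fin.addCases (m := m + k + j) (n := 1) (fun i => ?_) (fun i => ?_) z
    · rw [Equiv.trans_apply, Equiv.trans_apply, finSumFinEquiv_symm_apply_castAdd]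
      rfl
    · rw [Equiv.trans_apply, Equiv.trans_apply, finSumFinEquiv_symm_apply_natAdd]
      exact Fin.ext (by simp [Nat.add_assoc])

/-- Coordinate-free iterated structure maps for two tuples. -/
def lam₂ (X : SymmetricSpectrum.{u}) (e : Fin m ⊕ (Fin k ⊕ Fin j) ≃ Fin n) (x : X.seq.El m ℓ)
    (t : Fin k → S1 ℓ) (u : Fin j → S1 ℓ) : X.seq.El n ℓ :=
  X.lam ((Equiv.sumCongr (Equiv.refl _) finSumFinEquiv.symm).trans e) x (Fin.append t u)

lemma lam_append (e : Fin m ⊕ Fin (k + j) ≃ Fin n) (x : X.seq.El m ℓ)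
    (t : Fin k → S1 ℓ) (u : Fin j → S1 ℓ) : X.lam e x (Fin.append t u) =
      X.lam₂ ((Equiv.sumCongr (Equiv.refl _) finSumFinEquiv).trans e) x t u := by
  rw [lam₂]
  congr 1
  ext z
  simp

lemma lam_lam (e' : Fin m ⊕ Fin k ≃ Fin n) (e : Fin n ⊕ Fin j ≃ Fin l) (x : X.seq.El m ℓ)
    (t : Fin k → S1 ℓ) (u : Fin j → S1 ℓ) :
    X.lam e (X.lam e' x t) u =
      X.lam₂ ((Equiv.sumAssoc _ _ _).symm.trans ((Equiv.sumCongr e' (Equiv.refl _)).trans e))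
        x t u := by
  have h : X.lam e (X.lam e' x t) u = X.lam e (X.lam e' x t) (u ∘ (Equiv.refl _).symm) := rfl
  rw [h, lam.eq_def X e', lam_act, lam₂, lam, lam, ← iter_iter, SymSeq.act_act]
  congr 1
  ext z
  refine Fin.addCases (fun i => ?_) (fun i => ?_) z
  · refine Fin.addCases (fun i => ?_) (fun i => ?_) i
    · have : Fin.cast (Nat.add_assoc m k j) (Fin.castAdd j (Fin.castAdd k i)) =
        Fin.castAdd (k + j) i := rfl
      simp [this]
    · have : Fin.cast (Nat.add_assoc m k j) (Fin.castAdd j (Fin.natAdd m i)) =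
        Fin.natAdd m (Fin.castAdd j i) := rfl
      simp [this]
  · have : Fin.cast (Nat.add_assoc m k j) (Fin.natAdd (m + k) i) =
        Fin.natAdd m (Fin.natAdd k i) := Fin.ext (by simp [Nat.add_assoc])
    simp [this]

lemma lam₂_swap (e : Fin m ⊕ (Fin k ⊕ Fin j) ≃ Fin n) (x : X.seq.El m ℓ)
    (t : Fin k → S1 ℓ) (u : Fin j → S1 ℓ) :
    X.lam₂ e x t u =
      X.lam₂ ((Equiv.sumCongr (Equiv.refl _) (Equiv.sumComm _ _)).trans e) x u t := by
  have h : Fin.append t u = Fin.append u t ∘ (finSumFinEquiv.symm.trans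
      ((Equiv.sumComm (Fin j) (Fin k)).trans finSumFinEquiv)).symm := by
    ext i
    refine Fin.addCases (fun i => ?_) (fun i => ?_) i <;> simp
  rw [lam₂, h, lam₂]
  have := X.lam_act ((Equiv.sumCongr (Equiv.refl _) finSumFinEquiv.symm).trans e) (Equiv.refl _)
    (finSumFinEquiv.symm.trans ((Equiv.sumComm (Fin j) (Fin k)).trans finSumFinEquiv)) x
    (Fin.append u t)
  rw [SymSeq.act_refl] at this
  rw [this]
  congr 1
  ext z
  rcases z with z | z
  · simp
  · refine Fin.addCases (fun i => ?_) (fun i => ?_) z <;> simp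

lemma equiv_ext₁ {α : Type*} {e e' : Fin p ⊕ Fin q ≃ α}
    (h1 : ∀ i, e (Sum.inl i) = e' (Sum.inl i)) (h2 : ∀ i, e (Sum.inr i) = e' (Sum.inr i)) :
    e = e' := Equiv.ext (by rintro (i | i); exacts [h1 i, h2 i])

lemma equiv_ext₂ {α : Type*} {e e' : Fin p ⊕ Fin (q + r) ≃ α}
    (h1 : ∀ i, e (Sum.inl i) = e' (Sum.inl i))
    (h2 : ∀ i, e (Sum.inr (Fin.castAdd r i)) = e' (Sum.inr (Fin.castAdd r i)))
    (h3 : ∀ i, e (Sum.inr (Fin.natAdd q i)) = e' (Sum.inr (Fin.natAdd q i))) :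
    e = e' := equiv_ext₁ h1 fun i => Fin.addCases h2 h3 i

lemma equiv_ext₃ {α : Type*} {e e' : Fin (p + q) ⊕ Fin r ≃ α}
    (h1 : ∀ i, e (Sum.inl (Fin.castAdd q i)) = e' (Sum.inl (Fin.castAdd q i)))
    (h2 : ∀ i, e (Sum.inl (Fin.natAdd p i)) = e' (Sum.inl (Fin.natAdd p i)))
    (h3 : ∀ i, e (Sum.inr i) = e' (Sum.inr i)) :
    e = e' := equiv_ext₁ (fun i => Fin.addCases h1 h2 i) h3

/-- The bijection exchanging the last two blocks. -/
def blockSwap (m k j : ℕ) : Fin (m + j + k) ≃ Fin (m + k + j) :=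
  (finSumFinEquiv.symm.trans (Equiv.sumCongr finSumFinEquiv.symm (Equiv.refl _))).trans
    ((Equiv.sumAssoc _ _ _).trans
      ((Equiv.sumCongr (Equiv.refl _) (Equiv.sumComm _ _)).trans
        ((Equiv.sumAssoc _ _ _).symm.trans
          ((Equiv.sumCongr finSumFinEquiv (Equiv.refl _)).trans finSumFinEquiv))))

@[simp] lemma blockSwap_left (i : Fin m) : blockSwap m k j (Fin.castAdd k (Fin.castAdd j i)) =
    Fin.castAdd j (Fin.castAdd k i) := by
  simp [blockSwap]
@[simp] lemma blockSwap_mid (i : Fin j) : blockSwap m k j (Fin.castAdd k (Fin.natAdd m i)) =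
    Fin.natAdd (m + k) i := by
  simp [blockSwap]
@[simp] lemma blockSwap_right (i : Fin k) : blockSwap m k j (Fin.natAdd (m + j) i) =
    Fin.castAdd j (Fin.natAdd m i) := by
  simp [blockSwap]

lemma iter_iter_swap (x : X.seq.El m ℓ) (t : Fin k → S1 ℓ) (u : Fin j → S1 ℓ) :
    X.iter (X.iter x t) u = X.seq.act (blockSwap m k j) (X.iter (X.iter x u) t) := by
  have h (a b : ℕ) (v : Fin a → S1 ℓ) (w : Fin b → S1 ℓ) :
      X.iter (X.iter x v) w = X.lam finSumFinEquiv (X.lam finSumFinEquiv x v) w := by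
    simp [lam, SymSeq.act_refl]
  rw [h, h, lam_lam, lam_lam, lam₂_swap]
  rw [lam₂, lam₂, act_lam]
  congr 1
  refine equiv_ext₂ (fun i => ?_) (fun i => ?_) fun i => ?_ <;> simp

lemma str_str_swap (x : X.seq.El m ℓ) (s s' : S1 ℓ) :
    X.str (X.str x s) s' = X.seq.act (blockSwap m 1 1) (X.str (X.str x s') s) :=
  X.iter_iter_swap x (fun _ : Fin 1 => s) (fun _ : Fin 1 => s')

/-! The smash product -/

/-- The bijection obtained from `e` by adding `k` new points at the end. -/
def extR (e : Fin p ⊕ Fin q ≃ Fin n) (k : ℕ) : Fin p ⊕ Fin (q + k) ≃ Fin (n + k) :=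
  (Equiv.sumCongr (Equiv.refl _) finSumFinEquiv.symm).trans
    ((Equiv.sumAssoc _ _ _).symm.trans ((Equiv.sumCongr e (Equiv.refl _)).trans finSumFinEquiv))

@[simp] lemma extR_inl (e : Fin p ⊕ Fin q ≃ Fin n) (i : Fin p) :
    extR e k (Sum.inl i) = Fin.castAdd k (e (Sum.inl i)) := by simp [extR]
@[simp] lemma extR_castAdd (e : Fin p ⊕ Fin q ≃ Fin n) (i : Fin q) :
    extR e k (Sum.inr (Fin.castAdd k i)) = Fin.castAdd k (e (Sum.inr i)) := by simp [extR]
@[simp] lemma extR_natAdd (e : Fin p ⊕ Fin q ≃ Fin n) (i : Fin k) :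
    extR e k (Sum.inr (Fin.natAdd q i)) = Fin.natAdd n i := by simp [extR]

/-- The bijection that moves the last point of the second summand to the end of the first one. -/
def shift (p q : ℕ) : Fin p ⊕ Fin (q + 1) ≃ Fin (p + 1) ⊕ Fin q :=
  (Equiv.sumCongr (Equiv.refl _) (finSumFinEquiv.symm.trans (Equiv.sumComm _ _))).trans
    ((Equiv.sumAssoc _ _ _).symm.trans (Equiv.sumCongr finSumFinEquiv (Equiv.refl _)))

@[simp] lemma shift_inl (i : Fin p) : shift p q (Sum.inl i) = Sum.inl (Fin.castAdd 1 i) := by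
  simp [shift]
@[simp] lemma shift_castAdd (i : Fin q) :
    shift p q (Sum.inr (Fin.castAdd 1 i)) = Sum.inr i := by
  simp only [shift, Equiv.trans_apply, Equiv.sumCongr_apply, Sum.map_inr,
    finSumFinEquiv_symm_apply_castAdd]
  simp
@[simp] lemma shift_natAdd (i : Fin 1) :
    shift p q (Sum.inr (Fin.natAdd q i)) = Sum.inl (Fin.natAdd p i) := by
  simp only [shift, Equiv.trans_apply, Equiv.sumCongr_apply, Sum.map_inr,
    finSumFinEquiv_symm_apply_natAdd]
  simp

@[simp] lemma shift_symm_castAdd (i : Fin p) :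
    (shift p q).symm (Sum.inl (Fin.castAdd 1 i)) = Sum.inl i := by
  rw [← shift_inl (q := q), Equiv.symm_apply_apply]
@[simp] lemma shift_symm_natAdd (i : Fin 1) :
    (shift p q).symm (Sum.inl (Fin.natAdd p i)) = Sum.inr (Fin.natAdd q i) := by
  rw [← shift_natAdd (q := q), Equiv.symm_apply_apply]
@[simp] lemma shift_symm_inr (i : Fin q) :
    (shift p q).symm (Sum.inr i) = Sum.inr (Fin.castAdd 1 i) := by
  rw [← shift_castAdd (p := p), Equiv.symm_apply_apply]

/-- Generators of the smash product in level `n`: elements of `X_p ∧ Y_q` together with a bijection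
of `{0, …, p-1} ⊔ {0, …, q-1}` with `{0, …, n-1}` (so `p + q = n`). -/
structure SmashGen (X Y : SymmetricSpectrum.{u}) (n : ℕ) (ℓ : SimplexCategoryᵒᵖ) : Type u where
  /-- the level of the first element -/
  p : ℕ
  /-- the level of the second element -/
  q : ℕ
  /-- the bijection -/
  e : Fin p ⊕ Fin q ≃ Fin n
  /-- the first element -/
  x : X.seq.El p ℓ
  /-- the second element -/
  y : Y.seq.El q ℓ

/-- The relations of the smash product. `act` passes from `Σ_n × X_p × Y_q` to
`Σ_n ×_{Σ_p × Σ_q} X_p × Y_q`, `lin` identifies the two maps from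
`Σ_n ×_{Σ_p × Σ_1 × Σ_q} X_p ∧ S¹ ∧ Y_q` (right action of the sphere spectrum on `X`, left action on
`Y`), and `base` collapses everything that involves a basepoint. -/
inductive SmashRel (X Y : SymmetricSpectrum.{u}) (n : ℕ) (ℓ : SimplexCategoryᵒᵖ) :
    SmashGen X Y n ℓ → SmashGen X Y n ℓ → Prop
  | act {p p' q q' : ℕ} (τ : Fin p ≃ Fin p') (ρ : Fin q ≃ Fin q') (e : Fin p' ⊕ Fin q' ≃ Fin n)
      (x : X.seq.El p ℓ) (y : Y.seq.El q ℓ) :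
      SmashRel X Y n ℓ ⟨p, q, (Equiv.sumCongr τ ρ).trans e, x, y⟩
        ⟨p', q', e, X.seq.act τ x, Y.seq.act ρ y⟩
  | lin {p q : ℕ} (e : Fin (p + 1) ⊕ Fin q ≃ Fin n) (x : X.seq.El p ℓ) (s : S1 ℓ)
      (y : Y.seq.El q ℓ) :
      SmashRel X Y n ℓ ⟨p + 1, q, e, X.str x s, y⟩ ⟨p, q + 1, (shift p q).trans e, x, Y.str y s⟩
  | base {p p' q q' : ℕ} (e : Fin p ⊕ Fin q ≃ Fin n) (e' : Fin p' ⊕ Fin q' ≃ Fin n)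
      (x : X.seq.El p' ℓ) (y : Y.seq.El q ℓ) :
      SmashRel X Y n ℓ ⟨p, q, e, X.seq.pt p ℓ, y⟩ ⟨p', q', e', x, Y.seq.pt q' ℓ⟩

/-- The `ℓ`-simplices in level `n` of the smash product. -/
def SmashEl (X Y : SymmetricSpectrum.{u}) (n : ℕ) (ℓ : SimplexCategoryᵒᵖ) : Type u :=
  Quot (SmashRel X Y n ℓ)

namespace SmashEl

/-- The class of a generator. -/
def mk (e : Fin p ⊕ Fin q ≃ Fin n) (x : X.seq.El p ℓ) (y : Y.seq.El q ℓ) : SmashEl X Y n ℓ :=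
  Quot.mk _ ⟨p, q, e, x, y⟩

/-- The basepoint. -/
def pt (X Y : SymmetricSpectrum.{u}) (n : ℕ) (ℓ : SimplexCategoryᵒᵖ) : SmashEl X Y n ℓ :=
  mk (Equiv.sumEmpty (Fin n) (Fin 0)) (X.seq.pt n ℓ) (Y.seq.pt 0 ℓ)

lemma mk_act (τ : Fin p ≃ Fin m) (ρ : Fin q ≃ Fin r) (e : Fin m ⊕ Fin r ≃ Fin n)
    (x : X.seq.El p ℓ) (y : Y.seq.El q ℓ) :
    mk e (X.seq.act τ x) (Y.seq.act ρ y) = mk ((Equiv.sumCongr τ ρ).trans e) x y :=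
  (Quot.sound (.act τ ρ e x y)).symm

lemma mk_act_left (τ : Fin p ≃ Fin m) (e : Fin m ⊕ Fin q ≃ Fin n)
    (x : X.seq.El p ℓ) (y : Y.seq.El q ℓ) :
    mk e (X.seq.act τ x) y = mk ((Equiv.sumCongr τ (Equiv.refl _)).trans e) x y := by
  rw [← mk_act, SymSeq.act_refl]

lemma mk_act_right (ρ : Fin q ≃ Fin r) (e : Fin p ⊕ Fin r ≃ Fin n)
    (x : X.seq.El p ℓ) (y : Y.seq.El q ℓ) :
    mk e x (Y.seq.act ρ y) = mk ((Equiv.sumCongr (Equiv.refl _) ρ).trans e) x y := by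
  rw [← mk_act, SymSeq.act_refl]

lemma mk_str_left (e : Fin (p + 1) ⊕ Fin q ≃ Fin n) (x : X.seq.El p ℓ) (s : S1 ℓ)
    (y : Y.seq.El q ℓ) : mk e (X.str x s) y = mk ((shift p q).trans e) x (Y.str y s) :=
  Quot.sound (.lin e x s y)

lemma mk_pt_right (e : Fin p ⊕ Fin q ≃ Fin n) (x : X.seq.El p ℓ) :
    mk e x (Y.seq.pt q ℓ) = pt X Y n ℓ :=
  (Quot.sound (.base (Equiv.sumEmpty (Fin n) (Fin 0)) e x (Y.seq.pt 0 ℓ))).symm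

lemma mk_pt_left (e : Fin p ⊕ Fin q ≃ Fin n) (y : Y.seq.El q ℓ) :
    mk e (X.seq.pt p ℓ) y = pt X Y n ℓ :=
  (Quot.sound (.base e (Equiv.sumEmpty (Fin n) (Fin 0)) (X.seq.pt n ℓ) y))

lemma ind {P : SmashEl X Y n ℓ → Prop}
    (h : ∀ {p q : ℕ} (e : Fin p ⊕ Fin q ≃ Fin n) (x : X.seq.El p ℓ) (y : Y.seq.El q ℓ),
      P (mk e x y)) (w : SmashEl X Y n ℓ) : P w := by
  induction w using Quot.ind with
  | mk a => exact h a.e a.x a.y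

/-- Bijections act on the smash product. -/
def act (σ : Fin n ≃ Fin m) : SmashEl X Y n ℓ → SmashEl X Y m ℓ :=
  Quot.lift (fun a => mk (a.e.trans σ) a.x a.y) (by
    rintro _ _ (⟨τ, ρ, e, x, y⟩ | ⟨e, x, s, y⟩ | ⟨e, e', x, y⟩)
    · exact (mk_act τ ρ (e.trans σ) x y).symm
    · exact mk_str_left (e.trans σ) x s y
    · exact (mk_pt_left (e.trans σ) y).trans (mk_pt_right (e'.trans σ) x).symm)

lemma act_mk (σ : Fin n ≃ Fin m) (e : Fin p ⊕ Fin q ≃ Fin n) (x : X.seq.El p ℓ)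
    (y : Y.seq.El q ℓ) : act σ (mk e x y) = mk (e.trans σ) x y := rfl

/-- The simplicial structure of the smash product. -/
def res (θ : ℓ₁ ⟶ ℓ₂) : SmashEl X Y n ℓ₁ → SmashEl X Y n ℓ₂ :=
  Quot.lift (fun a => mk a.e (X.seq.res θ a.x) (Y.seq.res θ a.y)) (by
    rintro _ _ (⟨τ, ρ, e, x, y⟩ | ⟨e, x, s, y⟩ | ⟨e, e', x, y⟩)
    · simp only [SymSeq.res_act, mk_act]
    · simp only [res_str, mk_str_left]
    · simp only [SymSeq.res_pt, mk_pt_left, mk_pt_right])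

lemma res_mk (θ : ℓ₁ ⟶ ℓ₂) (e : Fin p ⊕ Fin q ≃ Fin n) (x : X.seq.El p ℓ₁)
    (y : Y.seq.El q ℓ₁) : res θ (mk e x y) = mk e (X.seq.res θ x) (Y.seq.res θ y) := rfl

/-- The structure maps of the smash product. -/
def str (w : SmashEl X Y n ℓ) (s : S1 ℓ) : SmashEl X Y (n + 1) ℓ :=
  Quot.lift (fun a => mk (extR a.e 1) a.x (Y.str a.y s)) (by
    rintro _ _ (⟨τ, ρ, e, x, y⟩ | ⟨e, x, s', y⟩ | ⟨e, e', x, y⟩)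
    · simp only [← act_str, mk_act]
      congr 1
      refine equiv_ext₂ (fun i => ?_) (fun i => ?_) fun i => ?_ <;> simp
    · simp only [mk_str_left]
      rw [str_str_swap, mk_act_right]
      congr 1
      refine equiv_ext₁ (fun i => ?_) fun i => ?_
      · simp
      · refine Fin.addCases (fun i => ?_) (fun i => ?_) i
        · refine Fin.addCases (fun i => ?_) (fun i => ?_) i <;> simp
        · simp
    · simp only [str_pt_left, mk_pt_left, mk_pt_right]) w

lemma str_mk (e : Fin p ⊕ Fin q ≃ Fin n) (x : X.seq.El p ℓ) (y : Y.seq.El q ℓ) (s : S1 ℓ) :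
    str (mk e x y) s = mk (extR e 1) x (Y.str y s) := rfl

end SmashEl
end SymmetricSpectrum

namespace SymmetricSpectrum

variable {X Y Z W : SymmetricSpectrum.{u}} {m n p q r k j l : ℕ} {ℓ ℓ₁ ℓ₂ : SimplexCategoryᵒᵖ}

/-- The symmetric sequence underlying the smash product. -/
@[reducible] def smashSeq (X Y : SymmetricSpectrum.{u}) : SymSeq.{u} :=
  SymSeq.ofData (SmashEl X Y) (SmashEl.pt X Y) SmashEl.act SmashEl.res
    (fun _ => SmashEl.mk_pt_left _ _)
    (fun x => by induction x using SmashEl.ind; rfl)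
    (fun _ _ x => by induction x using SmashEl.ind; rfl)
    (fun θ => by simp only [SmashEl.pt, SmashEl.res_mk, SymSeq.res_pt])
    (fun x => by induction x using SmashEl.ind; simp only [SmashEl.res_mk, SymSeq.res_id])
    (fun _ _ x => by induction x using SmashEl.ind; simp only [SmashEl.res_mk, SymSeq.res_comp])
    (fun _ _ x => by induction x using SmashEl.ind; rfl)

lemma smash_iterStr (e : Fin p ⊕ Fin q ≃ Fin n) (x : X.seq.El p ℓ) (y : Y.seq.El q ℓ)
    (t : Fin k → S1 ℓ) :
    iterStr (smashSeq X Y) SmashEl.str (SmashEl.mk e x y) t =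
      SmashEl.mk (extR e k) x (Y.iter y t) := by
  induction k with
  | zero =>
    have h : extR e 0 = e := equiv_ext₂ (fun i => extR_inl e i) (fun i => extR_castAdd e i)
      fun i => i.elim0
    rw [h]
    rfl
  | succ k ih =>
    have h : extR (extR e k) 1 = extR e (k + 1) := by
      refine equiv_ext₂ (q := q + k) (fun i => ?_) (fun i => ?_) fun i => ?_
      · rw [extR_inl, extR_inl, extR_inl]; rfl
      · rw [extR_castAdd]
        refine Fin.addCases (fun i => ?_) (fun i => ?_) i
        · rw [extR_castAdd]
          exact (extR_castAdd (k := k + 1) e i).symm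
        · rw [extR_natAdd]
          exact (extR_natAdd (k := k + 1) e i.castSucc).symm
      · rw [extR_natAdd]
        have hi : i = Fin.last 0 := Subsingleton.elim _ _
        subst hi
        exact (extR_natAdd (k := k + 1) e (Fin.last k)).symm
    refine (congrArg (fun w => SmashEl.str w (t (Fin.last k))) (ih _)).trans ?_
    rw [SmashEl.str_mk, h]
    rfl

/-- The smash product of symmetric spectra. -/
def smash (X Y : SymmetricSpectrum.{u}) : SymmetricSpectrum.{u} where
  seq := smashSeq X Y
  str := SmashEl.str
  str_pt_left s := SmashEl.mk_pt_left _ _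
  str_pt_right x := by
    induction x using SmashEl.ind
    exact (congrArg (SmashEl.mk _ _) (Y.str_pt_right _)).trans (SmashEl.mk_pt_right _ _)
  res_str θ x s := by
    induction x using SmashEl.ind
    exact congrArg (SmashEl.mk _ _) (Y.res_str θ _ s)
  act_iterStr τ ρ w t := by
    induction w using SmashEl.ind with
    | h e x y =>
    rw [smash_iterStr]
    refine Eq.trans ?_ (smash_iterStr (e.trans τ) x y (t ∘ ρ.symm)).symm
    refine (SmashEl.act_mk _ _ _ _).trans ?_
    have h := act_iter (Equiv.refl _) ρ y t
    rw [SymSeq.act_refl] at h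
    rw [← h, SmashEl.mk_act_right]
    congr 1
    refine equiv_ext₂ (fun i => ?_) (fun i => ?_) fun i => ?_ <;> simp

/-- The canonical element `x ∧ y` (with coordinates arranged by `e`) of the smash product. -/
def elt (e : Fin p ⊕ Fin q ≃ Fin n) (x : X.seq.El p ℓ) (y : Y.seq.El q ℓ) :
    (smash X Y).seq.El n ℓ := SmashEl.mk e x y

lemma smash_ind {P : (smash X Y).seq.El n ℓ → Prop}
    (h : ∀ {p q : ℕ} (e : Fin p ⊕ Fin q ≃ Fin n) (x : X.seq.El p ℓ) (y : Y.seq.El q ℓ),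
      P (elt e x y)) (w : (smash X Y).seq.El n ℓ) : P w := SmashEl.ind h w

lemma act_elt (σ : Fin n ≃ Fin m) (e : Fin p ⊕ Fin q ≃ Fin n) (x : X.seq.El p ℓ)
    (y : Y.seq.El q ℓ) : (smash X Y).seq.act σ (elt e x y) = elt (e.trans σ) x y := rfl
lemma res_elt (θ : ℓ₁ ⟶ ℓ₂) (e : Fin p ⊕ Fin q ≃ Fin n) (x : X.seq.El p ℓ₁)
    (y : Y.seq.El q ℓ₁) :
    (smash X Y).seq.res θ (elt e x y) = elt e (X.seq.res θ x) (Y.seq.res θ y) := rfl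
lemma str_elt (e : Fin p ⊕ Fin q ≃ Fin n) (x : X.seq.El p ℓ) (y : Y.seq.El q ℓ) (s : S1 ℓ) :
    (smash X Y).str (elt e x y) s = elt (extR e 1) x (Y.str y s) := rfl
lemma elt_act (τ : Fin p ≃ Fin m) (ρ : Fin q ≃ Fin r) (e : Fin m ⊕ Fin r ≃ Fin n)
    (x : X.seq.El p ℓ) (y : Y.seq.El q ℓ) :
    elt e (X.seq.act τ x) (Y.seq.act ρ y) = elt ((Equiv.sumCongr τ ρ).trans e) x y :=
  SmashEl.mk_act τ ρ e x y
lemma elt_act_left (τ : Fin p ≃ Fin m) (e : Fin m ⊕ Fin q ≃ Fin n)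
    (x : X.seq.El p ℓ) (y : Y.seq.El q ℓ) :
    elt e (X.seq.act τ x) y = elt ((Equiv.sumCongr τ (Equiv.refl _)).trans e) x y :=
  SmashEl.mk_act_left τ e x y
lemma elt_act_right (ρ : Fin q ≃ Fin r) (e : Fin p ⊕ Fin r ≃ Fin n)
    (x : X.seq.El p ℓ) (y : Y.seq.El q ℓ) :
    elt e x (Y.seq.act ρ y) = elt ((Equiv.sumCongr (Equiv.refl _) ρ).trans e) x y :=
  SmashEl.mk_act_right ρ e x y
lemma elt_str_left (e : Fin (p + 1) ⊕ Fin q ≃ Fin n) (x : X.seq.El p ℓ) (s : S1 ℓ)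
    (y : Y.seq.El q ℓ) : elt e (X.str x s) y = elt ((shift p q).trans e) x (Y.str y s) :=
  SmashEl.mk_str_left e x s y
lemma elt_str_right (e : Fin p ⊕ Fin (q + 1) ≃ Fin n) (x : X.seq.El p ℓ) (s : S1 ℓ)
    (y : Y.seq.El q ℓ) : elt e x (Y.str y s) = elt ((shift p q).symm.trans e) (X.str x s) y := by
  rw [elt_str_left, ← Equiv.trans_assoc, Equiv.self_trans_symm, Equiv.refl_trans]
lemma elt_pt_left (e : Fin p ⊕ Fin q ≃ Fin n) (y : Y.seq.El q ℓ) :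
    elt e (X.seq.pt p ℓ) y = (smash X Y).seq.pt n ℓ := SmashEl.mk_pt_left e y
lemma elt_pt_right (e : Fin p ⊕ Fin q ≃ Fin n) (x : X.seq.El p ℓ) :
    elt e x (Y.seq.pt q ℓ) = (smash X Y).seq.pt n ℓ := SmashEl.mk_pt_right e x

lemma smash_hom_ext {f g : smash X Y ⟶ Z}
    (h : ∀ {p q n : ℕ} {ℓ} (e : Fin p ⊕ Fin q ≃ Fin n) (x : X.seq.El p ℓ) (y : Y.seq.El q ℓ),
      ap f (elt e x y) = ap g (elt e x y)) : f = g :=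
  hom_ext' fun w => by
    induction w using smash_ind with
    | h e x y => exact h e x y

/-- Bimorphisms `(X, Y) → Z` of symmetric spectra. The component at the standard bijection of
`{0, …, p-1} ⊔ {0, …, q-1}` with `{0, …, p+q-1}` is a map `X_p ∧ Y_q → Z_{p+q}`. -/
structure Bimorphism (X Y Z : SymmetricSpectrum.{u}) where
  /-- the components -/
  b : ∀ {p q n : ℕ} {ℓ : SimplexCategoryᵒᵖ}, (Fin p ⊕ Fin q ≃ Fin n) →
    X.seq.El p ℓ → Y.seq.El q ℓ → Z.seq.El n ℓ
  act_b : ∀ {p q n m : ℕ} {ℓ} (σ : Fin n ≃ Fin m) (e : Fin p ⊕ Fin q ≃ Fin n) (x : X.seq.El p ℓ)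
    (y : Y.seq.El q ℓ), Z.seq.act σ (b e x y) = b (e.trans σ) x y
  b_act : ∀ {p p' q q' n : ℕ} {ℓ} (τ : Fin p ≃ Fin p') (ρ : Fin q ≃ Fin q')
    (e : Fin p' ⊕ Fin q' ≃ Fin n) (x : X.seq.El p ℓ) (y : Y.seq.El q ℓ),
    b e (X.seq.act τ x) (Y.seq.act ρ y) = b ((Equiv.sumCongr τ ρ).trans e) x y
  b_pt_left : ∀ {p q n : ℕ} {ℓ} (e : Fin p ⊕ Fin q ≃ Fin n) (y : Y.seq.El q ℓ),
    b e (X.seq.pt p ℓ) y = Z.seq.pt n ℓ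
  b_pt_right : ∀ {p q n : ℕ} {ℓ} (e : Fin p ⊕ Fin q ≃ Fin n) (x : X.seq.El p ℓ),
    b e x (Y.seq.pt q ℓ) = Z.seq.pt n ℓ
  res_b : ∀ {p q n : ℕ} {ℓ₁ ℓ₂} (θ : ℓ₁ ⟶ ℓ₂) (e : Fin p ⊕ Fin q ≃ Fin n) (x : X.seq.El p ℓ₁)
    (y : Y.seq.El q ℓ₁), Z.seq.res θ (b e x y) = b e (X.seq.res θ x) (Y.seq.res θ y)
  str_b : ∀ {p q n : ℕ} {ℓ} (e : Fin p ⊕ Fin q ≃ Fin n) (x : X.seq.El p ℓ) (y : Y.seq.El q ℓ)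
    (s : S1 ℓ), Z.str (b e x y) s = b (extR e 1) x (Y.str y s)
  b_str : ∀ {p q n : ℕ} {ℓ} (e : Fin (p + 1) ⊕ Fin q ≃ Fin n) (x : X.seq.El p ℓ) (s : S1 ℓ)
    (y : Y.seq.El q ℓ), b e (X.str x s) y = b ((shift p q).trans e) x (Y.str y s)

/-- The map out of the smash product given by a bimorphism. -/
def desc (B : Bimorphism X Y Z) : smash X Y ⟶ Z :=
  homMk (X := smash X Y)
    (fun {n ℓ} => Quot.lift (fun a => B.b a.e a.x a.y) (by
      rintro _ _ (⟨τ, ρ, e, x, y⟩ | ⟨e, x, s, y⟩ | ⟨e, e', x, y⟩)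
      · exact (B.b_act τ ρ e x y).symm
      · exact B.b_str e x s y
      · exact (B.b_pt_left e y).trans (B.b_pt_right e' x).symm))
    (fun n ℓ => B.b_pt_left _ _)
    (fun σ w => by
      induction w using smash_ind with
      | h e x y => exact (B.act_b σ e x y).symm)
    (fun θ w => by
      induction w using smash_ind with
      | h e x y => exact (B.res_b θ e x y).symm)
    (fun w s => by
      induction w using smash_ind with
      | h e x y => exact (B.str_b e x y s).symm)

@[simp] lemma ap_desc (B : Bimorphism X Y Z) (e : Fin p ⊕ Fin q ≃ Fin n) (x : X.seq.El p ℓ)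
    (y : Y.seq.El q ℓ) : ap (desc B) (elt e x y) = B.b e x y := rfl

/-- Functoriality of the smash product. -/
def smashMap {X' Y' : SymmetricSpectrum.{u}} (f : X ⟶ X') (g : Y ⟶ Y') :
    smash X Y ⟶ smash X' Y' :=
  desc
    { b := fun e x y => elt e (ap f x) (ap g y)
      act_b := fun _ _ _ _ => rfl
      b_act := fun τ ρ e x y => by rw [ap_act, ap_act, elt_act]
      b_pt_left := fun e y => by rw [ap_pt, elt_pt_left]
      b_pt_right := fun e y => by rw [ap_pt, elt_pt_right]
      res_b := fun θ e x y => by rw [ap_res, ap_res, res_elt]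
      str_b := fun e x y s => by rw [ap_str, str_elt]
      b_str := fun e x s y => by rw [ap_str, ap_str, elt_str_left] }

@[simp] lemma ap_smashMap {X' Y' : SymmetricSpectrum.{u}} (f : X ⟶ X') (g : Y ⟶ Y')
    (e : Fin p ⊕ Fin q ≃ Fin n) (x : X.seq.El p ℓ) (y : Y.seq.El q ℓ) :
    ap (smashMap f g) (elt e x y) = elt e (ap f x) (ap g y) := rfl

/-- The symmetry of the smash product. -/
def swapHom (X Y : SymmetricSpectrum.{u}) : smash X Y ⟶ smash Y X :=
  desc
    { b := fun e x y => elt ((Equiv.sumComm _ _).trans e) y x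
      act_b := fun _ _ _ _ => rfl
      b_act := fun τ ρ e x y => by
        rw [elt_act]
        congr 1
        refine equiv_ext₁ (fun i => ?_) fun i => ?_ <;> simp
      b_pt_left := fun e y => by rw [elt_pt_right]
      b_pt_right := fun e y => by rw [elt_pt_left]
      res_b := fun θ e x y => by rw [res_elt]
      str_b := fun e x y s => by
        rw [str_elt, elt_str_left]
        congr 1
        refine equiv_ext₂ (fun i => ?_) (fun i => ?_) fun i => ?_ <;> simp
      b_str := fun e x s y => by
        rw [elt_str_left]
        congr 1
        refine equiv_ext₂ (fun i => ?_) (fun i => ?_) fun i => ?_ <;> simp }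

@[simp] lemma ap_swapHom (e : Fin p ⊕ Fin q ≃ Fin n) (x : X.seq.El p ℓ) (y : Y.seq.El q ℓ) :
    ap (swapHom X Y) (elt e x y) = elt ((Equiv.sumComm _ _).trans e) y x := rfl

lemma swapHom_swapHom (X Y : SymmetricSpectrum.{u}) : swapHom X Y ≫ swapHom Y X = 𝟙 _ :=
  smash_hom_ext fun e x y => by
    rw [ap_comp, ap_swapHom, ap_swapHom, ap_id]
    congr 1
    refine equiv_ext₁ (fun i => ?_) fun i => ?_ <;> simp

/-- The symmetry isomorphism. -/
def swapIso (X Y : SymmetricSpectrum.{u}) : smash X Y ≅ smash Y X where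
  hom := swapHom X Y
  inv := swapHom Y X
  hom_inv_id := swapHom_swapHom X Y
  inv_hom_id := swapHom_swapHom Y X

/-- The element `x ∧ (y ∧ z)`. -/
def tri (e : Fin p ⊕ (Fin q ⊕ Fin r) ≃ Fin n) (x : X.seq.El p ℓ) (y : Y.seq.El q ℓ)
    (z : Z.seq.El r ℓ) : (smash X (smash Y Z)).seq.El n ℓ :=
  elt ((Equiv.sumCongr (Equiv.refl _) finSumFinEquiv.symm).trans e) x (elt finSumFinEquiv y z)

lemma elt_elt (e : Fin p ⊕ Fin m ≃ Fin n) (e' : Fin q ⊕ Fin r ≃ Fin m) (x : X.seq.El p ℓ)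
    (y : Y.seq.El q ℓ) (z : Z.seq.El r ℓ) :
    elt e x (elt e' y z) = tri ((Equiv.sumCongr (Equiv.refl _) e').trans e) x y z := by
  have h : elt e' y z = (smash Y Z).seq.act (finSumFinEquiv.symm.trans e')
      (elt finSumFinEquiv y z) := by
    rw [act_elt, ← Equiv.trans_assoc, Equiv.self_trans_symm, Equiv.refl_trans]
  rw [h, elt_act_right, tri]
  congr 1
  refine equiv_ext₁ (fun i => ?_) fun i => ?_ <;> simp

lemma act_tri (σ : Fin n ≃ Fin m) (e : Fin p ⊕ (Fin q ⊕ Fin r) ≃ Fin n) (x : X.seq.El p ℓ)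
    (y : Y.seq.El q ℓ) (z : Z.seq.El r ℓ) :
    (smash X (smash Y Z)).seq.act σ (tri e x y z) = tri (e.trans σ) x y z := rfl

lemma tri_act {p' q' r' : ℕ} (τ : Fin p ≃ Fin p') (ρ : Fin q ≃ Fin q') (υ : Fin r ≃ Fin r')
    (e : Fin p' ⊕ (Fin q' ⊕ Fin r') ≃ Fin n) (x : X.seq.El p ℓ) (y : Y.seq.El q ℓ)
    (z : Z.seq.El r ℓ) :
    tri e (X.seq.act τ x) (Y.seq.act ρ y) (Z.seq.act υ z) =
      tri ((Equiv.sumCongr τ (Equiv.sumCongr ρ υ)).trans e) x y z := by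
  rw [tri, elt_act, elt_act_left, elt_elt]
  congr 1
  ext (i | i | i) <;> simp

lemma res_tri (θ : ℓ₁ ⟶ ℓ₂) (e : Fin p ⊕ (Fin q ⊕ Fin r) ≃ Fin n) (x : X.seq.El p ℓ₁)
    (y : Y.seq.El q ℓ₁) (z : Z.seq.El r ℓ₁) :
    (smash X (smash Y Z)).seq.res θ (tri e x y z) =
      tri e (X.seq.res θ x) (Y.seq.res θ y) (Z.seq.res θ z) := rfl

lemma tri_pt₁ (e : Fin p ⊕ (Fin q ⊕ Fin r) ≃ Fin n) (y : Y.seq.El q ℓ) (z : Z.seq.El r ℓ) :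
    tri e (X.seq.pt p ℓ) y z = (smash X (smash Y Z)).seq.pt n ℓ := by
  rw [tri, elt_pt_left]
lemma tri_pt₂ (e : Fin p ⊕ (Fin q ⊕ Fin r) ≃ Fin n) (x : X.seq.El p ℓ) (z : Z.seq.El r ℓ) :
    tri e x (Y.seq.pt q ℓ) z = (smash X (smash Y Z)).seq.pt n ℓ := by
  rw [tri, elt_pt_left, elt_pt_right]
lemma tri_pt₃ (e : Fin p ⊕ (Fin q ⊕ Fin r) ≃ Fin n) (x : X.seq.El p ℓ) (y : Y.seq.El q ℓ) :
    tri e x y (Z.seq.pt r ℓ) = (smash X (smash Y Z)).seq.pt n ℓ := by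
  rw [tri, elt_pt_right, elt_pt_right]

/-- The bijection that adds a new point at the end of the third summand and of the target. -/
def extR₃ (e : Fin p ⊕ (Fin q ⊕ Fin r) ≃ Fin n) :
    Fin p ⊕ (Fin q ⊕ Fin (r + 1)) ≃ Fin (n + 1) :=
  (Equiv.sumCongr (Equiv.refl _) (extR finSumFinEquiv 1)).trans
    (extR ((Equiv.sumCongr (Equiv.refl _) finSumFinEquiv.symm).trans e) 1)

@[simp] lemma extR₃_1 (e : Fin p ⊕ (Fin q ⊕ Fin r) ≃ Fin n) (i) :
    extR₃ e (Sum.inl i) = Fin.castAdd 1 (e (Sum.inl i)) := by simp [extR₃]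
@[simp] lemma extR₃_2 (e : Fin p ⊕ (Fin q ⊕ Fin r) ≃ Fin n) (i) :
    extR₃ e (Sum.inr (Sum.inl i)) = Fin.castAdd 1 (e (Sum.inr (Sum.inl i))) := by
  simp only [extR₃, Equiv.trans_apply, Equiv.sumCongr_apply, Sum.map_inr, extR_inl, extR_castAdd,
    finSumFinEquiv_apply_left, finSumFinEquiv_symm_apply_castAdd]
@[simp] lemma extR₃_3 (e : Fin p ⊕ (Fin q ⊕ Fin r) ≃ Fin n) (i) :
    extR₃ e (Sum.inr (Sum.inr (Fin.castAdd 1 i))) =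
      Fin.castAdd 1 (e (Sum.inr (Sum.inr i))) := by
  simp only [extR₃, Equiv.trans_apply, Equiv.sumCongr_apply, Sum.map_inr, extR_castAdd,
    finSumFinEquiv_apply_right, finSumFinEquiv_symm_apply_natAdd]
@[simp] lemma extR₃_4 (e : Fin p ⊕ (Fin q ⊕ Fin r) ≃ Fin n) (i) :
    extR₃ e (Sum.inr (Sum.inr (Fin.natAdd r i))) = Fin.natAdd n i := by
  simp only [extR₃, Equiv.trans_apply, Equiv.sumCongr_apply, Sum.map_inr, extR_natAdd]

lemma str_tri (e : Fin p ⊕ (Fin q ⊕ Fin r) ≃ Fin n) (x : X.seq.El p ℓ) (y : Y.seq.El q ℓ)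
    (z : Z.seq.El r ℓ) (s : S1 ℓ) :
    (smash X (smash Y Z)).str (tri e x y z) s = tri (extR₃ e) x y (Z.str z s) := by
  rw [tri, str_elt, str_elt, elt_elt, extR₃]

lemma tri_str₂ (e : Fin p ⊕ (Fin (q + 1) ⊕ Fin r) ≃ Fin n) (x : X.seq.El p ℓ) (y : Y.seq.El q ℓ)
    (z : Z.seq.El r ℓ) (s : S1 ℓ) :
    tri e x (Y.str y s) z =
      tri ((Equiv.sumCongr (Equiv.refl _) (shift q r)).trans e) x y (Z.str z s) := by
  rw [tri, elt_str_left, elt_elt]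
  congr 1
  ext (i | i | i) <;> simp

lemma tri_str₁ (e : Fin (p + 1) ⊕ (Fin q ⊕ Fin r) ≃ Fin n) (x : X.seq.El p ℓ) (y : Y.seq.El q ℓ)
    (z : Z.seq.El r ℓ) (s : S1 ℓ) :
    tri e (X.str x s) y z =
      tri ((Equiv.sumAssoc _ _ _).symm.trans ((Equiv.sumCongr (Equiv.sumComm _ _)
        (Equiv.refl _)).trans ((Equiv.sumAssoc _ _ _).trans ((Equiv.sumCongr (Equiv.refl _)
          (shift p r)).trans ((Equiv.sumAssoc _ _ _).symm.trans ((Equiv.sumCongr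
            (Equiv.sumComm _ _) (Equiv.refl _)).trans
              ((Equiv.sumAssoc _ _ _).trans e))))))) x y (Z.str z s) := by
  rw [tri, elt_str_left, str_elt, elt_elt]
  congr 1
  refine Equiv.ext ?_
  rintro (i | i | i)
  · simp
  · simp
  · refine Fin.addCases (fun i => ?_) (fun i => ?_) i <;> simp

/-- The associativity of the smash product. -/
def assocHom (X Y Z : SymmetricSpectrum.{u}) : smash (smash X Y) Z ⟶ smash X (smash Y Z) :=
  desc
    { b := fun {m r n ℓ} e w z => Quot.lift (fun a : SmashGen X Y m ℓ =>
        tri ((Equiv.sumAssoc _ _ _).symm.trans ((Equiv.sumCongr a.e (Equiv.refl _)).trans e))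
          a.x a.y z) (by
        rintro _ _ (⟨τ, ρ, e', x, y⟩ | ⟨e', x, s, y⟩ | ⟨e', e'', x, y⟩)
        · have h := tri_act τ ρ (Equiv.refl _) ((Equiv.sumAssoc _ _ _).symm.trans
            ((Equiv.sumCongr e' (Equiv.refl _)).trans e)) x y z
          rw [SymSeq.act_refl] at h
          refine Eq.trans ?_ h.symm
          congr 1
          ext (i | i | i) <;> simp
        · refine (tri_str₁ _ x y z s).trans (Eq.trans ?_ (tri_str₂ _ x y z s).symm)
          congr 1
          refine Equiv.ext ?_
          rintro (i | i | i)
          · simp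
          · simp
          · refine Fin.addCases (fun i => ?_) (fun i => ?_) i <;> simp
        · exact (tri_pt₁ _ _ _).trans (tri_pt₂ _ _ _).symm) w
      act_b := fun σ e w z => by
        induction w using smash_ind with
        | h e' x y => rfl
      b_act := fun τ ρ e w z => by
        induction w using smash_ind with
        | h e' x y =>
        have h := tri_act (Equiv.refl _) (Equiv.refl _) ρ ((Equiv.sumAssoc _ _ _).symm.trans
            ((Equiv.sumCongr (e'.trans τ) (Equiv.refl _)).trans e)) x y z
        rw [SymSeq.act_refl, SymSeq.act_refl] at h
        refine Eq.trans h ?_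
        refine congrArg (fun E => tri E x y z) ?_
        ext (i | i | i) <;> simp
      b_pt_left := fun e z => tri_pt₁ _ _ _
      b_pt_right := fun e w => by
        induction w using smash_ind with
        | h e' x y => exact tri_pt₃ _ _ _
      res_b := fun θ e w z => by
        induction w using smash_ind with
        | h e' x y => rfl
      str_b := fun e w z s => by
        induction w using smash_ind with
        | h e' x y =>
        refine (str_tri _ x y z s).trans (congrArg (fun E => tri E x y (Z.str z s)) ?_)
        refine Equiv.ext ?_
        rintro (i | i | i)
        · simp
        · simp
        · refine Fin.addCases (fun i => ?_) (fun i => ?_) i <;> simp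
      b_str := fun e w s z => by
        induction w using smash_ind with
        | h e' x y =>
        refine (tri_str₂ _ x y z s).trans (congrArg (fun E => tri E x y (Z.str z s)) ?_)
        refine Equiv.ext ?_
        rintro (i | i | i)
        · simp
        · simp
        · refine Fin.addCases (fun i => ?_) (fun i => ?_) i <;> simp }

lemma ap_assocHom (e : Fin m ⊕ Fin r ≃ Fin n) (e' : Fin p ⊕ Fin q ≃ Fin m) (x : X.seq.El p ℓ)
    (y : Y.seq.El q ℓ) (z : Z.seq.El r ℓ) :
    ap (assocHom X Y Z) (elt e (elt e' x y) z) =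
      tri ((Equiv.sumAssoc _ _ _).symm.trans ((Equiv.sumCongr e' (Equiv.refl _)).trans e)) x y z :=
  rfl

end SymmetricSpectrum

namespace Sph

variable {n m l p k : ℕ} {ℓ ℓ₁ ℓ₂ : SimplexCategoryᵒᵖ}

lemma act_refl (x : Sph n ℓ) : act (Equiv.refl _) x = x := by
  induction x using ind <;> rfl

lemma act_act (e : Fin n ≃ Fin m) (e₁ : Fin m ≃ Fin l) (x : Sph n ℓ) :
    act e₁ (act e x) = act (e.trans e₁) x := by
  induction x using ind <;> rfl

lemma res_id (x : Sph n ℓ) : res (𝟙 ℓ) x = x := by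
  induction x using ind with
  | h0 => rfl
  | h1 t => exact congrArg mk (funext fun i => S1.res_id (t i))

lemma res_comp (θ : ℓ ⟶ ℓ₁) (η : ℓ₁ ⟶ ℓ₂) (x : Sph n ℓ) : res (θ ≫ η) x = res η (res θ x) := by
  induction x using ind with
  | h0 => rfl
  | h1 t => exact congrArg mk (funext fun i => S1.res_comp θ η (t i))

lemma res_act (θ : ℓ₁ ⟶ ℓ₂) (e : Fin n ≃ Fin m) (x : Sph n ℓ₁) :
    res θ (act e x) = act e (res θ x) := by
  induction x using ind <;> rfl

/-- The symmetric sequence of spheres. -/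
@[reducible] def seq : SymSeq.{u} :=
  SymSeq.ofData (fun n ℓ => ULift.{u} (Sph n ℓ)) (fun n ℓ => ⟨pt n ℓ⟩)
    (fun e x => ⟨act e x.down⟩) (fun θ x => ⟨res θ x.down⟩)
    (fun _ => rfl) (fun x => ULift.ext _ _ (act_refl x.down))
    (fun e e₁ x => ULift.ext _ _ (act_act e e₁ x.down))
    (fun _ => rfl) (fun x => ULift.ext _ _ (res_id x.down))
    (fun θ η x => ULift.ext _ _ (res_comp θ η x.down))
    (fun θ e x => ULift.ext _ _ (res_act θ e x.down))

/-- The structure maps `S^m ∧ S¹ → S^{m+1}`. -/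
def str (x : ULift.{u} (Sph m ℓ)) (s : S1 ℓ) : ULift.{u} (Sph (m + 1) ℓ) :=
  ⟨smash x.down (mk fun _ : Fin 1 => s)⟩

lemma iterStr_pt (t : Fin k → S1 ℓ) :
    iterStr seq.{u} str (⟨pt m ℓ⟩ : ULift.{u} (Sph m ℓ)) t = ⟨pt (m + k) ℓ⟩ := by
  induction k with
  | zero => rfl
  | succ k ih => exact (congrArg (fun w => str w (t (Fin.last k))) (ih _)).trans rfl

lemma iterStr_mk (u : Fin m → S1 ℓ) (t : Fin k → S1 ℓ) :
    iterStr seq.{u} str (⟨mk u⟩ : ULift.{u} (Sph m ℓ)) t = ⟨mk (Fin.append u t)⟩ := by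
  induction k with
  | zero =>
    have h : (Fin.append u t : Fin m → S1 ℓ) = u := funext fun i => Fin.append_left u t i
    exact ULift.ext _ _ (congrArg mk h.symm)
  | succ k ih =>
    refine (congrArg (fun w => str w (t (Fin.last k))) (ih _)).trans ?_
    refine ULift.ext _ _ (congrArg mk (funext fun i => ?_))
    refine Fin.addCases (m := m + k) (n := 1) (fun i => ?_) (fun i => ?_) i
    · refine (Fin.append_left _ _ i).trans ?_
      refine Fin.addCases (fun i => ?_) (fun i => ?_) i
      · exact (Fin.append_left _ _ i).trans (Fin.append_left u t i).symm
      · exact (Fin.append_right _ _ i).trans (Fin.append_right u t i.castSucc).symm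
    · have hi : i = Fin.last 0 := Subsingleton.elim _ _
      subst hi
      exact (Fin.append_right _ _ _).trans (Fin.append_right u t (Fin.last k)).symm

end Sph

/-- The sphere spectrum `(S⁰, S¹, S², …)`. -/
def sphereSpectrum : SymmetricSpectrum.{u} where
  seq := Sph.seq
  str := Sph.str
  str_pt_left {m ℓ} s := ULift.ext _ _ (Sph.pt_smash (p := m) (Sph.mk fun _ : Fin 1 => s))
  str_pt_right x := ULift.ext _ _ (by
    obtain ⟨x⟩ := x
    induction x using Sph.ind with
    | h0 => rfl
    | h1 t => exact Sph.mk_eq_pt _ (Fin.natAdd _ 0) (Fin.append_right _ _ _))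
  res_str θ x s := ULift.ext _ _ (by
    obtain ⟨x⟩ := x
    induction x using Sph.ind with
    | h0 => rfl
    | h1 t =>
      refine congrArg Sph.mk (funext fun i => ?_)
      refine Fin.addCases (fun i => ?_) (fun i => ?_) i
      · exact (congrArg (S1.res θ) (Fin.append_left _ _ i)).trans (Fin.append_left (S1.res θ ∘ t) (fun _ => S1.res θ s) i).symm
      · exact (congrArg (S1.res θ) (Fin.append_right _ _ i)).trans 
          (Fin.append_right (S1.res θ ∘ t) (fun _ => S1.res θ s) i).symm)
  act_iterStr τ ρ x t := by
    obtain ⟨x⟩ := x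
    induction x using Sph.ind with
    | h0 => rw [Sph.iterStr_pt]; exact (Sph.iterStr_pt _).symm
    | h1 u =>
      rw [Sph.iterStr_mk]
      refine Eq.trans ?_ (Sph.iterStr_mk (u ∘ τ.symm) (t ∘ ρ.symm)).symm
      refine ULift.ext _ _ (congrArg Sph.mk (funext fun i => ?_))
      refine Fin.addCases (fun i => ?_) (fun i => ?_) i <;> simp

namespace SymmetricSpectrum

variable {X Y Z W : SymmetricSpectrum.{u}} {m n p q r k j l : ℕ} {ℓ ℓ₁ ℓ₂ : SimplexCategoryᵒᵖ}

/-- The simplex `t₁ ∧ ⋯ ∧ tₙ` of the sphere spectrum. -/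
def sph (t : Fin n → S1 ℓ) : sphereSpectrum.{u}.seq.El n ℓ := ULift.up (Sph.mk t)

lemma sphere_ind {P : sphereSpectrum.{u}.seq.El n ℓ → Prop}
    (h0 : P (sphereSpectrum.{u}.seq.pt n ℓ)) (h1 : ∀ t, P (sph t)) (x) : P x := by
  obtain ⟨x⟩ := x
  induction x using Sph.ind with
  | h0 => exact h0
  | h1 t => exact h1 t

lemma act_sph (e : Fin n ≃ Fin m) (t : Fin n → S1 ℓ) :
    sphereSpectrum.{u}.seq.act e (sph t) = sph (t ∘ e.symm) := rfl
lemma res_sph (θ : ℓ₁ ⟶ ℓ₂) (t : Fin n → S1 ℓ₁) :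
    sphereSpectrum.{u}.seq.res θ (sph t) = sph (S1.res θ ∘ t) := rfl
lemma str_sph (t : Fin n → S1 ℓ) (s : S1 ℓ) :
    sphereSpectrum.{u}.str (sph t) s = sph (Fin.append t fun _ : Fin 1 => s) := rfl
lemma iter_sph (u : Fin m → S1 ℓ) (t : Fin k → S1 ℓ) :
    sphereSpectrum.{u}.iter (sph u) t = sph (Fin.append u t) := Sph.iterStr_mk u t
lemma sph_eq_pt (t : Fin n → S1 ℓ) (i : Fin n) (h : t i = S1.pt ℓ) :
    sph t = sphereSpectrum.{u}.seq.pt n ℓ := ULift.ext _ _ (Sph.mk_eq_pt t i h)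

/-- The action of the sphere spectrum on a symmetric spectrum. -/
def unitAct (X : SymmetricSpectrum.{u}) (e : Fin m ⊕ Fin k ≃ Fin n) (x : X.seq.El m ℓ)
    (t : sphereSpectrum.{u}.seq.El k ℓ) : X.seq.El n ℓ :=
  Sph.lift (X.seq.pt n ℓ) (fun t => X.lam e x t) (fun t i h => lam_eq_pt e x t i h) t.down

lemma unitAct_pt (e : Fin m ⊕ Fin k ≃ Fin n) (x : X.seq.El m ℓ) :
    X.unitAct e x (sphereSpectrum.{u}.seq.pt k ℓ) = X.seq.pt n ℓ := rfl
lemma unitAct_sph (e : Fin m ⊕ Fin k ≃ Fin n) (x : X.seq.El m ℓ) (t : Fin k → S1 ℓ) :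
    X.unitAct e x (sph t) = X.lam e x t := rfl

/-- The map `S ∧ X → X`. -/
def unitorHom (X : SymmetricSpectrum.{u}) : smash sphereSpectrum.{u} X ⟶ X :=
  desc
    { b := fun e t x => X.unitAct ((Equiv.sumComm _ _).trans e) x t
      act_b := fun σ e t x => by
        induction t using sphere_ind with
        | h0 => simp [unitAct_pt]
        | h1 t => rw [unitAct_sph, unitAct_sph, act_lam, Equiv.trans_assoc]
      b_act := fun τ ρ e t x => by
        induction t using sphere_ind with
        | h0 => simp [unitAct_pt]
        | h1 t =>
          rw [act_sph, unitAct_sph, lam_act, unitAct_sph]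
          congr 1
          refine equiv_ext₁ (fun i => ?_) fun i => ?_ <;> simp
      b_pt_left := fun e x => rfl
      b_pt_right := fun e t => by
        induction t using sphere_ind with
        | h0 => rfl
        | h1 t => rw [unitAct_sph, lam_pt]
      res_b := fun θ e t x => by
        induction t using sphere_ind with
        | h0 => simp [unitAct_pt]
        | h1 t => rw [unitAct_sph, res_lam, res_sph, unitAct_sph]
      str_b := fun e t x s => by
        induction t using sphere_ind with
        | h0 => rw [unitAct_pt, unitAct_pt, str_pt_left]
        | h1 t =>
          rw [unitAct_sph, unitAct_sph, str_eq_lam, str_eq_lam, lam_lam, lam_lam, lam₂_swap]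
          refine congrArg (fun E => X.lam₂ E x _ _) ?_
          ext (i | i | i) <;> simp
      b_str := fun e t s x => by
        induction t using sphere_ind with
        | h0 => rw [str_pt_left, unitAct_pt, unitAct_pt]
        | h1 t =>
          rw [str_sph, unitAct_sph, unitAct_sph, str_eq_lam, lam_lam, lam_append, lam₂_swap]
          refine congrArg (fun E => X.lam₂ E x _ _) ?_
          ext (i | i | i) <;> simp }

lemma ap_unitorHom (e : Fin p ⊕ Fin q ≃ Fin n) (t : Fin p → S1 ℓ) (x : X.seq.El q ℓ) :
    ap (unitorHom X) (elt e (sph t) x) = X.lam ((Equiv.sumComm _ _).trans e) x t := rfl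

/-- The map `X → S ∧ X`. -/
def unitorInv (X : SymmetricSpectrum.{u}) : X ⟶ smash sphereSpectrum.{u} X :=
  homMk (Y := smash sphereSpectrum.{u} X)
    (fun {n ℓ} x => elt (Equiv.emptySum (Fin 0) (Fin n)) (sph Fin.elim0) x)
    (fun n ℓ => elt_pt_right _ _)
    (fun e x => by
      have h := elt_act_right e (Equiv.emptySum (Fin 0) _)
        (sph Fin.elim0 : sphereSpectrum.{u}.seq.El 0 _) x
      rw [h, act_elt]
      congr 1
      refine equiv_ext₁ (fun i => i.elim0) fun i => ?_
      simp)
    (fun θ x => by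
      rw [res_elt, res_sph]
      congr 2
      exact funext fun i => i.elim0)
    (fun x s => by
      rw [str_elt]
      congr 1
      refine equiv_ext₂ (fun i => i.elim0) (fun i => ?_) fun i => ?_ <;> simp)

lemma ap_unitorInv (x : X.seq.El n ℓ) :
    ap (unitorInv X) x = elt (Equiv.emptySum (Fin 0) (Fin n)) (sph Fin.elim0) x := rfl

lemma elt_iter (e : Fin p ⊕ Fin (q + k) ≃ Fin n) (x : X.seq.El p ℓ) (y : Y.seq.El q ℓ)
    (t : Fin k → S1 ℓ) : elt e x (Y.iter y t) =
      elt (((Equiv.sumCongr finSumFinEquiv.symm (Equiv.refl _)).trans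
        ((Equiv.sumAssoc _ _ _).trans (Equiv.sumCongr (Equiv.refl _) ((Equiv.sumComm _ _).trans
          finSumFinEquiv)))).trans e) (X.iter x t) y := by
  induction k generalizing p with
  | zero =>
    rw [iter_zero]
    refine congrArg (fun E => elt E x y) ?_
    refine equiv_ext₁ (fun i => ?_) fun i => ?_
    · have h : (finSumFinEquiv.symm : Fin (p + 0) ≃ Fin p ⊕ Fin 0) i = Sum.inl i :=
        finSumFinEquiv_symm_apply_castAdd (n := 0) i
      simp [h]
    · simp
      rfl
  | succ k ih =>
    rw [iter_succ]
    refine (elt_str_right (q := q + k) e x (t (Fin.last k)) _).trans ?_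
    rw [ih]
    have h : X.iter (X.str x (t (Fin.last k))) (fun i => t i.castSucc) =
        X.seq.act (blockSwap p 1 k) (X.iter (m := p) (k := k + 1) x t) :=
      X.iter_iter_swap x (fun _ : Fin 1 => t (Fin.last k)) (fun i => t i.castSucc)
    rw [h, elt_act_left]
    refine congrArg (fun E => elt E (X.iter x t) y) ?_
    refine equiv_ext₁ (fun i => ?_) fun i => ?_
    · refine Fin.addCases (m := p + k) (n := 1) (fun i => ?_) (fun i => ?_) i
      · refine Fin.addCases (fun i => ?_) (fun i => ?_) i
        · have h1 : (finSumFinEquiv.symm : Fin (p + (k + 1)) ≃ Fin p ⊕ Fin (k + 1))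
              (Fin.castAdd 1 (Fin.castAdd k i)) = Sum.inl i :=
            finSumFinEquiv_symm_apply_castAdd (n := k + 1) i
          simp [h1]
        · have h1 : (finSumFinEquiv.symm : Fin (p + (k + 1)) ≃ Fin p ⊕ Fin (k + 1))
              (Fin.castAdd 1 (Fin.natAdd p i)) = Sum.inr (Fin.castAdd 1 i) :=
            finSumFinEquiv_symm_apply_natAdd (n := k + 1) i.castSucc
          have h2 : (finSumFinEquiv (Sum.inr (Fin.castAdd 1 i)) : Fin (q + (k + 1))) =
            Fin.castAdd 1 (Fin.natAdd q i) := rfl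
          simp [h1, h2]
      · have h1 : (finSumFinEquiv.symm : Fin (p + (k + 1)) ≃ Fin p ⊕ Fin (k + 1))
            (Fin.natAdd (p + k) i) = Sum.inr (Fin.natAdd k i) := by
          have hi : i = Fin.last 0 := Subsingleton.elim _ _
          subst hi
          exact finSumFinEquiv_symm_apply_natAdd (n := k + 1) (Fin.last k)
        have h2 : (finSumFinEquiv (Sum.inr (Fin.natAdd k i)) : Fin (q + (k + 1))) =
            Fin.natAdd (q + k) i := Fin.ext (by simp)
        simp [h1, h2]
    · have h2 : (finSumFinEquiv (Sum.inl i) : Fin (q + (k + 1))) =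
            Fin.castAdd 1 (Fin.castAdd k i) := rfl
      simp [h2]

lemma elt_lam (e : Fin p ⊕ Fin m ≃ Fin n) (e' : Fin q ⊕ Fin k ≃ Fin m) (x : X.seq.El p ℓ)
    (y : Y.seq.El q ℓ) (t : Fin k → S1 ℓ) : elt e x (Y.lam e' y t) =
      elt (((Equiv.sumCongr finSumFinEquiv.symm (Equiv.refl _)).trans
        ((Equiv.sumAssoc _ _ _).trans (Equiv.sumCongr (Equiv.refl _) ((Equiv.sumComm _ _).trans
          e')))).trans e) (X.iter x t) y := by
  rw [lam, elt_act_right, elt_iter]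
  congr 1
  refine equiv_ext₃ (fun i => ?_) (fun i => ?_) fun i => ?_ <;> simp

/-- The isomorphism `S ∧ X ≅ X`. -/
def unitorIso (X : SymmetricSpectrum.{u}) : smash sphereSpectrum.{u} X ≅ X where
  hom := unitorHom X
  inv := unitorInv X
  hom_inv_id := smash_hom_ext fun {p q n ℓ} e t x => by
    induction t using sphere_ind with
    | h0 => rw [elt_pt_left, ap_pt, ap_pt]
    | h1 t =>
      rw [ap_comp, ap_unitorHom, ap_unitorInv, elt_lam, iter_sph, ap_id]
      have h : sph.{u} (Fin.append Fin.elim0 t) =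
          sphereSpectrum.{u}.seq.act (finCongr (Nat.zero_add p).symm) (sph t) := by
        rw [act_sph, Fin.elim0_append]
        rfl
      rw [h, elt_act_left]
      congr 1
      refine equiv_ext₁ (fun i => ?_) fun i => ?_
      · have hi : Fin.cast (Nat.zero_add p).symm i = Fin.natAdd 0 i := Fin.ext (by simp)
        simp only [Equiv.trans_apply, Equiv.sumCongr_apply, Sum.map_inl, finCongr_apply, hi,
          finSumFinEquiv_symm_apply_natAdd]
        simp
      · simp
  inv_hom_id := hom_ext' fun x => by
    rw [ap_comp, ap_unitorInv, ap_unitorHom, lam_zero, ap_id]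
    refine Eq.trans ?_ (X.seq.act_refl x)
    congr 1

/-- The element `(x ∧ y) ∧ z`. -/
def tri' (e : (Fin p ⊕ Fin q) ⊕ Fin r ≃ Fin n) (x : X.seq.El p ℓ) (y : Y.seq.El q ℓ)
    (z : Z.seq.El r ℓ) : (smash (smash X Y) Z).seq.El n ℓ :=
  elt ((Equiv.sumCongr finSumFinEquiv.symm (Equiv.refl _)).trans e) (elt finSumFinEquiv x y) z

lemma elt_elt' (e : Fin m ⊕ Fin r ≃ Fin n) (e' : Fin p ⊕ Fin q ≃ Fin m) (x : X.seq.El p ℓ)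
    (y : Y.seq.El q ℓ) (z : Z.seq.El r ℓ) :
    elt e (elt e' x y) z = tri' ((Equiv.sumCongr e' (Equiv.refl _)).trans e) x y z := by
  have h : elt e' x y = (smash X Y).seq.act (finSumFinEquiv.symm.trans e')
      (elt finSumFinEquiv x y) := by
    rw [act_elt, ← Equiv.trans_assoc, Equiv.self_trans_symm, Equiv.refl_trans]
  rw [h, elt_act_left, tri']
  congr 1
  refine equiv_ext₁ (fun i => ?_) fun i => ?_ <;> simp

/-- Associativity isomorphism. -/
def assocIso (X Y Z : SymmetricSpectrum.{u}) :
    smash (smash X Y) Z ≅ smash X (smash Y Z) where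
  hom := assocHom X Y Z
  inv := swapHom X (smash Y Z) ≫ smashMap (swapHom Y Z) (𝟙 X) ≫ assocHom Z Y X ≫
    swapHom Z (smash Y X) ≫ smashMap (swapHom Y X) (𝟙 Z)
  hom_inv_id := smash_hom_ext fun e w z => by
    induction w using smash_ind with
    | h e' x y =>
    simp only [ap_comp, ap_assocHom, tri, ap_swapHom, ap_smashMap, ap_id]
    rw [elt_elt']
    rw [elt_elt']
    refine congrArg (fun E => tri' E x y z) ?_
    ext ((i | i) | i) <;> simp
  inv_hom_id := smash_hom_ext fun e x w => by
    induction w using smash_ind with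
    | h e' y z =>
    simp only [ap_comp, ap_assocHom, tri, ap_swapHom, ap_smashMap, ap_id]
    rw [elt_elt, elt_elt]
    refine congrArg (fun E => tri E x y z) ?_
    ext (i | i | i) <;> simp

lemma ap_assoc_tri' (e : (Fin p ⊕ Fin q) ⊕ Fin r ≃ Fin n) (x : X.seq.El p ℓ)
    (y : Y.seq.El q ℓ) (z : Z.seq.El r ℓ) :
    ap (assocHom X Y Z) (tri' e x y z) = tri ((Equiv.sumAssoc _ _ _).symm.trans e) x y z := by
  rw [tri', ap_assocHom]
  congr 1
  ext (i | i | i) <;> simp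

lemma ap_assocIso_inv (e : Fin p ⊕ (Fin q ⊕ Fin r) ≃ Fin n) (x : X.seq.El p ℓ)
    (y : Y.seq.El q ℓ) (z : Z.seq.El r ℓ) :
    ap (assocIso X Y Z).inv (tri e x y z) = tri' ((Equiv.sumAssoc _ _ _).trans e) x y z := by
  have h : tri e x y z = ap (assocIso X Y Z).hom (tri' ((Equiv.sumAssoc _ _ _).trans e) x y z) := by
    refine Eq.trans ?_ (ap_assoc_tri' _ x y z).symm
    rw [← Equiv.trans_assoc, Equiv.symm_trans_self, Equiv.refl_trans]
  rw [h, ← ap_comp, Iso.hom_inv_id, ap_id]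

/-- The smash product makes symmetric spectra into a monoidal category with unit the sphere
spectrum. -/
instance : MonoidalCategory SymmetricSpectrum.{u} where
  tensorObj := smash
  whiskerLeft X _ _ f := smashMap (𝟙 X) f
  whiskerRight f Y := smashMap f (𝟙 Y)
  tensorHom f g := smashMap f g
  tensorUnit := sphereSpectrum
  associator := assocIso
  leftUnitor := unitorIso
  rightUnitor X := swapIso X sphereSpectrum ≪≫ unitorIso X
  tensorHom_def f g := smash_hom_ext fun e x y => rfl
  id_tensorHom_id X Y := smash_hom_ext fun e x y => rfl
  tensorHom_comp_tensorHom f f' g g' := smash_hom_ext fun e x y => rfl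
  whiskerLeft_id X Y := smash_hom_ext fun e x y => rfl
  id_whiskerRight X Y := smash_hom_ext fun e x y => rfl
  associator_naturality f g h := smash_hom_ext fun e w z => by
    induction w using smash_ind with
    | h e' x y => rfl
  leftUnitor_naturality f := smash_hom_ext fun e t x => by
    induction t using sphere_ind with
    | h0 => rw [elt_pt_left, ap_pt, ap_pt]
    | h1 t => exact (ap_lam f _ x t).symm
  rightUnitor_naturality f := smash_hom_ext fun e x t => by
    induction t using sphere_ind with
    | h0 => rw [elt_pt_right, ap_pt, ap_pt]
    | h1 t => exact (ap_lam f
        ((Equiv.sumComm _ _).trans ((Equiv.sumComm _ _).trans e)) x t).symm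
  pentagon X Y Z W := smash_hom_ext fun e v w => by
    induction v using smash_ind with
    | h e' v z =>
    induction v using smash_ind with
    | h e'' x y =>
    change ap (smashMap (𝟙 X) (assocHom Y Z W)) (ap (assocHom X (smash Y Z) W)
      (elt e (ap (assocHom X Y Z) (elt e' (elt e'' x y) z)) w)) =
      ap (assocHom X Y (smash Z W)) (ap (assocHom (smash X Y) Z W)
        (elt e (elt e' (elt e'' x y) z) w))
    rw [ap_assocHom, ap_assocHom, tri, tri, ap_assocHom, ap_assocHom, tri, tri, ap_smashMap,
      ap_assocHom, tri, ap_id, elt_elt, tri]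
    congr 1
    refine equiv_ext₂ (fun i => ?_) (fun i => ?_) fun i => ?_
    · simp
    · simp
    · refine Fin.addCases (fun i => ?_) (fun i => ?_) i <;> simp
  triangle X Y := smash_hom_ext fun e w y => by
    induction w using smash_ind with
    | h e' x t =>
    induction t using sphere_ind with
    | h0 => rw [elt_pt_right, elt_pt_left, ap_pt, ap_pt]
    | h1 t =>
    change ap (smashMap (𝟙 X) (unitorHom Y)) (ap (assocHom X sphereSpectrum Y)
      (elt e (elt e' x (sph t)) y)) =
      elt e (X.lam ((Equiv.sumComm _ _).trans ((Equiv.sumComm _ _).trans e')) x t) y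
    rw [ap_assocHom, tri, ap_smashMap, ap_unitorHom, ap_id, elt_lam, lam, elt_act_left]
    congr 1
    refine equiv_ext₃ (fun i => ?_) (fun i => ?_) fun i => ?_ <;> simp

/-- The symmetric monoidal structure on symmetric spectra. -/
instance : SymmetricCategory SymmetricSpectrum.{u} where
  braiding := swapIso
  braiding_naturality_right X _ _ f := smash_hom_ext fun e x y => rfl
  braiding_naturality_left f Z := smash_hom_ext fun e x y => rfl
  hexagon_forward X Y Z := smash_hom_ext fun e w z => by
    induction w using smash_ind with
    | h e' x y =>
    change ap (assocHom Y Z X) (ap (swapHom X (smash Y Z)) (ap (assocHom X Y Z)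
        (elt e (elt e' x y) z))) =
      ap (smashMap (𝟙 Y) (swapHom X Z)) (ap (assocHom Y X Z)
        (elt e (ap (swapHom X Y) (elt e' x y)) z))
    rw [ap_assocHom, tri, ap_swapHom, ap_assocHom, ap_swapHom, ap_assocHom, tri, tri, ap_smashMap,
      ap_swapHom, elt_elt, elt_elt]
    refine congrArg (fun E => tri E y z x) ?_
    ext (i | i | i) <;> simp
  hexagon_reverse X Y Z := smash_hom_ext fun e x w => by
    induction w using smash_ind with
    | h e' y z =>
    change ap (assocIso Z X Y).inv (ap (swapHom (smash X Y) Z) (ap (assocIso X Y Z).inv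
        (elt e x (elt e' y z)))) =
      ap (smashMap (swapHom X Z) (𝟙 Y)) (ap (assocIso X Z Y).inv
        (elt e x (ap (swapHom Y Z) (elt e' y z))))
    rw [elt_elt, ap_assocIso_inv, tri', ap_swapHom, elt_elt, ap_assocIso_inv, ap_swapHom, elt_elt,
      ap_assocIso_inv, tri', tri', ap_smashMap, ap_swapHom, elt_elt', elt_elt']
    refine congrArg (fun E => tri' E z x y) ?_
    ext ((i | i) | i) <;> simp
  symmetry X Y := swapHom_swapHom X Y

end SymmetricSpectrum

/-! Matrix transfers -/

section MatrixTransfers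

open TensorProduct

variable (k : Type u) [CommRing k]

/-- The pointed set of `ℓ`-simplices of `Sⁿ`. -/
def sphPt (n : ℕ) (ℓ : SimplexCategoryᵒᵖ) : Pointed.{0} := ⟨Sph n ℓ, Sph.pt n ℓ⟩

/-- `A ⊙ K`, the product of copies of `A` indexed by the elements of the pointed set `K` other than
the basepoint. -/
abbrev Odot (A : Type u) (K : Pointed.{0}) : Type u := {x : K.X // x ≠ K.point} → A

open Classical in
/-- The component of `a ∈ A ⊙ K` at any element of `K`; it is `0` at the basepoint. -/
noncomputable def Odot.comp {A : Type u} [Zero A] {K : Pointed.{0}} (a : Odot A K) (x : K.X) : A :=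
  if h : x = K.point then 0 else a ⟨x, h⟩

lemma Odot.comp_pt {A : Type u} [Zero A] {K : Pointed.{0}} (a : Odot A K) :
    a.comp K.point = 0 := dif_pos rfl

lemma Odot.comp_coe {A : Type u} [Zero A] {K : Pointed.{0}} (a : Odot A K)
    (x : {x : K.X // x ≠ K.point}) : a.comp x.1 = a x := dif_neg x.2

lemma Odot.ext' {A : Type u} [Zero A] {K : Pointed.{0}} {a b : Odot A K}
    (h : ∀ x, a.comp x = b.comp x) : a = b :=
  funext fun x => ((Odot.comp_coe a x).symm.trans (h x.1)).trans (Odot.comp_coe b x)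

/-- The non-unital homomorphism `A ⊙ K' → A ⊙ K` induced by a pointed map `φ : K → K'`: the component
of the image of `a` at `x ∈ K` is the component of `a` at `φ x`. -/
noncomputable def odotMap (A : Type u) [Ring A] [Algebra k A] {K K' : Pointed.{0}} (φ : K ⟶ K') :
    Odot A K' →ₙₐ[k] Odot A K where
  toFun a := fun x => a.comp (Pointed.Hom.toFun φ x.1)
  map_smul' c a := by
    funext x
    by_cases h : Pointed.Hom.toFun φ x.1 = K'.point <;> simp [Odot.comp, h]
  map_zero' := by
    funext x
    by_cases h : Pointed.Hom.toFun φ x.1 = K'.point <;> simp [Odot.comp, h]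
  map_add' a b := by
    funext x
    by_cases h : Pointed.Hom.toFun φ x.1 = K'.point <;> simp [Odot.comp, h]
  map_mul' a b := by
    funext x
    by_cases h : Pointed.Hom.toFun φ x.1 = K'.point <;> simp [Odot.comp, h]

@[simp] lemma odotMap_comp_apply (A : Type u) [Ring A] [Algebra k A] {K K' : Pointed.{0}}
    (φ : K ⟶ K') (a : Odot A K') (x : K.X) :
    (odotMap k A φ a).comp x = a.comp (Pointed.Hom.toFun φ x) := by
  by_cases h : x = K.point
  · have h' : Pointed.Hom.toFun φ K.point = K'.point := Pointed.Hom.map_point φ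
    rw [h, h', Odot.comp_pt, Odot.comp_pt]
  · exact Odot.comp_coe _ ⟨x, h⟩

/-- Matrix correspondences of level `n` from `A` to `B`: non-unital homomorphisms `A → M_{2ⁿ}(B)`.
Rows and columns of a `2ⁿ × 2ⁿ`-matrix are indexed by words `i₁ ⋯ iₙ` in two letters, the first
letter being the outermost one: inserting `2^m × 2^m`-matrices into the entries of a
`2ⁿ × 2ⁿ`-matrix is concatenation of words. -/
abbrev Mtr (n : ℕ) (A B : Type u) [NonUnitalRing A] [Module k A] [Ring B] [Algebra k B] : Type u :=
  A →ₙₐ[k] Matrix (Fin n → Fin 2) (Fin n → Fin 2) B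

/-- The map of pointed sets `Sⁿ → S^m` given by a bijection (a permutation if `n = m`). -/
def sphActHom {n m : ℕ} (ℓ : SimplexCategoryᵒᵖ) (e : Fin n ≃ Fin m) : sphPt n ℓ ⟶ sphPt m ℓ :=
  ⟨Sph.act e, rfl⟩

/-- The simplicial structure maps of `Sⁿ`. -/
def sphResHom (n : ℕ) {ℓ₁ ℓ₂ : SimplexCategoryᵒᵖ} (θ : ℓ₁ ⟶ ℓ₂) : sphPt n ℓ₁ ⟶ sphPt n ℓ₂ :=
  ⟨Sph.res θ, rfl⟩

/-- The map `x ↦ x ∧ t`, for a fixed simplex `t` of `S^q`. -/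
def sphSmashHom (p : ℕ) {q : ℕ} {ℓ : SimplexCategoryᵒᵖ} (t : Sph q ℓ) :
    sphPt p ℓ ⟶ sphPt (p + q) ℓ :=
  ⟨fun x => Sph.smash x t, Sph.pt_smash t⟩

variable (A B : Type u) [Ring A] [Algebra k A] [Ring B] [Algebra k B]

/-- A bijection acts on matrices by permuting the letters of the words that index rows and columns;
the letter in position `i` is moved to position `e i`. -/
def permMatrix {n m : ℕ} (e : Fin n ≃ Fin m) :
    Matrix (Fin n → Fin 2) (Fin n → Fin 2) B →ₙₐ[k] Matrix (Fin m → Fin 2) (Fin m → Fin 2) B where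
  toFun M := Matrix.of fun i j => M (i ∘ e) (j ∘ e)
  map_smul' _ _ := rfl
  map_zero' := rfl
  map_add' _ _ := rfl
  map_mul' M N := by
    ext i j
    simp only [Matrix.mul_apply, Matrix.of_apply]
    exact Fintype.sum_equiv (Equiv.arrowCongr e (Equiv.refl _)) _ _ fun x => by
      have h : (Equiv.arrowCongr e (Equiv.refl (Fin 2)) x) ∘ e = x := by ext; simp
      rw [h]

/-- The homomorphism `M_{2^m}(B) → M_{2^{m+1}}(B)` that puts every entry in the upper left corner
of a `2 × 2`-matrix. -/
def cornerMatrix (m : ℕ) :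
    Matrix (Fin m → Fin 2) (Fin m → Fin 2) B →ₙₐ[k]
      Matrix (Fin (m + 1) → Fin 2) (Fin (m + 1) → Fin 2) B where
  toFun M := Matrix.of fun i j => if i (Fin.last m) = 0 ∧ j (Fin.last m) = 0 then
    M (i ∘ Fin.castSucc) (j ∘ Fin.castSucc) else 0
  map_smul' c M := by
    ext i j
    by_cases h : i (Fin.last m) = 0 ∧ j (Fin.last m) = 0 <;> simp [h]
  map_zero' := by
    ext i j
    simp
  map_add' M N := by
    ext i j
    by_cases h : i (Fin.last m) = 0 ∧ j (Fin.last m) = 0 <;> simp [h]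
  map_mul' M N := by
    ext i j
    simp only [Matrix.mul_apply, Matrix.of_apply]
    rw [← (Fin.snocEquiv fun _ : Fin (m + 1) => Fin 2).sum_comp, Fintype.sum_prod_type,
      Fin.sum_univ_two]
    by_cases h1 : i (Fin.last m) = 0 <;> by_cases h2 : j (Fin.last m) = 0 <;>
      simp [h1, h2, Fin.snocEquiv, Function.comp_def]

/-- The simplices of `Mtrc_n(A, B) = Mtr_n(A ⊙ Sⁿ, B)`. -/
abbrev MtrcEl (n : ℕ) (ℓ : SimplexCategoryᵒᵖ) : Type u := Mtr k n (Odot A (sphPt n ℓ)) B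

variable {k A B} in
/-- The action of bijections by conjugation. -/
noncomputable def MtrcEl.act {n m : ℕ} {ℓ : SimplexCategoryᵒᵖ} (e : Fin n ≃ Fin m)
    (f : MtrcEl k A B n ℓ) : MtrcEl k A B m ℓ :=
  (permMatrix k B e).comp (f.comp (odotMap k A (sphActHom ℓ e)))

variable {k A B} in
/-- The simplicial structure. -/
noncomputable def MtrcEl.res {n : ℕ} {ℓ₁ ℓ₂ : SimplexCategoryᵒᵖ} (θ : ℓ₁ ⟶ ℓ₂)
    (f : MtrcEl k A B n ℓ₁) : MtrcEl k A B n ℓ₂ :=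
  f.comp (odotMap k A (sphResHom n θ))

variable {k A B} in
/-- The structure maps: `(f, s)` is sent to the composition of the projection of
`A ⊙ S^{m+1}` to the factor `A ⊙ S^m` with index `s`, the map `f`, and the corner map. -/
noncomputable def MtrcEl.str {m : ℕ} {ℓ : SimplexCategoryᵒᵖ}
    (f : MtrcEl k A B m ℓ) (s : S1 ℓ) : MtrcEl k A B (m + 1) ℓ :=
  (cornerMatrix k B m).comp
    (f.comp (odotMap k A (sphSmashHom m (Sph.mk fun _ : Fin 1 => s))))

variable {k A B} in
lemma MtrcEl.ext' {n : ℕ} {ℓ : SimplexCategoryᵒᵖ} {f g : MtrcEl k A B n ℓ}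
    (h : ∀ a i j, f a i j = g a i j) : f = g :=
  NonUnitalAlgHom.ext fun a => Matrix.ext fun i j => h a i j

/-- The symmetric sequence `(Mtr_n(A ⊙ Sⁿ, B))_n`. -/
@[reducible] noncomputable def mtrcSeq : SymSeq.{u} :=
  SymSeq.ofData (MtrcEl k A B) (fun _ _ => 0) MtrcEl.act MtrcEl.res
    (fun _ => MtrcEl.ext' fun _ _ _ => rfl)
    (fun {n ℓ} f => MtrcEl.ext' fun a i j => by
      have h : odotMap k A (sphActHom ℓ (Equiv.refl (Fin n))) a = a :=
        Odot.ext' fun x => by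
          rw [odotMap_comp_apply]; exact congrArg a.comp (Sph.act_refl x)
      change f (odotMap k A (sphActHom ℓ (Equiv.refl (Fin n))) a) i j = _
      rw [h])
    (fun {n m l ℓ} e e₁ f => MtrcEl.ext' fun a i j => by
      have h : odotMap k A (sphActHom ℓ e) (odotMap k A (sphActHom ℓ e₁) a) =
          odotMap k A (sphActHom ℓ (e.trans e₁)) a :=
        Odot.ext' fun x => by
          rw [odotMap_comp_apply, odotMap_comp_apply, odotMap_comp_apply]
          exact congrArg a.comp (Sph.act_act e e₁ x)
      change f (odotMap k A (sphActHom ℓ e) (odotMap k A (sphActHom ℓ e₁) a)) _ _ = _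
      rw [h]
      rfl)
    (fun _ => MtrcEl.ext' fun _ _ _ => rfl)
    (fun {n ℓ} f => MtrcEl.ext' fun a i j => by
      have h : odotMap k A (sphResHom n (𝟙 ℓ)) a = a :=
        Odot.ext' fun x => by
          rw [odotMap_comp_apply]; exact congrArg a.comp (Sph.res_id x)
      change f (odotMap k A (sphResHom n (𝟙 ℓ)) a) i j = _
      rw [h])
    (fun {n ℓ ℓ₁ ℓ₂} θ η f => MtrcEl.ext' fun a i j => by
      have h : odotMap k A (sphResHom n (θ ≫ η)) a =
          odotMap k A (sphResHom n θ) (odotMap k A (sphResHom n η) a) :=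
        Odot.ext' fun x => by
          rw [odotMap_comp_apply, odotMap_comp_apply, odotMap_comp_apply]
          exact congrArg a.comp (Sph.res_comp θ η x)
      change f (odotMap k A (sphResHom n (θ ≫ η)) a) i j = _
      rw [h]
      rfl)
    (fun {n m ℓ₁ ℓ₂} θ e f => MtrcEl.ext' fun a i j => by
      have h : odotMap k A (sphActHom ℓ₁ e) (odotMap k A (sphResHom m θ) a) =
          odotMap k A (sphResHom n θ) (odotMap k A (sphActHom ℓ₂ e) a) :=
        Odot.ext' fun x => by
          rw [odotMap_comp_apply, odotMap_comp_apply, odotMap_comp_apply, odotMap_comp_apply]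
          exact congrArg a.comp (Sph.res_act θ e x)
      change f (odotMap k A (sphActHom ℓ₁ e) (odotMap k A (sphResHom m θ) a)) _ _ = _
      rw [h]
      rfl)

variable {k A B} in
/-- Iterated structure maps. -/
noncomputable def MtrcEl.iter {m r : ℕ} {ℓ : SimplexCategoryᵒᵖ} (f : MtrcEl k A B m ℓ)
    (t : Fin r → S1 ℓ) : MtrcEl k A B (m + r) ℓ :=
  iterStr (mtrcSeq k A B) MtrcEl.str f t

variable {k A B} in
lemma mtrc_iterStr {m r : ℕ} {ℓ : SimplexCategoryᵒᵖ} (f : MtrcEl k A B m ℓ) (t : Fin r → S1 ℓ)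
    (a : Odot A (sphPt (m + r) ℓ)) (i j : Fin (m + r) → Fin 2) :
    MtrcEl.iter f t a i j =
      if ∀ l : Fin r, i (Fin.natAdd m l) = 0 ∧ j (Fin.natAdd m l) = 0 then
        f (odotMap k A (sphSmashHom m (Sph.mk t)) a) (i ∘ Fin.castAdd r) (j ∘ Fin.castAdd r)
      else 0 := by
  induction r with
  | zero =>
    rw [if_pos fun l => l.elim0]
    have h : odotMap k A (sphSmashHom m (Sph.mk t)) a = a := by
      refine Odot.ext' fun x => ?_
      rw [odotMap_comp_apply]
      refine congrArg a.comp ?_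
      induction x using Sph.ind with
      | h0 => rfl
      | h1 u => exact congrArg Sph.mk (funext fun i => Fin.append_left u t i)
    rw [h]
    rfl
  | succ r ih =>
    have h1 := ih (fun l => t l.castSucc)
      (odotMap k A (sphSmashHom (m + r) (Sph.mk fun _ : Fin 1 => t (Fin.last r))) a)
      (i ∘ Fin.castSucc) (j ∘ Fin.castSucc)
    have h2 : odotMap k A (sphSmashHom m (Sph.mk fun l => t l.castSucc))
        (odotMap k A (sphSmashHom (m + r) (Sph.mk fun _ : Fin 1 => t (Fin.last r))) a) =
        odotMap k A (sphSmashHom m (Sph.mk t)) a := by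
      refine Odot.ext' fun x => ?_
      rw [odotMap_comp_apply, odotMap_comp_apply, odotMap_comp_apply]
      refine congrArg a.comp ?_
      induction x using Sph.ind with
      | h0 => rfl
      | h1 u =>
        have h3 := Sph.iterStr_mk.{u} u t
        have h4 := Sph.iterStr_mk.{u} u fun l => t l.castSucc
        have h5 := congrArg (fun w => Sph.str.{u} w (t (Fin.last r))) h4
        exact (congrArg ULift.down (h5.symm.trans h3))
    rw [h2] at h1
    have h3 : MtrcEl.iter f t a i j =
        if i (Fin.last (m + r)) = 0 ∧ j (Fin.last (m + r)) = 0 then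
          MtrcEl.iter f (fun l => t l.castSucc)
            (odotMap k A (sphSmashHom (m + r) (Sph.mk fun _ : Fin 1 => t (Fin.last r))) a)
            (i ∘ Fin.castSucc) (j ∘ Fin.castSucc) else 0 := rfl
    rw [h3, h1]
    by_cases hl : i (Fin.last (m + r)) = 0 ∧ j (Fin.last (m + r)) = 0
    · rw [if_pos hl]
      refine if_congr ⟨fun h l => ?_, fun h l => h l.castSucc⟩ rfl rfl
      exact Fin.lastCases hl h l
    · rw [if_neg hl, if_neg fun h => hl (h (Fin.last r))]

/-- The symmetric spectrum `Mtrc_*(A, B) = (Mtr_n(A ⊙ Sⁿ, B))_n`. -/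
noncomputable def mtrcSpectrum : SymmetricSpectrum.{u} where
  seq := mtrcSeq k A B
  str := MtrcEl.str
  str_pt_left s := MtrcEl.ext' fun a i j => by
    change (cornerMatrix k B _) 0 i j = 0
    rw [map_zero]; rfl
  str_pt_right {m ℓ} f := MtrcEl.ext' fun a i j => by
    have h : odotMap k A (sphSmashHom m (Sph.mk fun _ : Fin 1 => S1.pt ℓ)) a = 0 := by
      refine Odot.ext' fun x => ?_
      rw [odotMap_comp_apply]
      have h1 : (Sph.mk fun _ : Fin 1 => S1.pt ℓ) = Sph.pt 1 ℓ := Sph.mk_eq_pt _ 0 rfl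
      rw [h1]
      refine (Odot.comp_pt a).trans ?_
      by_cases h : x = (sphPt m ℓ).point <;> simp [Odot.comp, h]
    change (cornerMatrix k B _) (f (odotMap k A _ a)) i j = 0
    rw [h, map_zero, map_zero]; rfl
  res_str {m ℓ₁ ℓ₂} θ f s := MtrcEl.ext' fun a i j => by
    have h : odotMap k A (sphSmashHom m (Sph.mk fun _ : Fin 1 => s))
        (odotMap k A (sphResHom (m + 1) θ) a) = odotMap k A (sphResHom m θ)
          (odotMap k A (sphSmashHom m (Sph.mk fun _ : Fin 1 => S1.res θ s)) a) := by
      refine Odot.ext' fun x => ?_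
      rw [odotMap_comp_apply, odotMap_comp_apply, odotMap_comp_apply, odotMap_comp_apply]
      refine congrArg a.comp ?_
      exact congrArg ULift.down (sphereSpectrum.{u}.res_str θ (ULift.up x) s)
    change (cornerMatrix k B _) (f (odotMap k A _ (odotMap k A _ a))) i j =
      (cornerMatrix k B _) (f (odotMap k A _ (odotMap k A _ a))) i j
    rw [h]
  act_iterStr {m n r q ℓ} τ ρ f t := MtrcEl.ext' fun a i j => by
    refine Eq.trans ?_ (mtrc_iterStr (MtrcEl.act τ f) (t ∘ ρ.symm) a i j).symm
    refine (mtrc_iterStr f t _ _ _).trans ?_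
    refine if_congr ?_ ?_ rfl
    · simp only [Function.comp_apply, Equiv.trans_apply, finSumFinEquiv_symm_apply_natAdd,
        Equiv.sumCongr_apply, Sum.map_inr, finSumFinEquiv_apply_right]
      exact ⟨fun h l => by simpa using h (ρ.symm l), fun h l => h (ρ l)⟩
    · have h : odotMap k A (sphSmashHom m (Sph.mk t)) (odotMap k A (sphActHom ℓ
          (finSumFinEquiv.symm.trans ((Equiv.sumCongr τ ρ).trans finSumFinEquiv))) a) =
          odotMap k A (sphActHom ℓ τ) (odotMap k A (sphSmashHom n (Sph.mk (t ∘ ρ.symm))) a) := by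
        refine Odot.ext' fun x => ?_
        rw [odotMap_comp_apply, odotMap_comp_apply, odotMap_comp_apply, odotMap_comp_apply]
        refine congrArg a.comp ?_
        induction x using Sph.ind with
        | h0 => rfl
        | h1 u =>
          refine congrArg Sph.mk (funext fun z => ?_)
          refine Fin.addCases (fun z => ?_) (fun z => ?_) z <;> simp
      have h1 : (i ∘ (finSumFinEquiv.symm.trans ((Equiv.sumCongr τ ρ).trans finSumFinEquiv))) ∘
          Fin.castAdd r = (i ∘ Fin.castAdd q) ∘ τ := by ext z; simp
      have h2 : (j ∘ (finSumFinEquiv.symm.trans ((Equiv.sumCongr τ ρ).trans finSumFinEquiv))) ∘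
          Fin.castAdd r = (j ∘ Fin.castAdd q) ∘ τ := by ext z; simp
      exact (congrFun (congrFun (congrArg _ h) _) _).trans
        ((congrFun (congrArg _ h1) _).trans (congrArg _ h2))

end MatrixTransfers

/-! Enriched categories with prescribed morphism objects, symmetric monoidal enriched categories -/

section Enriched

universe v w u₁

/-- The structure of a `V`-category with given objects and given morphism objects `H X Y`. -/
structure Enrichment (V : Type v) [Category.{w} V] [MonoidalCategory V] (C : Type u₁)
    (H : C → C → V) where
  /-- The units. -/
  id (X : C) : 𝟙_ V ⟶ H X X
  /-- The composition. -/
  comp (X Y Z : C) : H X Y ⊗ H Y Z ⟶ H X Z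
  id_comp (X Y : C) : (λ_ (H X Y)).inv ≫ id X ▷ _ ≫ comp X X Y = 𝟙 _
  comp_id (X Y : C) : (ρ_ (H X Y)).inv ≫ _ ◁ id Y ≫ comp X Y Y = 𝟙 _
  assoc (W X Y Z : C) :
    (α_ _ _ _).inv ≫ comp W X Y ▷ _ ≫ comp W Y Z = _ ◁ comp X Y Z ≫ comp W X Z

/-- The `V`-category given by an enrichment. -/
abbrev Enrichment.toEnrichedCategory {V : Type v} [Category.{w} V] [MonoidalCategory V]
    {C : Type u₁} {H : C → C → V} (E : Enrichment V C H) : EnrichedCategory V C where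
  Hom := H
  id := E.id
  comp := E.comp
  id_comp := E.id_comp
  comp_id := E.comp_id
  assoc := E.assoc

variable (V : Type v) [Category.{w} V] [MonoidalCategory V] {C : Type u₁} [EnrichedCategory V C]

/-- Composition with a morphism `X ⟶ Y` of the underlying category, on the target side. -/
noncomputable def postcomp (W : C) {X Y : C}
    (f : ForgetEnrichment.of V X ⟶ ForgetEnrichment.of V Y) :
    EnrichedCategory.Hom (V := V) W X ⟶ EnrichedCategory.Hom (V := V) W Y :=
  (ρ_ _).inv ≫ (_ ◁ ForgetEnrichment.homTo V f) ≫ eComp V W X Y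

/-- Composition with a morphism `X ⟶ Y` of the underlying category, on the source side. -/
noncomputable def precomp {X Y : C} (f : ForgetEnrichment.of V X ⟶ ForgetEnrichment.of V Y)
    (W : C) : EnrichedCategory.Hom (V := V) Y W ⟶ EnrichedCategory.Hom (V := V) X W :=
  (λ_ _).inv ≫ (ForgetEnrichment.homTo V f ▷ _) ≫ eComp V X Y W

variable {V} in
/-- The action of a family of maps `H(A, A') ⊗ H(B, B') ⟶ H(A ⊠ B, A' ⊠ B')` on the morphisms of
the underlying category. -/
noncomputable def tensorUnderlying {T : C → C → C} {A A' B B' : C}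
    (t : EnrichedCategory.Hom (V := V) A A' ⊗ EnrichedCategory.Hom (V := V) B B' ⟶
      EnrichedCategory.Hom (V := V) (T A B) (T A' B'))
    (f : ForgetEnrichment.of V A ⟶ ForgetEnrichment.of V A')
    (g : ForgetEnrichment.of V B ⟶ ForgetEnrichment.of V B') :
    ForgetEnrichment.of V (T A B) ⟶ ForgetEnrichment.of V (T A' B') :=
  ForgetEnrichment.homOf V
    ((λ_ (𝟙_ V)).inv ≫ (ForgetEnrichment.homTo V f ⊗ₘ ForgetEnrichment.homTo V g) ≫ t)

/-- The structure of a symmetric monoidal `V`-category on a `V`-category `C`, with given tensor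
product `T` of objects and given unit object `I`: a `V`-functor `T : C ⊗ C ⟶ C`, and associativity,
unit and symmetry isomorphisms that are `V`-natural and satisfy the coherence axioms. -/
structure SymmetricMonoidalEnrichment (V : Type v) [Category.{w} V] [MonoidalCategory V]
    [SymmetricCategory V] (C : Type u₁) [EnrichedCategory V C] (T : C → C → C) (I : C) where
  /-- The tensor product on morphism objects. -/
  tensorHom (A A' B B' : C) :
    EnrichedCategory.Hom (V := V) A A' ⊗ EnrichedCategory.Hom (V := V) B B' ⟶
      EnrichedCategory.Hom (V := V) (T A B) (T A' B')
  tensor_id (A B : C) :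
    (λ_ (𝟙_ V)).inv ≫ (eId V A ⊗ₘ eId V B) ≫ tensorHom A A B B = eId V (T A B)
  tensor_comp (A A' A'' B B' B'' : C) :
    tensorμ (EnrichedCategory.Hom (V := V) A A') (EnrichedCategory.Hom (V := V) A' A'')
        (EnrichedCategory.Hom (V := V) B B') (EnrichedCategory.Hom (V := V) B' B'') ≫
      (tensorHom A A' B B' ⊗ₘ tensorHom A' A'' B' B'') ≫
        eComp V (T A B) (T A' B') (T A'' B'') =
    (eComp V A A' A'' ⊗ₘ eComp V B B' B'') ≫ tensorHom A A'' B B''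
  /-- The associativity isomorphism. -/
  associator (A B D : C) :
    ForgetEnrichment.of V (T (T A B) D) ≅ ForgetEnrichment.of V (T A (T B D))
  /-- The left unit isomorphism. -/
  leftUnitor (A : C) : ForgetEnrichment.of V (T I A) ≅ ForgetEnrichment.of V A
  /-- The right unit isomorphism. -/
  rightUnitor (A : C) : ForgetEnrichment.of V (T A I) ≅ ForgetEnrichment.of V A
  /-- The symmetry isomorphism. -/
  braiding (A B : C) : ForgetEnrichment.of V (T A B) ≅ ForgetEnrichment.of V (T B A)
  associator_naturality (A A' B B' D D' : C) :
    (tensorHom A A' B B' ▷ EnrichedCategory.Hom (V := V) D D') ≫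
        tensorHom (T A B) (T A' B') D D' ≫ postcomp V _ (associator A' B' D').hom =
      (α_ _ _ _).hom ≫ (EnrichedCategory.Hom (V := V) A A' ◁ tensorHom B B' D D') ≫
        tensorHom A A' (T B D) (T B' D') ≫ precomp V (associator A B D).hom _
  leftUnitor_naturality (A A' : C) :
    (λ_ _).inv ≫ (eId V I ▷ EnrichedCategory.Hom (V := V) A A') ≫ tensorHom I I A A' ≫
        postcomp V _ (leftUnitor A').hom = precomp V (leftUnitor A).hom _
  rightUnitor_naturality (A A' : C) :
    (ρ_ _).inv ≫ (EnrichedCategory.Hom (V := V) A A' ◁ eId V I) ≫ tensorHom A A' I I ≫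
        postcomp V _ (rightUnitor A').hom = precomp V (rightUnitor A).hom _
  braiding_naturality (A A' B B' : C) :
    tensorHom A A' B B' ≫ postcomp V _ (braiding A' B').hom =
      (β_ _ _).hom ≫ tensorHom B B' A A' ≫ precomp V (braiding A B).hom _
  pentagon (A B D E : C) :
    tensorUnderlying (tensorHom _ _ _ _) (associator A B D).hom (𝟙 (ForgetEnrichment.of V E)) ≫
        (associator A (T B D) E).hom ≫
        tensorUnderlying (tensorHom _ _ _ _) (𝟙 (ForgetEnrichment.of V A)) (associator B D E).hom =
      (associator (T A B) D E).hom ≫ (associator A B (T D E)).hom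
  triangle (A B : C) :
    (associator A I B).hom ≫
        tensorUnderlying (tensorHom _ _ _ _) (𝟙 (ForgetEnrichment.of V A)) (leftUnitor B).hom =
      tensorUnderlying (tensorHom _ _ _ _) (rightUnitor A).hom (𝟙 (ForgetEnrichment.of V B))
  hexagon (A B D : C) :
    (associator A B D).hom ≫ (braiding A (T B D)).hom ≫ (associator B D A).hom =
      tensorUnderlying (tensorHom _ _ _ _) (braiding A B).hom (𝟙 (ForgetEnrichment.of V D)) ≫
        (associator B A D).hom ≫
        tensorUnderlying (tensorHom _ _ _ _) (𝟙 (ForgetEnrichment.of V B)) (braiding A D).hom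
  symmetry (A B : C) : (braiding A B).hom ≫ (braiding B A).hom = 𝟙 _

/-- Symmetric monoidal structures on the `V`-category given by an enrichment. -/
abbrev Enrichment.SymmetricMonoidal {V : Type v} [Category.{w} V] [MonoidalCategory V]
    [SymmetricCategory V] {C : Type u₁} {H : C → C → V} (E : Enrichment V C H)
    (T : C → C → C) (I : C) :=
  @SymmetricMonoidalEnrichment V _ _ _ C E.toEnrichedCategory T I

end Enriched

/-! The spectral category of matrix transfers -/

section Mtrc

open TensorProduct Opposite Simplicial

variable (k : Type u) [CommRing k]

/-- The symmetric spectra `Mtrc_*(A, B)`. -/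
noncomputable abbrev mtrc (A B : AlgCat.{u} k) : SymmetricSpectrum.{u} := mtrcSpectrum k A B

/-- The tensor product of algebras. -/
noncomputable abbrev algTensor (A B : AlgCat.{u} k) : AlgCat.{u} k := AlgCat.of k (A ⊗[k] B)

variable {k}

/-- The non-unital homomorphism `A → B` given by the image of the non-basepoint of `S⁰` under a
map `𝕊 → Mtrc_*(A, B)`; here `A = A ⊙ S⁰` and `B` is identified with the ring of
`1 × 1`-matrices. -/
noncomputable def levelZeroHom {A B : AlgCat.{u} k}
    (φ : 𝟙_ SymmetricSpectrum.{u} ⟶ mtrc k A B) : A →ₙₐ[k] B :=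
  let f : MtrcEl k A B 0 (op ⦋0⦌) :=
    SymmetricSpectrum.ap φ (SymmetricSpectrum.sph fun i : Fin 0 => i.elim0)
  { toFun := fun a => f (fun _ => a) default default
    map_smul' := fun c a => congrFun (congrFun (map_smul f c fun _ => a) default) default
    map_zero' := congrFun (congrFun (map_zero f) default) default
    map_add' := fun a b =>
      congrFun (congrFun (map_add f (fun _ => a) fun _ => b) default) default
    map_mul' := fun a b => by
      refine (congrFun (congrFun (map_mul f (fun _ => a) fun _ => b) default) default).trans ?_
      rw [Matrix.mul_apply, Fintype.sum_unique]
      exact congrArg₂ (· * ·) (congrArg _ (Subsingleton.elim _ _))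
        (congrFun (congrArg _ (Subsingleton.elim _ _)) _) }

/-- `h` is the composition
`A ⊙ S^{p+q} → M_{2^p}(B) ⊙ S^q = M_{2^p}(B ⊙ S^q) → M_{2^p}(M_{2^q}(C)) = M_{2^{p+q}}(C)`
of the homomorphisms `f ⊙ S^q` and `M_{2^p}(g)`. -/
def IsMatrixComposition {A B C : AlgCat.{u} k} {p q : ℕ} {ℓ : SimplexCategoryᵒᵖ}
    (f : MtrcEl k A B p ℓ) (g : MtrcEl k B C q ℓ) (h : MtrcEl k A C (p + q) ℓ) : Prop :=
  ∀ (a : Odot A (sphPt (p + q) ℓ)) (i j : Fin (p + q) → Fin 2),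
    h a i j = g (fun t => f (odotMap k A (sphSmashHom p t.1) a)
      (i ∘ Fin.castAdd q) (j ∘ Fin.castAdd q)) (i ∘ Fin.natAdd p) (j ∘ Fin.natAdd p)

/-- `h` is the composition
`(A ⊗ B) ⊙ S^{p+q} = (A ⊙ S^p) ⊗ (B ⊙ S^q) → M_{2^p}(A') ⊗ M_{2^q}(B') = M_{2^{p+q}}(A' ⊗ B')`
whose middle map is `f ⊗ g`. -/
def IsMatrixTensor {A A' B B' : AlgCat.{u} k} {p q : ℕ} {ℓ : SimplexCategoryᵒᵖ}
    (f : MtrcEl k A A' p ℓ) (g : MtrcEl k B B' q ℓ)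
    (h : MtrcEl k (A ⊗[k] B) (A' ⊗[k] B') (p + q) ℓ) : Prop :=
  ∀ (a : Odot A (sphPt p ℓ)) (b : Odot B (sphPt q ℓ))
    (c : Odot (A ⊗[k] B) (sphPt (p + q) ℓ)),
    (∀ (s : Sph p ℓ) (t : Sph q ℓ),
      Odot.comp c (Sph.smash s t) = Odot.comp a s ⊗ₜ[k] Odot.comp b t) →
    ∀ i j : Fin (p + q) → Fin 2,
      h c i j = f a (i ∘ Fin.castAdd q) (j ∘ Fin.castAdd q) ⊗ₜ[k]
        g b (i ∘ Fin.natAdd p) (j ∘ Fin.natAdd p)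

end Mtrc

/-! In a fixed simplicial degree the circle has finitely many simplices, and the simplices of `Sⁿ`
other than the basepoint are the tuples of `n` non-basepoint simplices of the circle. Hence `A ⊙ Sⁿ`
is a finite product of copies of `A`, every element is a sum of elements `sing u a` concentrated in
one factor (`Odot.sum_sing`), and a correspondence `f : A ⊙ Sⁿ → M_{2ⁿ}(B)` is determined by the
entries `f (sing u a) i j` (`MtrcEl.ext_sing`).

Such an entry depends on three words of length `n`: the tuple `u`, the row `i` and the column `j`.
Most of the structure acts on these words. Bijections permute the letters of all three. The
structure map at `s` tests whether the last letter of `u` is `s` and those of `i` and `j` are `0`,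
and drops these letters. Composition and tensor product cut all three words in two, the first parts
belonging to `f` and the second to `g` (`MtrcEl.matComp_sing`, `MtrcEl.matTensor_sing`). The
bimorphism axioms, associativity, the interchange law and naturality thereby become comparisons of
bijections of finite sets. The exception is the simplicial structure, which does not carry one
factor to one factor; it is treated in coordinates (`MtrcEl.res_matComp`, `MtrcEl.res_matTensor`).

Algebra enters in the multiplicativity of the two products. For composition it is matrix
multiplication, with the sum over words split into a double sum (`MtrcEl.sum_words`). For the tensor
product, finite products commute with `⊗`, so `f ⊗ g` is defined factor by factor; it is
multiplicative because distinct factors of `A ⊙ Sⁿ` annihilate each other (`MtrcEl.sum_entry_mul`,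
`MtrcEl.sum_tensorEntry_mul`).

The sphere spectrum is generated by the non-basepoint of `S⁰` (`SymmetricSpectrum.sphere_hom_ext`),
so a map from it to `Mtrc_*(A, B)` amounts to an element of level zero, which is a homomorphism `A →
B`; conversely, a homomorphism followed by the upper left corner extends to all levels
(`mtrcOfHom`). The pentagon, triangle, hexagon and symmetry are equations in the underlying
category, so they reduce to equations between homomorphisms of algebras, which are checked on pure
tensors. -/

/-! ### Finiteness and normal forms for the simplices of the spheres. -/

instance S1.instFinite (ℓ : SimplexCategoryᵒᵖ) : Finite (S1 ℓ) := by
  have : Finite (ℓ.unop ⟶ SimplexCategory.mk 1) :=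
    Finite.of_injective (fun f => (f.toOrderHom : Fin _ → Fin _)) fun f g h =>
      SimplexCategory.Hom.ext _ _ (OrderHom.ext _ _ h)
  exact Quot.finite _

namespace Sph

variable {n m p q : ℕ} {ℓ ℓ₁ ℓ₂ : SimplexCategoryᵒᵖ}

open Classical in
/-- A tuple of simplices of the circle, none of which is the basepoint, as an invariant of the
simplex of the sphere that it represents. -/
noncomputable def toTuple : Sph n ℓ → Option (Fin n → S1 ℓ) :=
  lift none (fun t => if ∃ i, t i = S1.pt ℓ then none else some t) fun _ i h => if_pos ⟨i, h⟩

lemma toTuple_mk {t : Fin n → S1 ℓ} (h : ∀ i, t i ≠ S1.pt ℓ) : toTuple (mk t) = some t :=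
  if_neg (by simpa using h)

lemma mk_ne_pt {t : Fin n → S1 ℓ} (h : ∀ i, t i ≠ S1.pt ℓ) : mk t ≠ pt n ℓ := fun h' => by
  have := (toTuple_mk h).symm.trans (congrArg toTuple h')
  exact Option.some_ne_none _ this

/-- The tuple is recovered by `toTuple`. Only `t` has to avoid the basepoint: if `t'` met it, `mk
t'` would be the basepoint, which `mk t` is not. -/
lemma mk_inj {t t' : Fin n → S1 ℓ} (h : ∀ i, t i ≠ S1.pt ℓ) : mk t = mk t' ↔ t = t' := by
  refine ⟨fun h' => ?_, congrArg mk⟩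
  have h1 := (toTuple_mk h).symm.trans (congrArg toTuple h')
  by_cases h2 : ∃ i, t' i = S1.pt ℓ
  · obtain ⟨i, hi⟩ := h2
    exact absurd (h'.trans (mk_eq_pt t' i hi)) (mk_ne_pt h)
  · rw [toTuple_mk (by simpa using h2)] at h1
    exact Option.some_injective _ h1

lemma ne_pt_of_mk_ne {t : Fin n → S1 ℓ} (h : mk t ≠ pt n ℓ) (i : Fin n) : t i ≠ S1.pt ℓ :=
  fun hi => h (mk_eq_pt t i hi)

lemma exists_mk (x : Sph n ℓ) (hx : x ≠ pt n ℓ) :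
    ∃ t : Fin n → S1 ℓ, (∀ i, t i ≠ S1.pt ℓ) ∧ x = mk t := by
  induction x using ind with
  | h0 => exact absurd rfl hx
  | h1 t => exact ⟨t, ne_pt_of_mk_ne hx, rfl⟩

/-- The smash product `S^p ∧ S^q → S^n` with coordinates arranged by `e`. -/
def join (e : Fin p ⊕ Fin q ≃ Fin n) (x : Sph p ℓ) (y : Sph q ℓ) : Sph n ℓ :=
  act (finSumFinEquiv.symm.trans e) (smash x y)

@[simp] lemma pt_join (e : Fin p ⊕ Fin q ≃ Fin n) (y : Sph q ℓ) : join e (pt p ℓ) y = pt n ℓ := by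
  rw [join, pt_smash, act_pt]

lemma join_mk (e : Fin p ⊕ Fin q ≃ Fin n) (u : Fin p → S1 ℓ) (t : Fin q → S1 ℓ) :
    join e (mk u) (mk t) = mk (Sum.elim u t ∘ e.symm) := by
  refine congrArg mk (funext fun i => ?_)
  obtain ⟨i, rfl⟩ := e.surjective i
  rcases i with i | i <;> simp

lemma join_finSumFinEquiv (x : Sph p ℓ) (y : Sph q ℓ) : join finSumFinEquiv x y = smash x y := by
  rw [join, Equiv.symm_trans_self, act_refl]

/-- Cutting a word along `e` loses nothing, so a test for equality of words is a pair of tests on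
their parts. All Kronecker deltas below are factored in this way. -/
lemma eq_elim_comp_symm {α : Type*} (e : Fin p ⊕ Fin q ≃ Fin n) (w : Fin n → α) (z : Fin p → α)
    (y : Fin q → α) :
    Sum.elim z y ∘ e.symm = w ↔ z = w ∘ e ∘ Sum.inl ∧ y = w ∘ e ∘ Sum.inr := by
  constructor
  · rintro rfl
    constructor <;> ext i <;> simp
  · rintro ⟨rfl, rfl⟩
    funext i
    obtain ⟨i, rfl⟩ := e.surjective i
    rcases i with i | i <;> simp

end Sph

/-! ### Coordinates on `A ⊙ Sⁿ` and elements concentrated in one factor. -/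

section MatrixTransfers

variable {n m p q : ℕ} {ℓ ℓ₁ ℓ₂ : SimplexCategoryᵒᵖ}

/-- The map `x ↦ x ∧ y`, for a fixed simplex `y` of `S^q`, with coordinates arranged by `e`. -/
def sphJoinHom (e : Fin p ⊕ Fin q ≃ Fin n) (y : Sph q ℓ) : sphPt p ℓ ⟶ sphPt n ℓ :=
  ⟨fun x => Sph.join e x y, Sph.pt_join e y⟩

lemma sphJoinHom_finSumFinEquiv (y : Sph q ℓ) :
    sphJoinHom (finSumFinEquiv (m := p)) y = sphSmashHom p y :=
  Pointed.Hom.ext (funext fun x => Sph.join_finSumFinEquiv x y)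

namespace Odot

lemma comp_apply_coe {A : Type u} [Zero A] {K : Pointed.{0}} (F : K.X → A) (h : F K.point = 0)
    (x : K.X) : Odot.comp (K := K) (fun y => F y.1) x = F x := by
  by_cases hx : x = K.point
  · rw [hx, comp_pt, h]
  · exact comp_coe (fun y => F y.1) ⟨x, hx⟩

/-- The component of an element of `A ⊙ Sⁿ` at `w₁ ∧ ⋯ ∧ wₙ`. -/
noncomputable def coord {A : Type u} [Zero A] (a : Odot A (sphPt n ℓ)) (w : Fin n → S1 ℓ) : A :=
  a.comp (Sph.mk w : Sph n ℓ)

lemma coord_of_eq_pt {A : Type u} [Zero A] (a : Odot A (sphPt n ℓ)) (w : Fin n → S1 ℓ) (i : Fin n)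
    (h : w i = S1.pt ℓ) : a.coord w = 0 := by
  rw [coord, Sph.mk_eq_pt w i h]; exact comp_pt a

/-- The factors of `A ⊙ Sⁿ` are indexed by exactly the tuples that avoid the basepoint. -/
lemma ext_coord {A : Type u} [Zero A] {a b : Odot A (sphPt n ℓ)}
    (h : ∀ w : Fin n → S1 ℓ, (∀ i, w i ≠ S1.pt ℓ) → a.coord w = b.coord w) : a = b := by
  refine ext' fun x => ?_
  by_cases hx : x = Sph.pt n ℓ
  · subst hx; exact (comp_pt a).trans (comp_pt b).symm
  · obtain ⟨w, hw, rfl⟩ := Sph.exists_mk x hx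
    exact h w hw

section

variable {A : Type u} [NonUnitalNonAssocRing A]

lemma comp_zero {K : Pointed.{0}} (x : K.X) : (0 : Odot A K).comp x = 0 := by
  by_cases h : x = K.point <;> simp [Odot.comp, h]

lemma comp_add {K : Pointed.{0}} (a b : Odot A K) (x : K.X) :
    (a + b).comp x = a.comp x + b.comp x := by
  by_cases h : x = K.point <;> simp [Odot.comp, h]

lemma comp_mul {K : Pointed.{0}} (a b : Odot A K) (x : K.X) :
    (a * b).comp x = a.comp x * b.comp x := by
  by_cases h : x = K.point <;> simp [Odot.comp, h]

lemma comp_smul {R : Type*} [Zero R] [SMulWithZero R A] {K : Pointed.{0}} (c : R) (a : Odot A K)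
    (x : K.X) : (c • a).comp x = c • a.comp x := by
  by_cases h : x = K.point <;> simp [Odot.comp, h]

lemma coord_zero (w : Fin n → S1 ℓ) : (0 : Odot A (sphPt n ℓ)).coord w = 0 := comp_zero _

lemma coord_add (a b : Odot A (sphPt n ℓ)) (w : Fin n → S1 ℓ) :
    (a + b).coord w = a.coord w + b.coord w := comp_add a b _

lemma coord_mul (a b : Odot A (sphPt n ℓ)) (w : Fin n → S1 ℓ) :
    (a * b).coord w = a.coord w * b.coord w := comp_mul a b _

lemma coord_smul {R : Type*} [Zero R] [SMulWithZero R A] (c : R) (a : Odot A (sphPt n ℓ))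
    (w : Fin n → S1 ℓ) : (c • a).coord w = c • a.coord w := comp_smul c a _

lemma coord_sum {ι : Type*} (s : Finset ι) (a : ι → Odot A (sphPt n ℓ)) (w : Fin n → S1 ℓ) :
    (∑ i ∈ s, a i).coord w = ∑ i ∈ s, (a i).coord w :=
  map_sum (⟨⟨fun b => b.coord w, coord_zero w⟩, fun b c => coord_add b c w⟩ :
    Odot A (sphPt n ℓ) →+ A) a s

open Classical in
/-- The element of `A ⊙ Sⁿ` whose component at `u₁ ∧ ⋯ ∧ uₙ` is `a` and whose other components
are `0`. -/
noncomputable def sing (u : Fin n → S1 ℓ) (a : A) : Odot A (sphPt n ℓ) :=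
  fun x => if x.1 = (Sph.mk u : Sph n ℓ) then a else 0

open Classical in
-- The condition on `w` cannot be dropped: at a tuple that meets the basepoint the coordinate is
-- `0`, even for `w = u`.
lemma coord_sing (u : Fin n → S1 ℓ) {w : Fin n → S1 ℓ} (h : ∀ i, w i ≠ S1.pt ℓ) (a : A) :
    (sing u a).coord w = if w = u then a else 0 :=
  (dif_neg (Sph.mk_ne_pt h)).trans (if_congr (Sph.mk_inj h) rfl rfl)

/-- A tuple that collapses to the basepoint indexes no factor. This is why sums may run over all
tuples instead of only those that avoid the basepoint. -/
lemma sing_of_eq_pt (u : Fin n → S1 ℓ) (i : Fin n) (h : u i = S1.pt ℓ) (a : A) : sing u a = 0 :=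
  ext_coord fun w hw => by
    rw [coord_sing u hw, coord_zero, if_neg]
    rintro rfl
    exact hw i h

lemma sing_zero (u : Fin n → S1 ℓ) : sing u (0 : A) = 0 :=
  ext_coord fun w hw => by rw [coord_sing u hw, coord_zero, ite_self]

lemma sing_add (u : Fin n → S1 ℓ) (a b : A) : sing u (a + b) = sing u a + sing u b :=
  ext_coord fun w hw => by
    rw [coord_add, coord_sing u hw, coord_sing u hw, coord_sing u hw]
    split_ifs <;> simp

lemma sing_smul {R : Type*} [Zero R] [SMulWithZero R A] (u : Fin n → S1 ℓ) (c : R) (a : A) :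
    sing u (c • a) = c • sing u a :=
  ext_coord fun w hw => by
    rw [coord_smul, coord_sing u hw, coord_sing u hw]
    split_ifs <;> simp

open Classical in
-- Multiplication in a product is componentwise, so distinct factors are orthogonal; the
-- multiplicativity of `matTensor` rests on this.
lemma sing_mul_sing (u w : Fin n → S1 ℓ) (a b : A) :
    sing u a * sing w b = if u = w then sing u (a * b) else 0 := by
  refine ext_coord fun v hv => ?_
  by_cases h : u = w
  · subst h
    rw [if_pos rfl, coord_mul, coord_sing u hv, coord_sing u hv, coord_sing u hv]
    split_ifs <;> simp
  · rw [if_neg h, coord_mul, coord_sing u hv, coord_sing w hv, coord_zero]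
    by_cases h1 : v = u
    · subst h1; simp [h]
    · simp [h1]

noncomputable instance instFintypeTuple : Fintype (Fin n → S1 ℓ) := Fintype.ofFinite _

/-- The finiteness of the circle in each degree makes this sum available. -/
lemma sum_sing (a : Odot A (sphPt n ℓ)) : ∑ u : Fin n → S1 ℓ, sing u (a.coord u) = a := by
  classical
  refine ext_coord fun w hw => ?_
  rw [coord_sum, Finset.sum_congr rfl fun u _ => coord_sing u hw _, Finset.sum_ite_eq]
  simp

end

end Odot

variable {k : Type u} [CommRing k] {A B C : Type u} [Ring A] [Algebra k A] [Ring B] [Algebra k B]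
  [Ring C] [Algebra k C]

open Odot

lemma coord_odotMap_act (e : Fin n ≃ Fin m) (a : Odot A (sphPt m ℓ)) (w : Fin n → S1 ℓ) :
    (odotMap k A (sphActHom ℓ e) a).coord w = a.coord (w ∘ e.symm) :=
  odotMap_comp_apply k A (sphActHom ℓ e) a _

lemma coord_odotMap_res (θ : ℓ₁ ⟶ ℓ₂) (a : Odot A (sphPt n ℓ₂)) (w : Fin n → S1 ℓ₁) :
    (odotMap k A (sphResHom n θ) a).coord w = a.coord (S1.res θ ∘ w) :=
  odotMap_comp_apply k A (sphResHom n θ) a _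

lemma coord_odotMap_join (e : Fin p ⊕ Fin q ≃ Fin n) (t : Fin q → S1 ℓ) (a : Odot A (sphPt n ℓ))
    (w : Fin p → S1 ℓ) :
    (odotMap k A (sphJoinHom e (Sph.mk t)) a).coord w = a.coord (Sum.elim w t ∘ e.symm) :=
  (odotMap_comp_apply k A (sphJoinHom e (Sph.mk t)) a _).trans (congrArg a.comp (Sph.join_mk e w t))

lemma odotMap_join_pt (e : Fin p ⊕ Fin q ≃ Fin n) (a : Odot A (sphPt n ℓ)) :
    odotMap k A (sphJoinHom e (Sph.pt q ℓ)) a = 0 :=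
  ext_coord fun w _ => (odotMap_comp_apply k A (sphJoinHom e (Sph.pt q ℓ)) a _).trans
    ((comp_pt a).trans (coord_zero w).symm)

open Classical in
lemma odotMap_act_sing (e : Fin n ≃ Fin m) (u : Fin m → S1 ℓ) (a : A) :
    odotMap k A (sphActHom ℓ e) (sing u a) = sing (u ∘ e) a := by
  refine ext_coord fun w hw => ?_
  rw [coord_odotMap_act, coord_sing _ hw, coord_sing u (w := w ∘ e.symm) fun i => hw _]
  refine if_congr ⟨?_, ?_⟩ rfl rfl
  · rintro rfl; ext; simp
  · rintro rfl; ext; simp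

open Classical in
-- The map `x ↦ x ∧ t` meets the factor `u` only if `t` is the second part of `u`, and then only at
-- the first part. If `t` met the basepoint the left side would vanish, whereas the right side might
-- not, since the first part of `u` could still avoid the basepoint.
lemma odotMap_join_sing (e : Fin p ⊕ Fin q ≃ Fin n) (u : Fin n → S1 ℓ) (t : Fin q → S1 ℓ)
    (ht : ∀ i, t i ≠ S1.pt ℓ) (a : A) : odotMap k A (sphJoinHom e (Sph.mk t)) (sing u a) =
      if t = u ∘ e ∘ Sum.inr then sing (u ∘ e ∘ Sum.inl) a else 0 := by
  refine ext_coord fun w hw => ?_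
  have h0 : ∀ i, (Sum.elim w t ∘ e.symm) i ≠ S1.pt ℓ := fun i => by
    obtain ⟨i, rfl⟩ := e.surjective i
    rcases i with i | i <;> simp [hw, ht]
  rw [coord_odotMap_join, coord_sing u h0]
  by_cases h : t = u ∘ e ∘ Sum.inr
  · rw [if_pos h, coord_sing _ hw]
    exact if_congr ((Sph.eq_elim_comp_symm _ _ _ _).trans (and_iff_left h)) rfl rfl
  · rw [if_neg h, if_neg fun h' => h ((Sph.eq_elim_comp_symm _ _ _ _).1 h').2, coord_zero]

/-! ### Matrix correspondences evaluated on single factors. -/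

namespace MtrcEl

lemma apply_eq_sum (f : MtrcEl k A B n ℓ) (a : Odot A (sphPt n ℓ)) (i j : Fin n → Fin 2) :
    f a i j = ∑ u : Fin n → S1 ℓ, f (sing u (a.coord u)) i j := by
  conv_lhs => rw [← sum_sing a, map_sum, Matrix.sum_apply]

/-- Both sides are additive and `sum_sing` decomposes the argument; factors at tuples that meet the
basepoint contribute nothing. -/
lemma ext_sing {f g : MtrcEl k A B n ℓ}
    (h : ∀ u : Fin n → S1 ℓ, (∀ i, u i ≠ S1.pt ℓ) → ∀ a i j, f (sing u a) i j = g (sing u a) i j) :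
    f = g := by
  refine MtrcEl.ext' fun a i j => ?_
  rw [apply_eq_sum, apply_eq_sum g]
  refine Finset.sum_congr rfl fun u _ => ?_
  by_cases hu : ∀ i, u i ≠ S1.pt ℓ
  · exact h u hu _ i j
  · obtain ⟨l, hl⟩ := not_forall.1 hu
    rw [sing_of_eq_pt u l (not_not.1 hl), map_zero, map_zero]

lemma act_sing (e : Fin n ≃ Fin m) (f : MtrcEl k A B n ℓ) (u : Fin m → S1 ℓ) (a : A)
    (i j : Fin m → Fin 2) : MtrcEl.act e f (sing u a) i j = f (sing (u ∘ e) a) (i ∘ e) (j ∘ e) := by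
  change f (odotMap k A (sphActHom ℓ e) (sing u a)) (i ∘ e) (j ∘ e) = _
  rw [odotMap_act_sing]

open Classical in
-- The corner map tests the last letters of `i` and `j`, and the projection with index `s` tests the
-- last letter of `u`; what remains is `f` on the shortened words.
lemma str_sing (f : MtrcEl k A B m ℓ) (s : S1 ℓ) (u : Fin (m + 1) → S1 ℓ)
    (hu : ∀ i, u i ≠ S1.pt ℓ) (a : A) (i j : Fin (m + 1) → Fin 2) :
    MtrcEl.str f s (sing u a) i j =
      if (i (Fin.natAdd m 0) = 0 ∧ j (Fin.natAdd m 0) = 0) ∧ u (Fin.natAdd m 0) = s then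
        f (sing (u ∘ Fin.castAdd 1) a) (i ∘ Fin.castAdd 1) (j ∘ Fin.castAdd 1) else 0 := by
  -- The last position is written `Fin.natAdd m 0`, the form in which `extR` and `shift` treat the
  -- added letter.
  change (if i (Fin.natAdd m 0) = 0 ∧ j (Fin.natAdd m 0) = 0 then
    f (odotMap k A (sphSmashHom m (Sph.mk fun _ : Fin 1 => s)) (sing u a)) (i ∘ Fin.castAdd 1)
      (j ∘ Fin.castAdd 1) else 0) = _
  have h0 : odotMap k A (sphSmashHom m (Sph.mk fun _ : Fin 1 => s)) (sing u a) =
      if u (Fin.natAdd m 0) = s then sing (u ∘ Fin.castAdd 1) a else 0 := by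
    -- For `s` the basepoint the projection is zero, and `hu` prevents the last letter of `u` from
    -- being `s`, so the right side is zero as well.
    by_cases hs : s = S1.pt ℓ
    · rw [if_neg fun h => hu _ (h.trans hs)]
      have h1 : Sph.mk (fun _ : Fin 1 => s) = Sph.pt 1 ℓ := Sph.mk_eq_pt _ 0 hs
      rw [h1, ← sphJoinHom_finSumFinEquiv, odotMap_join_pt]
    · rw [← sphJoinHom_finSumFinEquiv, odotMap_join_sing _ _ _ fun _ => hs]
      refine if_congr ⟨fun h => ?_, ?_⟩ ?_ rfl
      · simpa using (congrFun h 0).symm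
      · rintro rfl
        ext l
        fin_cases l
        rfl
      · congr 1
  rw [h0]
  split_ifs <;> simp_all

lemma res_apply (θ : ℓ₁ ⟶ ℓ₂) (f : MtrcEl k A B n ℓ₁) (a : Odot A (sphPt n ℓ₂)) :
    MtrcEl.res θ f a = f (odotMap k A (sphResHom n θ) a) := rfl

end MtrcEl
end MatrixTransfers

/-! ### Composition of matrix correspondences. -/

section MatrixTransfers

open TensorProduct Odot

variable {n m p q r p' q' : ℕ} {ℓ ℓ₁ ℓ₂ : SimplexCategoryᵒᵖ}

/-- A word of length `n` is a pair of words, cut along `e`. It is used both for matrix indices (`α =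
Fin 2`) and for tuples of simplices (`α = S1 ℓ`), which is why the finiteness structures on words
are left arbitrary. -/
lemma sum_words {α M : Type*} [Fintype α] [DecidableEq α] [AddCommMonoid M] [Fintype (Fin n → α)]
    [Fintype (Fin p → α)] [Fintype (Fin q → α)]
    (e : Fin p ⊕ Fin q ≃ Fin n)
    (F : (Fin p → α) → (Fin q → α) → M) :
    ∑ l : Fin n → α, F (l ∘ e ∘ Sum.inl) (l ∘ e ∘ Sum.inr) = ∑ x, ∑ y, F x y := by
  rw [← Fintype.sum_prod_type']
  exact Fintype.sum_equiv ((Equiv.arrowCongr e.symm (Equiv.refl _)).trans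
    (Equiv.sumArrowEquivProdArrow _ _ _)) _ _ fun l => rfl

variable {k : Type u} [CommRing k] {A B C A' B' : Type u} [Ring A] [Algebra k A] [Ring B]
  [Algebra k B] [Ring C] [Algebra k C] [Ring A'] [Algebra k A'] [Ring B'] [Algebra k B']

namespace MtrcEl

/-- The `(i, j)`-entry of the image of `a` under `f ⊙ S^q`. -/
noncomputable def slice (e : Fin p ⊕ Fin q ≃ Fin n) (f : MtrcEl k A B p ℓ)
    (a : Odot A (sphPt n ℓ)) (i j : Fin p → Fin 2) : Odot B (sphPt q ℓ) :=
  fun t => f (odotMap k A (sphJoinHom e t.1) a) i j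

/-- The formula for `slice` remains valid at the basepoint, because smashing with the basepoint
pulls `a` back to `0`. -/
lemma slice_comp (e : Fin p ⊕ Fin q ≃ Fin n) (f : MtrcEl k A B p ℓ) (a : Odot A (sphPt n ℓ))
    (i j : Fin p → Fin 2) (t : Sph q ℓ) :
    (slice e f a i j).comp t = f (odotMap k A (sphJoinHom e t) a) i j :=
  comp_apply_coe (K := sphPt q ℓ) (fun t => f (odotMap k A (sphJoinHom e t) a) i j)
    (by
      change f (odotMap k A (sphJoinHom e (Sph.pt q ℓ)) a) i j = 0
      rw [odotMap_join_pt, map_zero, Matrix.zero_apply]) t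

lemma slice_coord (e : Fin p ⊕ Fin q ≃ Fin n) (f : MtrcEl k A B p ℓ) (a : Odot A (sphPt n ℓ))
    (i j : Fin p → Fin 2) (t : Fin q → S1 ℓ) :
    (slice e f a i j).coord t = f (odotMap k A (sphJoinHom e (Sph.mk t)) a) i j :=
  slice_comp e f a i j _

/-- A single factor goes to a single factor, since only `t` equal to the second part of `u` sees the
support of `sing u a`. -/
lemma slice_sing (e : Fin p ⊕ Fin q ≃ Fin n) (f : MtrcEl k A B p ℓ) (u : Fin n → S1 ℓ) (a : A)
    (i j : Fin p → Fin 2) :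
    slice e f (sing u a) i j = sing (u ∘ e ∘ Sum.inr) (f (sing (u ∘ e ∘ Sum.inl) a) i j) := by
  classical
  refine ext_coord fun t ht => ?_
  rw [coord_sing _ ht, slice_coord, odotMap_join_sing e u t ht]
  split_ifs <;> simp

/-- The composition of matrix correspondences, with coordinates arranged by `e`. -/
noncomputable def matComp (e : Fin p ⊕ Fin q ≃ Fin n) (f : MtrcEl k A B p ℓ)
    (g : MtrcEl k B C q ℓ) : MtrcEl k A C n ℓ where
  toFun a := Matrix.of fun i j =>
    g (slice e f a (i ∘ e ∘ Sum.inl) (j ∘ e ∘ Sum.inl)) (i ∘ e ∘ Sum.inr) (j ∘ e ∘ Sum.inr)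
  map_smul' c a := by
    ext i j
    have h : slice e f (c • a) (i ∘ e ∘ Sum.inl) (j ∘ e ∘ Sum.inl) =
        c • slice e f a (i ∘ e ∘ Sum.inl) (j ∘ e ∘ Sum.inl) := by
      funext t; simp [slice]
    simp [h]
  map_zero' := by
    ext i j
    have h : slice e f 0 (i ∘ e ∘ Sum.inl) (j ∘ e ∘ Sum.inl) = 0 := by
      funext t; simp [slice]
    simp [h]
  map_add' a b := by
    ext i j
    have h : slice e f (a + b) (i ∘ e ∘ Sum.inl) (j ∘ e ∘ Sum.inl) =
        slice e f a (i ∘ e ∘ Sum.inl) (j ∘ e ∘ Sum.inl) +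
          slice e f b (i ∘ e ∘ Sum.inl) (j ∘ e ∘ Sum.inl) := by
      funext t; simp [slice]
    simp [h]
  map_mul' a b := by
    ext i j
    -- Multiplicativity of `f` makes the slices multiply like matrices over `B ⊙ S^q`; then `g`
    -- turns each product of slices into a sum over inner words.
    have h : slice e f (a * b) (i ∘ e ∘ Sum.inl) (j ∘ e ∘ Sum.inl) =
        ∑ l, slice e f a (i ∘ e ∘ Sum.inl) l * slice e f b l (j ∘ e ∘ Sum.inl) := by
      funext t; simp [slice, Matrix.mul_apply]
    rw [Matrix.of_apply, h, map_sum, Matrix.sum_apply, Matrix.mul_apply]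
    simp only [map_mul, Matrix.mul_apply, Matrix.of_apply]
    -- An outer word `x` and an inner word `y` together form one summation index of the product of
    -- `2ⁿ × 2ⁿ`-matrices.
    exact (sum_words e fun x y => g (slice e f a (i ∘ e ∘ Sum.inl) x) (i ∘ e ∘ Sum.inr) y *
      g (slice e f b x (j ∘ e ∘ Sum.inl)) y (j ∘ e ∘ Sum.inr)).symm

lemma matComp_apply (e : Fin p ⊕ Fin q ≃ Fin n) (f : MtrcEl k A B p ℓ) (g : MtrcEl k B C q ℓ)
    (a : Odot A (sphPt n ℓ)) (i j : Fin n → Fin 2) : matComp e f g a i j =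
      g (slice e f a (i ∘ e ∘ Sum.inl) (j ∘ e ∘ Sum.inl)) (i ∘ e ∘ Sum.inr) (j ∘ e ∘ Sum.inr) := rfl

/-- The working formula for composition. Most identities about `matComp` follow from it by comparing
how two bijections cut the words `u`, `i`, `j`. -/
lemma matComp_sing (e : Fin p ⊕ Fin q ≃ Fin n) (f : MtrcEl k A B p ℓ) (g : MtrcEl k B C q ℓ)
    (u : Fin n → S1 ℓ) (a : A) (i j : Fin n → Fin 2) : matComp e f g (sing u a) i j =
      g (sing (u ∘ e ∘ Sum.inr) (f (sing (u ∘ e ∘ Sum.inl) a) (i ∘ e ∘ Sum.inl) (j ∘ e ∘ Sum.inl)))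
        (i ∘ e ∘ Sum.inr) (j ∘ e ∘ Sum.inr) := by
  rw [matComp_apply, slice_sing]

lemma act_matComp (σ : Fin n ≃ Fin m) (e : Fin p ⊕ Fin q ≃ Fin n) (f : MtrcEl k A B p ℓ)
    (g : MtrcEl k B C q ℓ) : MtrcEl.act σ (matComp e f g) = matComp (e.trans σ) f g :=
  ext_sing fun u _ a i j => by rw [act_sing, matComp_sing, matComp_sing]; rfl

lemma matComp_act (τ : Fin p ≃ Fin p') (ρ : Fin q ≃ Fin q') (e : Fin p' ⊕ Fin q' ≃ Fin n)
    (f : MtrcEl k A B p ℓ) (g : MtrcEl k B C q ℓ) :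
    matComp e (MtrcEl.act τ f) (MtrcEl.act ρ g) = matComp ((Equiv.sumCongr τ ρ).trans e) f g :=
  ext_sing fun u _ a i j => by
    rw [matComp_sing, matComp_sing, act_sing, act_sing]; rfl

lemma zero_matComp (e : Fin p ⊕ Fin q ≃ Fin n) (g : MtrcEl k B C q ℓ) :
    matComp e (0 : MtrcEl k A B p ℓ) g = 0 :=
  MtrcEl.ext' fun _ _ _ => congrFun (congrFun (map_zero g) _) _

lemma matComp_zero (e : Fin p ⊕ Fin q ≃ Fin n) (f : MtrcEl k A B p ℓ) :
    matComp e f (0 : MtrcEl k B C q ℓ) = 0 := rfl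

/-- Pulling `sing u a` back along `θ` spreads it over all tuples that `θ` maps to `u`, so `ext_sing`
does not help. Coordinates are compared instead: `θ` acts letter by letter and therefore commutes
with cutting. -/
lemma res_matComp (θ : ℓ₁ ⟶ ℓ₂) (e : Fin p ⊕ Fin q ≃ Fin n) (f : MtrcEl k A B p ℓ₁)
    (g : MtrcEl k B C q ℓ₁) :
    MtrcEl.res θ (matComp e f g) = matComp e (MtrcEl.res θ f) (MtrcEl.res θ g) := by
  refine MtrcEl.ext' fun a i j => ?_
  rw [res_apply, matComp_apply, matComp_apply, res_apply]
  refine congrArg (fun b => g b _ _) (ext_coord fun t _ => ?_)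
  rw [coord_odotMap_res]
  rw [slice_coord, slice_coord, res_apply]
  refine congrArg (fun b => f b _ _) (ext_coord fun w _ => ?_)
  rw [coord_odotMap_join, coord_odotMap_res, coord_odotMap_res, coord_odotMap_join]
  congr 1
  ext z
  obtain ⟨z, rfl⟩ := e.surjective z
  rcases z with z | z <;> simp

/-- Under `extR e 1` the added letter is the last one of the second part, so the tests made by `str`
are the same on both sides. -/
lemma str_matComp (e : Fin p ⊕ Fin q ≃ Fin n) (f : MtrcEl k A B p ℓ) (g : MtrcEl k B C q ℓ)
    (s : S1 ℓ) : MtrcEl.str (matComp e f g) s =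
      matComp (SymmetricSpectrum.extR e 1) f (MtrcEl.str g s) := by
  classical
  refine ext_sing fun u hu a i j => ?_
  rw [str_sing _ _ _ hu, matComp_sing, matComp_sing,
    str_sing g s (u ∘ SymmetricSpectrum.extR e 1 ∘ Sum.inr) fun _ => hu _]
  refine if_congr (by simp) ?_ rfl
  simp [Function.comp_def]

lemma apply_sing_ite (f : MtrcEl k A B n ℓ) (u : Fin n → S1 ℓ) (c : Prop) [Decidable c] (a : A)
    (i j : Fin n → Fin 2) :
    f (sing u (if c then a else 0)) i j = if c then f (sing u a) i j else 0 := by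
  split_ifs
  · rfl
  · rw [sing_zero, map_zero, Matrix.zero_apply]

/-- The test of the added letter either keeps the value or replaces it by zero. Since `g` preserves
zero, it may be made before or after applying `g`, provided that `shift` hands the letter over from
the first part to the second. -/
lemma matComp_str (e : Fin (p + 1) ⊕ Fin q ≃ Fin n) (f : MtrcEl k A B p ℓ) (s : S1 ℓ)
    (g : MtrcEl k B C q ℓ) : matComp e (MtrcEl.str f s) g =
      matComp ((SymmetricSpectrum.shift p q).trans e) f (MtrcEl.str g s) := by
  classical
  refine ext_sing fun u hu a i j => ?_
  rw [matComp_sing, matComp_sing, str_sing f s (u ∘ e ∘ Sum.inl) fun _ => hu _,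
    str_sing g s (u ∘ (SymmetricSpectrum.shift p q).trans e ∘ Sum.inr) fun _ => hu _]
  rw [apply_sing_ite]
  refine if_congr (by simp) ?_ rfl
  simp [Function.comp_def]

/-- Both sides apply `f`, `g`, `h` in turn to the three parts of the words. The bijection on the
left is the one that `ap_associator_inv` produces. -/
lemma matComp_assoc {D : Type u} [Ring D] [Algebra k D] (e : Fin p ⊕ Fin m ≃ Fin n)
    (e' : Fin q ⊕ Fin r ≃ Fin m) (f : MtrcEl k A B p ℓ) (g : MtrcEl k B C q ℓ)
    (h : MtrcEl k C D r ℓ) :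
    matComp ((Equiv.sumCongr finSumFinEquiv.symm (Equiv.refl _)).trans
        ((Equiv.sumAssoc _ _ _).trans ((Equiv.sumCongr (Equiv.refl _) e').trans e)))
      (matComp finSumFinEquiv f g) h = matComp e f (matComp e' g h) := by
  refine ext_sing fun u _ a i j => ?_
  rw [matComp_sing, matComp_sing, matComp_sing, matComp_sing]
  simp [Function.comp_def]

/-! ### Tensor products of matrix correspondences. -/

/-- The linear map given by the entries of a matrix correspondence on one factor. -/
noncomputable def entry (f : MtrcEl k A B n ℓ) (u : Fin n → S1 ℓ) (i j : Fin n → Fin 2) :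
    A →ₗ[k] B where
  toFun a := f (sing u a) i j
  map_add' a b := by rw [sing_add, map_add, Matrix.add_apply]
  map_smul' c a := by rw [sing_smul, map_smul, Matrix.smul_apply]; rfl

lemma entry_apply (f : MtrcEl k A B n ℓ) (u : Fin n → S1 ℓ) (i j : Fin n → Fin 2) (a : A) :
    entry f u i j a = f (sing u a) i j := rfl

open Classical in
-- The sum is an entry of the matrix product `f (sing u a) * f (sing w b)`, which is `f` of a
-- product of orthogonal elements unless `u = w`.
lemma sum_entry_mul (f : MtrcEl k A B n ℓ) (u w : Fin n → S1 ℓ) (i j : Fin n → Fin 2) (a b : A) :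
    ∑ l, entry f u i l a * entry f w l j b = if u = w then entry f u i j (a * b) else 0 := by
  simp only [entry_apply]
  rw [← Matrix.mul_apply, ← map_mul, sing_mul_sing]
  split_ifs <;> simp

/-- The linear map given by the entries of the tensor product of two matrix correspondences on one
factor. -/
noncomputable def tensorEntry (e : Fin p ⊕ Fin q ≃ Fin n) (f : MtrcEl k A A' p ℓ)
    (g : MtrcEl k B B' q ℓ) (u : Fin n → S1 ℓ) (i j : Fin n → Fin 2) :
    A ⊗[k] B →ₗ[k] A' ⊗[k] B' :=
  TensorProduct.map
    (entry f (u ∘ e ∘ Sum.inl) (i ∘ e ∘ Sum.inl) (j ∘ e ∘ Sum.inl))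
    (entry g (u ∘ e ∘ Sum.inr) (i ∘ e ∘ Sum.inr) (j ∘ e ∘ Sum.inr))

open Classical in
-- Both sides are biadditive in `x` and `y`, so pure tensors suffice. There the sum over `l` splits
-- into one sum for each tensor factor, and the deltas for the two parts combine to the delta for `u
-- = w`.
lemma sum_tensorEntry_mul (e : Fin p ⊕ Fin q ≃ Fin n) (f : MtrcEl k A A' p ℓ)
    (g : MtrcEl k B B' q ℓ) (u w : Fin n → S1 ℓ) (i j : Fin n → Fin 2) (x y : A ⊗[k] B) :
    ∑ l, tensorEntry e f g u i l x * tensorEntry e f g w l j y =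
      if u = w then tensorEntry e f g u i j (x * y) else 0 := by
  induction x using TensorProduct.induction_on with
  | zero => simp
  | add x x' hx hx' =>
    simp only [map_add, add_mul, Finset.sum_add_distrib, hx, hx']
    split_ifs <;> simp
  | tmul a b =>
    induction y using TensorProduct.induction_on with
    | zero => simp
    | add y y' hy hy' =>
      simp only [map_add, mul_add, Finset.sum_add_distrib, hy, hy']
      split_ifs <;> simp
    | tmul a' b' =>
      simp only [tensorEntry, TensorProduct.map_tmul, Algebra.TensorProduct.tmul_mul_tmul]
      refine (sum_words e fun l₁ l₂ => (entry f (u ∘ e ∘ Sum.inl) (i ∘ e ∘ Sum.inl) l₁ a *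
        entry f (w ∘ e ∘ Sum.inl) l₁ (j ∘ e ∘ Sum.inl) a') ⊗ₜ[k]
        (entry g (u ∘ e ∘ Sum.inr) (i ∘ e ∘ Sum.inr) l₂ b *
          entry g (w ∘ e ∘ Sum.inr) l₂ (j ∘ e ∘ Sum.inr) b')).trans ?_
      simp only [← TensorProduct.tmul_sum, ← TensorProduct.sum_tmul]
      rw [sum_entry_mul, sum_entry_mul]
      have h : u = w ↔ u ∘ e ∘ Sum.inl = w ∘ e ∘ Sum.inl ∧ u ∘ e ∘ Sum.inr = w ∘ e ∘ Sum.inr := by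
        rw [← Sph.eq_elim_comp_symm, (Sph.eq_elim_comp_symm e u _ _).2 ⟨rfl, rfl⟩]
      by_cases h1 : u ∘ e ∘ Sum.inl = w ∘ e ∘ Sum.inl <;>
        by_cases h2 : u ∘ e ∘ Sum.inr = w ∘ e ∘ Sum.inr <;> simp [h, h1, h2]

/-- The tensor product of matrix correspondences, with coordinates arranged by `e`. -/
noncomputable def matTensor (e : Fin p ⊕ Fin q ≃ Fin n) (f : MtrcEl k A A' p ℓ)
    (g : MtrcEl k B B' q ℓ) : MtrcEl k (A ⊗[k] B) (A' ⊗[k] B') n ℓ where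
  toFun c := Matrix.of fun i j => ∑ u : Fin n → S1 ℓ, tensorEntry e f g u i j (c.coord u)
  map_smul' a c := by
    ext i j
    simp [coord_smul, Finset.smul_sum]
  map_zero' := by
    ext i j
    simp [coord_zero]
  map_add' c d := by
    ext i j
    simp [coord_add, Finset.sum_add_distrib]
  map_mul' c d := by
    classical
    ext i j
    simp only [Matrix.mul_apply, Matrix.of_apply, coord_mul, Finset.sum_mul_sum]
    -- The product of the two sums runs over pairs of tuples `u`, `w` and an inner index. Summing
    -- over the inner index before `w` leaves only the terms with `u = w`.
    rw [Finset.sum_comm]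
    refine Finset.sum_congr rfl fun u _ => ?_
    rw [Finset.sum_comm, Finset.sum_congr rfl fun w _ => sum_tensorEntry_mul e f g u w i j _ _,
      Finset.sum_ite_eq, if_pos (Finset.mem_univ u)]

lemma matTensor_apply (e : Fin p ⊕ Fin q ≃ Fin n) (f : MtrcEl k A A' p ℓ) (g : MtrcEl k B B' q ℓ)
    (c : Odot (A ⊗[k] B) (sphPt n ℓ)) (i j : Fin n → Fin 2) :
    matTensor e f g c i j = ∑ u : Fin n → S1 ℓ, tensorEntry e f g u i j (c.coord u) := rfl

/-- The tensor product of matrix correspondences on elements whose components are decomposable. -/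
lemma matTensor_of_coord (e : Fin p ⊕ Fin q ≃ Fin n) (f : MtrcEl k A A' p ℓ)
    (g : MtrcEl k B B' q ℓ) (c : Odot (A ⊗[k] B) (sphPt n ℓ)) (a : Odot A (sphPt p ℓ))
    (b : Odot B (sphPt q ℓ))
    (h : ∀ u, c.coord u = a.coord (u ∘ e ∘ Sum.inl) ⊗ₜ[k] b.coord (u ∘ e ∘ Sum.inr))
    (i j : Fin n → Fin 2) : matTensor e f g c i j =
      f a (i ∘ e ∘ Sum.inl) (j ∘ e ∘ Sum.inl) ⊗ₜ[k] g b (i ∘ e ∘ Sum.inr) (j ∘ e ∘ Sum.inr) := by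
  classical
  rw [matTensor_apply, apply_eq_sum f a, apply_eq_sum g b]
  simp only [h, tensorEntry, TensorProduct.map_tmul, entry_apply]
  have : Fintype (S1 ℓ) := Fintype.ofFinite _
  -- Expanding `f a` and `g b` over the factors turns the right side into a sum over pairs of
  -- tuples, and such pairs are the tuples of length `n`.
  refine (sum_words e fun x y => f (sing x (a.coord x)) (i ∘ e ∘ Sum.inl) (j ∘ e ∘ Sum.inl) ⊗ₜ[k]
    g (sing y (b.coord y)) (i ∘ e ∘ Sum.inr) (j ∘ e ∘ Sum.inr)).trans ?_
  simp only [← TensorProduct.tmul_sum, ← TensorProduct.sum_tmul]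

/-- If `w` avoids the basepoint, the test `w = u` factors into tests of the two parts. Otherwise one
part contains a basepoint letter, so that one tensor factor vanishes along with the left side. -/
lemma coord_sing_tmul (e : Fin p ⊕ Fin q ≃ Fin n) (u w : Fin n → S1 ℓ) (a : A) (b : B) :
    (sing u (a ⊗ₜ[k] b)).coord w = (sing (u ∘ e ∘ Sum.inl) a).coord (w ∘ e ∘ Sum.inl) ⊗ₜ[k]
      (sing (u ∘ e ∘ Sum.inr) b).coord (w ∘ e ∘ Sum.inr) := by
  classical
  by_cases hw : ∀ i, w i ≠ S1.pt ℓ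
  · rw [coord_sing _ hw, coord_sing (w := w ∘ e ∘ Sum.inl) _ fun _ => hw _,
      coord_sing (w := w ∘ e ∘ Sum.inr) _ fun _ => hw _]
    have h : w = u ↔ w ∘ e ∘ Sum.inl = u ∘ e ∘ Sum.inl ∧ w ∘ e ∘ Sum.inr = u ∘ e ∘ Sum.inr := by
      rw [← Sph.eq_elim_comp_symm, (Sph.eq_elim_comp_symm e w _ _).2 ⟨rfl, rfl⟩]
    by_cases h1 : w ∘ e ∘ Sum.inl = u ∘ e ∘ Sum.inl <;>
      by_cases h2 : w ∘ e ∘ Sum.inr = u ∘ e ∘ Sum.inr <;> simp [h, h1, h2]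
  · obtain ⟨i, hi⟩ := not_forall.1 hw
    rw [coord_of_eq_pt _ w i (not_not.1 hi)]
    obtain ⟨i, rfl⟩ := e.surjective i
    rcases i with i | i
    · rw [coord_of_eq_pt _ (w ∘ e ∘ Sum.inl) i (not_not.1 hi), TensorProduct.zero_tmul]
    · rw [coord_of_eq_pt _ (w ∘ e ∘ Sum.inr) i (not_not.1 hi), TensorProduct.tmul_zero]

lemma matTensor_sing (e : Fin p ⊕ Fin q ≃ Fin n) (f : MtrcEl k A A' p ℓ) (g : MtrcEl k B B' q ℓ)
    (u : Fin n → S1 ℓ) (a : A) (b : B) (i j : Fin n → Fin 2) :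
    matTensor e f g (sing u (a ⊗ₜ[k] b)) i j =
      f (sing (u ∘ e ∘ Sum.inl) a) (i ∘ e ∘ Sum.inl) (j ∘ e ∘ Sum.inl) ⊗ₜ[k]
        g (sing (u ∘ e ∘ Sum.inr) b) (i ∘ e ∘ Sum.inr) (j ∘ e ∘ Sum.inr) :=
  matTensor_of_coord e f g _ _ _ (fun w => coord_sing_tmul e u w a b) i j

/-- On a single factor each entry is `k`-linear, and pure tensors span. -/
lemma ext_sing_tmul {f g : MtrcEl k (A ⊗[k] B) C n ℓ}
    (h : ∀ u : Fin n → S1 ℓ, (∀ i, u i ≠ S1.pt ℓ) → ∀ a b i j,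
      f (sing u (a ⊗ₜ b)) i j = g (sing u (a ⊗ₜ b)) i j) : f = g :=
  ext_sing fun u hu c i j => by
    have h' : entry f u i j = entry g u i j := TensorProduct.ext' fun a b => h u hu a b i j
    exact LinearMap.congr_fun h' c

lemma act_matTensor (σ : Fin n ≃ Fin m) (e : Fin p ⊕ Fin q ≃ Fin n) (f : MtrcEl k A A' p ℓ)
    (g : MtrcEl k B B' q ℓ) : MtrcEl.act σ (matTensor e f g) = matTensor (e.trans σ) f g :=
  ext_sing_tmul fun u _ a b i j => by rw [act_sing, matTensor_sing, matTensor_sing]; rfl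

lemma matTensor_act (τ : Fin p ≃ Fin p') (ρ : Fin q ≃ Fin q') (e : Fin p' ⊕ Fin q' ≃ Fin n)
    (f : MtrcEl k A A' p ℓ) (g : MtrcEl k B B' q ℓ) :
    matTensor e (MtrcEl.act τ f) (MtrcEl.act ρ g) = matTensor ((Equiv.sumCongr τ ρ).trans e) f g :=
  ext_sing_tmul fun u _ a b i j => by
    rw [matTensor_sing, matTensor_sing, act_sing, act_sing]; rfl

lemma zero_matTensor (e : Fin p ⊕ Fin q ≃ Fin n) (g : MtrcEl k B B' q ℓ) :
    matTensor e (0 : MtrcEl k A A' p ℓ) g = 0 :=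
  ext_sing_tmul fun u _ a b i j => by
    rw [matTensor_sing]; exact TensorProduct.zero_tmul _ _

lemma matTensor_zero (e : Fin p ⊕ Fin q ≃ Fin n) (f : MtrcEl k A A' p ℓ) :
    matTensor e f (0 : MtrcEl k B B' q ℓ) = 0 :=
  ext_sing_tmul fun u _ a b i j => by
    rw [matTensor_sing]; exact TensorProduct.tmul_zero _ _

/-- The pullback of `sing u (a ⊗ₜ b)` is spread over several factors, but its coordinates are still
pure tensors of the coordinates of two pulled back elements, as `matTensor_of_coord` requires. -/
lemma res_matTensor (θ : ℓ₁ ⟶ ℓ₂) (e : Fin p ⊕ Fin q ≃ Fin n) (f : MtrcEl k A A' p ℓ₁)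
    (g : MtrcEl k B B' q ℓ₁) :
    MtrcEl.res θ (matTensor e f g) = matTensor e (MtrcEl.res θ f) (MtrcEl.res θ g) := by
  refine ext_sing_tmul fun u _ a b i j => ?_
  rw [matTensor_sing, res_apply, res_apply, res_apply]
  refine matTensor_of_coord e f g _ _ _ (fun w => ?_) i j
  rw [coord_odotMap_res, coord_odotMap_res, coord_odotMap_res]
  exact coord_sing_tmul e u _ a b

lemma str_matTensor (e : Fin p ⊕ Fin q ≃ Fin n) (f : MtrcEl k A A' p ℓ) (g : MtrcEl k B B' q ℓ)
    (s : S1 ℓ) : MtrcEl.str (matTensor e f g) s =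
      matTensor (SymmetricSpectrum.extR e 1) f (MtrcEl.str g s) := by
  classical
  refine ext_sing_tmul fun u hu a b i j => ?_
  rw [str_sing _ _ _ hu, matTensor_sing, matTensor_sing,
    str_sing g s (u ∘ SymmetricSpectrum.extR e 1 ∘ Sum.inr) fun _ => hu _,
    TensorProduct.tmul_ite]
  refine if_congr (by simp) ?_ rfl
  simp [Function.comp_def]

/-- A pure tensor vanishes as soon as one factor does, so either factor may carry the test of the
letter added with `s`. -/
lemma matTensor_str (e : Fin (p + 1) ⊕ Fin q ≃ Fin n) (f : MtrcEl k A A' p ℓ) (s : S1 ℓ)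
    (g : MtrcEl k B B' q ℓ) : matTensor e (MtrcEl.str f s) g =
      matTensor ((SymmetricSpectrum.shift p q).trans e) f (MtrcEl.str g s) := by
  classical
  refine ext_sing_tmul fun u hu a b i j => ?_
  rw [matTensor_sing, matTensor_sing, str_sing f s (u ∘ e ∘ Sum.inl) fun _ => hu _,
    str_sing g s (u ∘ (SymmetricSpectrum.shift p q).trans e ∘ Sum.inr) fun _ => hu _,
    TensorProduct.tmul_ite, TensorProduct.ite_tmul]
  refine if_congr (by simp) ?_ rfl
  simp [Function.comp_def]

end MtrcEl
end MatrixTransfers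

/-! ### Maps out of the sphere spectrum, and the coherence maps of the smash product on generators.
-/

namespace SymmetricSpectrum

variable {X Y Z W : SymmetricSpectrum.{u}} {l m n p q r s : ℕ} {ℓ : SimplexCategoryᵒᵖ}

open Opposite Simplicial in
/-- A map out of the sphere spectrum is determined by the image of the non-basepoint of `S⁰`. -/
lemma sphere_hom_ext {φ ψ : sphereSpectrum.{u} ⟶ X}
    (h : ap φ (sph (ℓ := op ⦋0⦌) fun i : Fin 0 => i.elim0) =
      ap ψ (sph (ℓ := op ⦋0⦌) fun i : Fin 0 => i.elim0)) : φ = ψ := by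
  refine hom_ext' fun {n ℓ} t => ?_
  induction t using sphere_ind with
  | h0 => rw [ap_pt, ap_pt]
  | h1 t =>
    -- The non-basepoint of `S⁰` is degenerated to degree `ℓ` and smashed with `t₁, …, tₙ`; the
    -- result lies in level `0 + n`, hence the relabelling.
    have h0 : sph.{u} t = sphereSpectrum.{u}.seq.act (finCongr (Nat.zero_add n))
        (sphereSpectrum.{u}.iter (sphereSpectrum.{u}.seq.res (SimplexCategory.const ℓ.unop ⦋0⦌ 0).op
          (sph (ℓ := op ⦋0⦌) fun i : Fin 0 => i.elim0)) t) := by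
      rw [res_sph, iter_sph, act_sph]
      congr 1
      ext i
      have hi : (finCongr (Nat.zero_add n)).symm i = Fin.natAdd 0 i := Fin.ext (by simp)
      rw [Function.comp_apply, hi, Fin.append_right]
    rw [h0, ap_act, ap_act, ap_iter, ap_iter, ap_res, ap_res, h]

lemma ap_comp_of_eq {f : X ⟶ Y} (g : Y ⟶ Z) {x : X.seq.El n ℓ} {y : Y.seq.El n ℓ}
    (h : ap f x = y) : ap (f ≫ g) x = ap g y := congrArg (ap g) h

lemma ap_braiding_hom (e : Fin p ⊕ Fin q ≃ Fin n) (x : X.seq.El p ℓ) (y : Y.seq.El q ℓ) :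
    ap (β_ X Y).hom (elt e x y) = elt ((Equiv.sumComm _ _).trans e) y x := rfl

lemma ap_associator_hom (e : Fin m ⊕ Fin r ≃ Fin n) (e' : Fin p ⊕ Fin q ≃ Fin m)
    (x : X.seq.El p ℓ) (y : Y.seq.El q ℓ) (z : Z.seq.El r ℓ) :
    ap (α_ X Y Z).hom (elt (X := smash X Y) e (elt e' x y) z) = elt (Y := smash Y Z)
      ((Equiv.sumCongr (Equiv.refl _) finSumFinEquiv.symm).trans
        ((Equiv.sumAssoc _ _ _).symm.trans ((Equiv.sumCongr e' (Equiv.refl _)).trans e)))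
      x (elt finSumFinEquiv y z) := rfl

/-- The inverse is built from the associator and symmetries. The generator is first brought to the
standard form `tri`, on which `ap_assocIso_inv` knows it. -/
lemma ap_associator_inv (e : Fin p ⊕ Fin m ≃ Fin n) (e' : Fin q ⊕ Fin r ≃ Fin m)
    (x : X.seq.El p ℓ) (y : Y.seq.El q ℓ) (z : Z.seq.El r ℓ) :
    ap (α_ X Y Z).inv (elt (Y := smash Y Z) e x (elt e' y z)) = elt (X := smash X Y)
      ((Equiv.sumCongr finSumFinEquiv.symm (Equiv.refl _)).trans
        ((Equiv.sumAssoc _ _ _).trans ((Equiv.sumCongr (Equiv.refl _) e').trans e)))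
      (elt finSumFinEquiv x y) z := by
  rw [elt_elt]
  exact ap_assocIso_inv _ x y z

/-- The interchange of the middle factors only permutes the four blocks of positions; the elements
themselves do not change. -/
lemma ap_tensorμ (e : Fin m ⊕ Fin l ≃ Fin n) (e₁ : Fin p ⊕ Fin q ≃ Fin m)
    (e₂ : Fin r ⊕ Fin s ≃ Fin l) (x : X.seq.El p ℓ) (y : Y.seq.El q ℓ) (z : Z.seq.El r ℓ)
    (w : W.seq.El s ℓ) :
    ap (tensorμ X Y Z W) (elt (X := smash X Y) (Y := smash Z W) e (elt e₁ x y) (elt e₂ z w)) =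
      elt (X := smash X Z) (Y := smash Y W)
        ((Equiv.sumCongr finSumFinEquiv.symm finSumFinEquiv.symm).trans
          ((Equiv.sumSumSumComm _ _ _ _).trans ((Equiv.sumCongr e₁ e₂).trans e)))
        (elt finSumFinEquiv x z) (elt finSumFinEquiv y w) := by
  -- The five constituents of `tensorμ`, innermost first: two reassociations, the swap of `Y` and
  -- `Z`, and two reassociations back.
  change ap (assocIso X Z (smash Y W)).inv (ap (smashMap (𝟙 X) (assocHom Z Y W))
    (ap (smashMap (𝟙 X) (smashMap (swapHom Y Z) (𝟙 W))) (ap (smashMap (𝟙 X) (assocIso Y Z W).inv)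
      (ap (assocHom X Y (smash Z W)) (elt e (elt e₁ x y) (elt e₂ z w)))))) = _
  rw [ap_assocHom, tri, ap_smashMap, elt_elt, ap_assocIso_inv, tri', ap_smashMap, ap_smashMap,
    ap_smashMap, ap_swapHom, ap_assocHom, tri, elt_elt, ap_assocIso_inv, tri']
  refine congrArg (fun E => elt (X := smash X Z) (Y := smash Y W) E _ _) ?_
  refine equiv_ext₁ (fun i => ?_) fun i => ?_ <;>
    refine Fin.addCases (fun i => ?_) (fun i => ?_) i <;> simp

end SymmetricSpectrum

/-! ### The bimorphisms of correspondences, and spectrum maps given by homomorphisms. -/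

section MatrixTransfers

open TensorProduct Odot SymmetricSpectrum

variable {n m p q r : ℕ} {ℓ ℓ₁ ℓ₂ : SimplexCategoryᵒᵖ}
variable (k : Type u) [CommRing k] (A B C A' B' : Type u) [Ring A] [Algebra k A] [Ring B]
  [Algebra k B] [Ring C] [Algebra k C] [Ring A'] [Algebra k A'] [Ring B'] [Algebra k B']

/-- The composition of matrix correspondences as a bimorphism. -/
noncomputable def mtrcCompBimorphism :
    Bimorphism (mtrcSpectrum k A B) (mtrcSpectrum k B C) (mtrcSpectrum k A C) where
  b e f g := MtrcEl.matComp e f g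
  act_b σ e f g := MtrcEl.act_matComp σ e f g
  b_act τ ρ e f g := MtrcEl.matComp_act τ ρ e f g
  b_pt_left e g := MtrcEl.zero_matComp e g
  b_pt_right e f := MtrcEl.matComp_zero e f
  res_b θ e f g := MtrcEl.res_matComp θ e f g
  str_b e f g s := MtrcEl.str_matComp e f g s
  b_str e f s g := MtrcEl.matComp_str e f s g

/-- The tensor product of matrix correspondences as a bimorphism. -/
noncomputable def mtrcTensorBimorphism : Bimorphism (mtrcSpectrum k A A') (mtrcSpectrum k B B')
    (mtrcSpectrum k (A ⊗[k] B) (A' ⊗[k] B')) where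
  b e f g := MtrcEl.matTensor e f g
  act_b σ e f g := MtrcEl.act_matTensor σ e f g
  b_act τ ρ e f g := MtrcEl.matTensor_act τ ρ e f g
  b_pt_left e g := MtrcEl.zero_matTensor e g
  b_pt_right e f := MtrcEl.matTensor_zero e f
  res_b θ e f g := MtrcEl.res_matTensor θ e f g
  str_b e f g s := MtrcEl.str_matTensor e f g s
  b_str e f s g := MtrcEl.matTensor_str e f s g

variable {k A B C A' B'}

namespace MtrcEl

/-- An element of the spectrum `Mtrc_*(A, B)` as a matrix correspondence. -/
abbrev ofEl (x : (mtrcSpectrum k A B).seq.El n ℓ) : MtrcEl k A B n ℓ := x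

/-- The matrix correspondence `A ⊙ Sⁿ → A → B → M_{2ⁿ}(B)` given by the projection to the factor
with index `x`, the homomorphism `f` and the upper left corner. -/
noncomputable def corner (f : A →ₙₐ[k] B) (x : (sphPt n ℓ).X) : MtrcEl k A B n ℓ where
  toFun a := Matrix.of fun i j => if i = 0 ∧ j = 0 then f (a.comp x) else 0
  map_smul' c a := by
    ext i j
    by_cases h : i = 0 ∧ j = 0 <;> simp [h, comp_smul]
  map_zero' := by
    ext i j
    simp [comp_zero]
  map_add' a b := by
    ext i j
    by_cases h : i = 0 ∧ j = 0 <;> simp [h, comp_add]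
  map_mul' a b := by
    ext i j
    -- The constant word `0` indexes the upper left corner and is the only inner index that
    -- contributes.
    rw [Matrix.mul_apply, Finset.sum_eq_single 0]
    · by_cases h1 : i = 0 <;> by_cases h2 : j = 0 <;> simp [h1, h2, comp_mul]
    · intro l _ hl
      simp [hl]
    · simp

lemma corner_apply (f : A →ₙₐ[k] B) (x : (sphPt n ℓ).X) (a : Odot A (sphPt n ℓ))
    (i j : Fin n → Fin 2) : corner f x a i j = if i = 0 ∧ j = 0 then f (a.comp x) else 0 := rfl

lemma corner_pt (f : A →ₙₐ[k] B) : corner f (sphPt n ℓ).point = 0 :=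
  MtrcEl.ext' fun a i j => by
    rw [corner_apply, comp_pt, map_zero, ite_self]
    rfl

/-- The corner is indexed by a constant word, which permutations of letters respect; only the index
of the projection moves. -/
lemma corner_act (f : A →ₙₐ[k] B) (e : Fin n ≃ Fin m) (x : (sphPt n ℓ).X) :
    corner f (Pointed.Hom.toFun (sphActHom ℓ e) x) = MtrcEl.act e (corner f x) :=
  MtrcEl.ext' fun a i j => by
    refine Eq.trans ?_ (corner_apply f x (odotMap k A (sphActHom ℓ e) a) (i ∘ e) (j ∘ e)).symm
    rw [corner_apply, odotMap_comp_apply]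
    have h (i : Fin m → Fin 2) : i = 0 ↔ i ∘ e = 0 := by
      rw [funext_iff, funext_iff, ← e.forall_congr_right]; rfl
    exact if_congr (and_congr (h i) (h j)) rfl rfl

lemma corner_res (f : A →ₙₐ[k] B) (θ : ℓ₁ ⟶ ℓ₂) (x : (sphPt n ℓ₁).X) :
    corner f (Pointed.Hom.toFun (sphResHom n θ) x) = MtrcEl.res θ (corner f x) :=
  MtrcEl.ext' fun a i j => by
    rw [res_apply, corner_apply, corner_apply, odotMap_comp_apply]

/-- A word is constantly `0` exactly if its last letter is `0` and the rest is, so the corner of the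
corner is the corner. -/
lemma corner_str (f : A →ₙₐ[k] B) (x : (sphPt n ℓ).X) (s : S1 ℓ) :
    corner f (Pointed.Hom.toFun (sphSmashHom n (Sph.mk fun _ : Fin 1 => s)) x) =
      MtrcEl.str (corner f x) s :=
  MtrcEl.ext' fun a i j => by
    change _ = if i (Fin.last n) = 0 ∧ j (Fin.last n) = 0 then
      corner f x (odotMap k A (sphSmashHom n (Sph.mk fun _ : Fin 1 => s)) a)
        (i ∘ Fin.castSucc) (j ∘ Fin.castSucc) else 0
    rw [corner_apply, corner_apply, odotMap_comp_apply, ← ite_and]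
    have h (i : Fin (n + 1) → Fin 2) : i = 0 ↔ i (Fin.last n) = 0 ∧ i ∘ Fin.castSucc = 0 := by
      rw [funext_iff, funext_iff, Fin.forall_fin_succ']
      exact and_comm
    exact if_congr (by rw [h i, h j]; tauto) rfl rfl

end MtrcEl

/-- The map of spectra `𝕊 → Mtrc_*(A, B)` given by a non-unital homomorphism `A → B`. -/
noncomputable def mtrcOfHom (f : A →ₙₐ[k] B) : sphereSpectrum.{u} ⟶ mtrcSpectrum k A B :=
  homMk (X := sphereSpectrum.{u}) (Y := mtrcSpectrum k A B)
    (fun x => MtrcEl.corner f x.down)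
    (fun _ _ => MtrcEl.corner_pt f)
    (fun e x => MtrcEl.corner_act f e x.down)
    (fun θ x => MtrcEl.corner_res f θ x.down)
    (fun x s => MtrcEl.corner_str f x.down s)

/-- In each degree `S⁰` has one simplex besides the basepoint, which identifies `A ⊙ S⁰` with `A`.
-/
lemma Odot.sing_elim0 (u : Fin 0 → S1 ℓ) (a : A) :
    sing u a = fun _ => a := by
  classical
  funext x
  obtain ⟨w, -, hw⟩ := Sph.exists_mk x.1 x.2
  exact if_pos (hw.trans (congrArg Sph.mk (Subsingleton.elim _ _)))

/-- All empty words agree; leaving them arbitrary lets the formula fit the ones that the unitors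
produce. -/
lemma ap_mtrcOfHom_sing (f : A →ₙₐ[k] B) (t u : Fin 0 → S1 ℓ) (a : A) (i j : Fin 0 → Fin 2) :
    MtrcEl.ofEl (ap (mtrcOfHom f) (sph t)) (sing u a) i j = f a := by
  classical
  refine (MtrcEl.corner_apply f (Sph.mk t) (sing u a) i j).trans ?_
  rw [if_pos ⟨Subsingleton.elim _ _, Subsingleton.elim _ _⟩]
  congr 1
  exact (coord_sing u (w := t) (fun l => l.elim0) a).trans (if_pos (Subsingleton.elim _ _))

end MatrixTransfers

/-! ### Homomorphisms as maps from the sphere spectrum, and the spectral category. -/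

section Mtrc

open Opposite Simplicial SymmetricSpectrum Odot TensorProduct

variable {k : Type u} [CommRing k] {A B C D A' B' : AlgCat.{u} k}

lemma levelZeroHom_apply (φ : 𝟙_ SymmetricSpectrum.{u} ⟶ mtrc k A B) (u : Fin 0 → S1 (op ⦋0⦌))
    (a : A) (i j : Fin 0 → Fin 2) : levelZeroHom φ a =
      MtrcEl.ofEl (ap φ (sph (ℓ := op ⦋0⦌) fun i : Fin 0 => i.elim0)) (sing u a) i j := by
  rw [Subsingleton.elim i default, Subsingleton.elim j default]
  exact congrArg (fun b : Odot A (sphPt 0 _) => MtrcEl.ofEl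
    (ap φ (sph (ℓ := op ⦋0⦌) fun i : Fin 0 => i.elim0)) b default default) (sing_elim0 u a).symm

lemma levelZeroHom_mtrcOfHom (f : A →ₙₐ[k] B) :
    levelZeroHom (A := A) (B := B) (mtrcOfHom f) = f :=
  NonUnitalAlgHom.ext fun a => (levelZeroHom_apply (A := A) (B := B) (mtrcOfHom f) Fin.elim0 a
    default default).trans (ap_mtrcOfHom_sing f _ _ a _ _)

/-- By `sphere_hom_ext` a map is determined by one correspondence `A ⊙ S⁰ → M₁(B)`, and by
`ext_sing` that one is determined by its entries. -/
lemma levelZeroHom_injective : Function.Injective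
    (levelZeroHom : (𝟙_ SymmetricSpectrum.{u} ⟶ mtrc k A B) → (A →ₙₐ[k] B)) := fun φ ψ h =>
  sphere_hom_ext <| MtrcEl.ext_sing fun u _ a i j =>
    (levelZeroHom_apply φ u a i j).symm.trans
      ((DFunLike.congr_fun h a).trans (levelZeroHom_apply ψ u a i j))

lemma mtrcOfHom_levelZeroHom (φ : 𝟙_ SymmetricSpectrum.{u} ⟶ mtrc k A B) :
    mtrcOfHom (levelZeroHom φ) = φ :=
  levelZeroHom_injective (levelZeroHom_mtrcOfHom _)

lemma levelZeroHom_bijective : Function.Bijective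
    (levelZeroHom : (𝟙_ SymmetricSpectrum.{u} ⟶ mtrc k A B) → (A →ₙₐ[k] B)) :=
  ⟨levelZeroHom_injective, fun f => ⟨_, levelZeroHom_mtrcOfHom f⟩⟩

/-- `levelZeroHom` looks only at simplicial degree `0`. The other degrees follow because `φ` is
recovered from its level zero homomorphism as `mtrcOfHom`. -/
lemma ap_sph_sing (φ : 𝟙_ SymmetricSpectrum.{u} ⟶ mtrc k A B) {ℓ : SimplexCategoryᵒᵖ}
    (t u : Fin 0 → S1 ℓ) (a : A) (i j : Fin 0 → Fin 2) :
    MtrcEl.ofEl (ap φ (sph t)) (sing u a) i j = levelZeroHom φ a := by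
  conv_lhs => rw [← mtrcOfHom_levelZeroHom φ]
  exact ap_mtrcOfHom_sing _ t u a i j

variable (k) in
/-- The spectral category of matrix transfers. -/
noncomputable def mtrcEnrichment :
    Enrichment SymmetricSpectrum.{u} (AlgCat.{u} k) (mtrc k) where
  id A := mtrcOfHom (NonUnitalAlgHom.id k A)
  comp A B C := desc (mtrcCompBimorphism k A B C)
  id_comp A B := hom_ext' fun {n ℓ} x => MtrcEl.ext_sing fun u _ a i j => by
    -- The inverse unitor smashes `x` with the non-basepoint of `S⁰`: the first part of every word
    -- is empty, and the identity acts on `a`.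
    refine (MtrcEl.matComp_sing (Equiv.emptySum (Fin 0) (Fin n))
      (MtrcEl.ofEl (ap (mtrcOfHom (NonUnitalAlgHom.id k A)) (sph Fin.elim0))) x u a i j).trans ?_
    rw [ap_mtrcOfHom_sing]
    rfl
  comp_id A B := hom_ext' fun {n ℓ} x => MtrcEl.ext_sing fun u _ a i j => by
    refine (MtrcEl.matComp_sing ((Equiv.sumComm _ _).trans (Equiv.emptySum (Fin 0) (Fin n))) x
      (MtrcEl.ofEl (ap (mtrcOfHom (NonUnitalAlgHom.id k B)) (sph Fin.elim0))) u a i j).trans ?_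
    exact ap_mtrcOfHom_sing _ _ _ _ _ _
  assoc A B C D := smash_hom_ext fun {p m n ℓ} e x w => by
    induction w using smash_ind with
    | @h q r e' y z =>
    refine (ap_comp_of_eq _ (ap_associator_inv e e' x y z)).trans ?_
    exact MtrcEl.matComp_assoc e e' x y z

end Mtrc

/-! ### The underlying category and its action on matrix correspondences. -/

section Mtrc

open Opposite Simplicial SymmetricSpectrum Odot TensorProduct

variable {k : Type u} [CommRing k] {A B C D A' B' D' : AlgCat.{u} k} {n m p q r : ℕ}
  {ℓ : SimplexCategoryᵒᵖ}

lemma MtrcEl.ext_sing_tmul_tmul {A B D C : Type u} [Ring A] [Algebra k A] [Ring B] [Algebra k B]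
    [Ring D] [Algebra k D] [Ring C] [Algebra k C] {f g : MtrcEl k ((A ⊗[k] B) ⊗[k] D) C n ℓ}
    (h : ∀ u : Fin n → S1 ℓ, (∀ i, u i ≠ S1.pt ℓ) → ∀ a b d i j,
      f (sing u (a ⊗ₜ b ⊗ₜ d)) i j = g (sing u (a ⊗ₜ b ⊗ₜ d)) i j) : f = g :=
  MtrcEl.ext_sing fun u hu c i j => by
    have h' : MtrcEl.entry f u i j = MtrcEl.entry g u i j :=
      TensorProduct.ext_threefold fun a b d => h u hu a b d i j
    exact LinearMap.congr_fun h' c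

namespace NonUnitalAlgHom

/-- Linearity alone separates homomorphisms, so extensionality on iterated pure tensors is inherited
from linear maps. -/
lemma ext_linearMap {R S : Type u} [NonUnitalNonAssocSemiring R] [Module k R]
    [NonUnitalNonAssocSemiring S] [Module k S] {f g : R →ₙₐ[k] S}
    (h : (f : R →ₗ[k] S) = (g : R →ₗ[k] S)) : f = g :=
  NonUnitalAlgHom.ext (LinearMap.congr_fun h)

variable {A B C D E : Type u} [Ring A] [Algebra k A] [Ring B] [Algebra k B] [Ring C] [Algebra k C]
  [Ring D] [Algebra k D] [Ring E] [Algebra k E]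

lemma ext_tmul {f g : A ⊗[k] B →ₙₐ[k] C} (h : ∀ a b, f (a ⊗ₜ b) = g (a ⊗ₜ b)) : f = g :=
  ext_linearMap (TensorProduct.ext' h)

lemma ext_tmul_tmul {f g : (A ⊗[k] B) ⊗[k] D →ₙₐ[k] C}
    (h : ∀ a b d, f (a ⊗ₜ b ⊗ₜ d) = g (a ⊗ₜ b ⊗ₜ d)) : f = g :=
  ext_linearMap (TensorProduct.ext_threefold h)

lemma ext_tmul_tmul_tmul {f g : ((A ⊗[k] B) ⊗[k] D) ⊗[k] E →ₙₐ[k] C}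
    (h : ∀ a b d c, f (a ⊗ₜ b ⊗ₜ d ⊗ₜ c) = g (a ⊗ₜ b ⊗ₜ d ⊗ₜ c)) : f = g :=
  ext_linearMap (TensorProduct.ext_fourfold h)

end NonUnitalAlgHom

variable (k) in
noncomputable instance mtrcEnrichedCategory :
    EnrichedCategory SymmetricSpectrum.{u} (AlgCat.{u} k) := (mtrcEnrichment k).toEnrichedCategory

/-- The inverse unitor doubles the generator of the sphere spectrum. In level zero all words are
empty, and `matComp` is composition of maps. -/
lemma levelZeroHom_comp (φ : 𝟙_ SymmetricSpectrum.{u} ⟶ mtrc k A B)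
    (ψ : 𝟙_ SymmetricSpectrum.{u} ⟶ mtrc k B C) :
    levelZeroHom ((λ_ (𝟙_ SymmetricSpectrum.{u})).inv ≫ (φ ⊗ₘ ψ) ≫ (mtrcEnrichment k).comp A B C) =
      (levelZeroHom ψ).comp (levelZeroHom φ) :=
  NonUnitalAlgHom.ext fun a => by
    rw [levelZeroHom_apply _ Fin.elim0 a default default]
    refine (MtrcEl.matComp_sing (Equiv.emptySum (Fin 0) (Fin 0)) (MtrcEl.ofEl (ap φ (sph Fin.elim0)))
      (MtrcEl.ofEl (ap ψ (sph _))) _ a _ _).trans ?_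
    rw [ap_sph_sing, ap_sph_sing]
    rfl

variable (A B A' B') in
/-- The tensor product of matrix correspondences as a map of spectra. -/
noncomputable def mtrcTensorHom :
    mtrc k A A' ⊗ mtrc k B B' ⟶ mtrc k (algTensor k A B) (algTensor k A' B') :=
  desc (mtrcTensorBimorphism k A B A' B')

lemma levelZeroHom_tensor (φ : 𝟙_ SymmetricSpectrum.{u} ⟶ mtrc k A A')
    (ψ : 𝟙_ SymmetricSpectrum.{u} ⟶ mtrc k B B') (a : A) (b : B) :
    levelZeroHom ((λ_ (𝟙_ SymmetricSpectrum.{u})).inv ≫ (φ ⊗ₘ ψ) ≫ mtrcTensorHom A B A' B')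
      (a ⊗ₜ[k] b) = levelZeroHom φ a ⊗ₜ[k] levelZeroHom ψ b := by
  rw [levelZeroHom_apply _ Fin.elim0 _ default default]
  refine (MtrcEl.matTensor_sing (Equiv.emptySum (Fin 0) (Fin 0)) (MtrcEl.ofEl (ap φ (sph Fin.elim0)))
    (MtrcEl.ofEl (ap ψ (sph _))) _ a b _ _).trans ?_
  rw [ap_sph_sing, ap_sph_sing]

/-- The non-unital homomorphism that corresponds to a morphism of the underlying category. -/
noncomputable def underlyingHom (f : ForgetEnrichment.of SymmetricSpectrum.{u} A ⟶
    ForgetEnrichment.of SymmetricSpectrum.{u} B) : A →ₙₐ[k] B :=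
  levelZeroHom (A := A) (B := B) (ForgetEnrichment.homTo SymmetricSpectrum.{u} f)

/-- This reduces every equation in the underlying category to one between homomorphisms of algebras.
-/
lemma underlyingHom_injective : Function.Injective
    (underlyingHom : (ForgetEnrichment.of SymmetricSpectrum.{u} A ⟶
      ForgetEnrichment.of SymmetricSpectrum.{u} B) → (A →ₙₐ[k] B)) :=
  levelZeroHom_injective

lemma underlyingHom_id :
    underlyingHom (𝟙 (ForgetEnrichment.of SymmetricSpectrum.{u} A)) = NonUnitalAlgHom.id k A :=
  (congrArg (levelZeroHom (A := A) (B := A)) (ForgetEnrichment.homTo_id _ _)).trans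
    (levelZeroHom_mtrcOfHom _)

lemma underlyingHom_comp (f : ForgetEnrichment.of SymmetricSpectrum.{u} A ⟶
      ForgetEnrichment.of SymmetricSpectrum.{u} B) (g : ForgetEnrichment.of SymmetricSpectrum.{u} B ⟶
      ForgetEnrichment.of SymmetricSpectrum.{u} C) :
    underlyingHom (f ≫ g) = (underlyingHom g).comp (underlyingHom f) :=
  levelZeroHom_comp _ _

lemma underlyingHom_tensor (f : ForgetEnrichment.of SymmetricSpectrum.{u} A ⟶
      ForgetEnrichment.of SymmetricSpectrum.{u} A')
    (g : ForgetEnrichment.of SymmetricSpectrum.{u} B ⟶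
      ForgetEnrichment.of SymmetricSpectrum.{u} B') (a : A) (b : B) :
    underlyingHom (tensorUnderlying (T := algTensor k) (mtrcTensorHom A B A' B') f g) (a ⊗ₜ[k] b) =
      underlyingHom f a ⊗ₜ[k] underlyingHom g b :=
  levelZeroHom_tensor _ _ a b

/-- The morphism of the underlying category that corresponds to a non-unital homomorphism. -/
noncomputable def underlyingOfHom (f : A →ₙₐ[k] B) : ForgetEnrichment.of SymmetricSpectrum.{u} A ⟶
    ForgetEnrichment.of SymmetricSpectrum.{u} B :=
  ForgetEnrichment.homOf SymmetricSpectrum.{u} (mtrcOfHom f)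

lemma underlyingHom_underlyingOfHom (f : A →ₙₐ[k] B) : underlyingHom (underlyingOfHom f) = f :=
  levelZeroHom_mtrcOfHom f

/-- The isomorphism of the underlying category that corresponds to an isomorphism of algebras. -/
noncomputable def underlyingIso (e : A ≃ₐ[k] B) : ForgetEnrichment.of SymmetricSpectrum.{u} A ≅
    ForgetEnrichment.of SymmetricSpectrum.{u} B where
  hom := underlyingOfHom (e.toAlgHom : A →ₙₐ[k] B)
  inv := underlyingOfHom (e.symm.toAlgHom : B →ₙₐ[k] A)
  hom_inv_id := underlyingHom_injective <| by
    rw [underlyingHom_comp, underlyingHom_underlyingOfHom, underlyingHom_underlyingOfHom,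
      underlyingHom_id]
    exact NonUnitalAlgHom.ext fun a => e.symm_apply_apply a
  inv_hom_id := underlyingHom_injective <| by
    rw [underlyingHom_comp, underlyingHom_underlyingOfHom, underlyingHom_underlyingOfHom,
      underlyingHom_id]
    exact NonUnitalAlgHom.ext fun a => e.apply_symm_apply a

lemma underlyingHom_underlyingIso (e : A ≃ₐ[k] B) :
    underlyingHom (underlyingIso e).hom = (e.toAlgHom : A →ₙₐ[k] B) :=
  underlyingHom_underlyingOfHom _

lemma underlyingIso_apply (e : A ≃ₐ[k] B) (a : A) : underlyingHom (underlyingIso e).hom a = e a := by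
  rw [underlyingHom_underlyingIso]; rfl

/-- The second correspondence has level zero and cuts off empty words, so it just acts on each
matrix entry. -/
lemma ap_postcomp_sing (f : ForgetEnrichment.of SymmetricSpectrum.{u} B ⟶
      ForgetEnrichment.of SymmetricSpectrum.{u} C) (x : (mtrc k A B).seq.El n ℓ)
    (u : Fin n → S1 ℓ) (a : A) (i j : Fin n → Fin 2) :
    MtrcEl.ofEl (A := A) (B := C) (ap (postcomp SymmetricSpectrum.{u} A f) x) (sing u a) i j =
      underlyingHom f (MtrcEl.ofEl x (sing u a) i j) := by
  refine (MtrcEl.matComp_sing ((Equiv.sumComm _ _).trans (Equiv.emptySum (Fin 0) (Fin n)))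
    (MtrcEl.ofEl x) (MtrcEl.ofEl (A := B) (B := C)
      (ap (ForgetEnrichment.homTo SymmetricSpectrum.{u} f) (sph Fin.elim0))) u a i j).trans ?_
  exact ap_sph_sing (A := B) (B := C) _ _ _ _ _ _

/-- Here the first correspondence has level zero, so it acts on the argument inside its factor. -/
lemma ap_precomp_sing (f : ForgetEnrichment.of SymmetricSpectrum.{u} A ⟶
      ForgetEnrichment.of SymmetricSpectrum.{u} B) (x : (mtrc k B C).seq.El n ℓ)
    (u : Fin n → S1 ℓ) (a : A) (i j : Fin n → Fin 2) :
    MtrcEl.ofEl (A := A) (B := C) (ap (precomp SymmetricSpectrum.{u} f C) x) (sing u a) i j =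
      MtrcEl.ofEl x (sing u (underlyingHom f a)) i j := by
  refine (MtrcEl.matComp_sing (Equiv.emptySum (Fin 0) (Fin n)) (MtrcEl.ofEl (A := A) (B := B)
      (ap (ForgetEnrichment.homTo SymmetricSpectrum.{u} f) (sph Fin.elim0)))
    (MtrcEl.ofEl x) u a i j).trans ?_
  rw [ap_sph_sing (A := A) (B := B)]
  rfl

end Mtrc

/-! ### Interchange and coherence isomorphisms on matrix entries. -/

section MatrixTransfers

open TensorProduct Odot

variable {n m l p q r s : ℕ} {ℓ : SimplexCategoryᵒᵖ} {k : Type u} [CommRing k]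
  {A B D A' B' D' A'' B'' : Type u} [Ring A] [Algebra k A] [Ring B] [Algebra k B] [Ring D]
  [Algebra k D] [Ring A'] [Algebra k A'] [Ring B'] [Algebra k B'] [Ring D'] [Algebra k D']
  [Ring A''] [Algebra k A''] [Ring B''] [Algebra k B'']

namespace MtrcEl

/-- The tensor product of matrix correspondences is compatible with composition. -/
lemma matComp_matTensor (e : Fin m ⊕ Fin l ≃ Fin n) (e₁ : Fin p ⊕ Fin q ≃ Fin m)
    (e₂ : Fin r ⊕ Fin s ≃ Fin l) (x : MtrcEl k A A' p ℓ) (y : MtrcEl k A' A'' q ℓ)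
    (z : MtrcEl k B B' r ℓ) (w : MtrcEl k B' B'' s ℓ) :
    matComp ((Equiv.sumCongr finSumFinEquiv.symm finSumFinEquiv.symm).trans
        ((Equiv.sumSumSumComm _ _ _ _).trans ((Equiv.sumCongr e₁ e₂).trans e)))
      (matTensor finSumFinEquiv x z) (matTensor finSumFinEquiv y w) =
    matTensor e (matComp e₁ x y) (matComp e₂ z w) := by
  refine ext_sing_tmul fun u _ a b i j => ?_
  rw [matComp_sing, matTensor_sing, matTensor_sing, matTensor_sing, matComp_sing, matComp_sing]
  simp [Function.comp_def]

/-- Both sides are the tensor of the same three entries, bracketed alike; the bijection on the right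
is that of `ap_associator_hom`. -/
lemma matTensor_assoc_sing (e : Fin m ⊕ Fin r ≃ Fin n) (e' : Fin p ⊕ Fin q ≃ Fin m)
    (x : MtrcEl k A A' p ℓ) (y : MtrcEl k B B' q ℓ) (z : MtrcEl k D D' r ℓ) (u : Fin n → S1 ℓ)
    (a : A) (b : B) (d : D) (i j : Fin n → Fin 2) :
    Algebra.TensorProduct.assoc k k k A' B' D'
        (matTensor e (matTensor e' x y) z (sing u (a ⊗ₜ b ⊗ₜ d)) i j) =
      matTensor ((Equiv.sumCongr (Equiv.refl _) finSumFinEquiv.symm).trans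
          ((Equiv.sumAssoc _ _ _).symm.trans ((Equiv.sumCongr e' (Equiv.refl _)).trans e)))
        x (matTensor finSumFinEquiv y z)
        (sing u (Algebra.TensorProduct.assoc k k k A B D (a ⊗ₜ b ⊗ₜ d))) i j := by
  rw [matTensor_sing, matTensor_sing, Algebra.TensorProduct.assoc_tmul,
    Algebra.TensorProduct.assoc_tmul, matTensor_sing, matTensor_sing]
  simp [Function.comp_def]

lemma matTensor_comm_sing (e : Fin p ⊕ Fin q ≃ Fin n) (x : MtrcEl k A A' p ℓ)
    (y : MtrcEl k B B' q ℓ) (u : Fin n → S1 ℓ) (a : A) (b : B) (i j : Fin n → Fin 2) :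
    Algebra.TensorProduct.comm k A' B' (matTensor e x y (sing u (a ⊗ₜ b)) i j) =
      matTensor ((Equiv.sumComm _ _).trans e) y x
        (sing u (Algebra.TensorProduct.comm k A B (a ⊗ₜ b))) i j := by
  rw [matTensor_sing, Algebra.TensorProduct.comm_tmul, Algebra.TensorProduct.comm_tmul,
    matTensor_sing]
  rfl

/-- By `k`-linearity of `x` the scalar `c` may act before or after it. The hypothesis `hf` is what
`ap_mtrcOfHom_sing` says about the unit at `k`. -/
lemma lid_matTensor_sing {f : MtrcEl k k k 0 ℓ} (hf : ∀ t c i j, f (sing t c) i j = c)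
    (x : MtrcEl k A A' n ℓ) (u : Fin n → S1 ℓ) (c : k) (a : A) (i j : Fin n → Fin 2) :
    Algebra.TensorProduct.lid k A'
        (matTensor (Equiv.emptySum (Fin 0) (Fin n)) f x (sing u (c ⊗ₜ a)) i j) =
      x (sing u (Algebra.TensorProduct.lid k A (c ⊗ₜ a))) i j := by
  rw [matTensor_sing, hf, Algebra.TensorProduct.lid_tmul, Algebra.TensorProduct.lid_tmul,
    sing_smul, map_smul]
  rfl

lemma rid_matTensor_sing {f : MtrcEl k k k 0 ℓ} (hf : ∀ t c i j, f (sing t c) i j = c)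
    (x : MtrcEl k A A' n ℓ) (u : Fin n → S1 ℓ) (c : k) (a : A) (i j : Fin n → Fin 2) :
    Algebra.TensorProduct.rid k k A' (matTensor ((Equiv.sumComm _ _).trans
        (Equiv.emptySum (Fin 0) (Fin n))) x f (sing u (a ⊗ₜ c)) i j) =
      x (sing u (Algebra.TensorProduct.rid k k A (a ⊗ₜ c))) i j := by
  rw [matTensor_sing, hf, Algebra.TensorProduct.rid_tmul, Algebra.TensorProduct.rid_tmul,
    sing_smul, map_smul]
  rfl

end MtrcEl
end MatrixTransfers

/-! ### The symmetric monoidal structure. -/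

section Mtrc

open Opposite Simplicial SymmetricSpectrum Odot TensorProduct

variable {k : Type u} [CommRing k]

lemma ap_postcomp_underlyingIso_sing {n : ℕ} {ℓ : SimplexCategoryᵒᵖ} (A B C : AlgCat.{u} k)
    (e : B ≃ₐ[k] C) (x : MtrcEl k A B n ℓ) (u : Fin n → S1 ℓ) (a : A) (i j : Fin n → Fin 2) :
    MtrcEl.ofEl (A := A) (B := C) (ap (X := mtrc k A B) (Y := mtrc k A C)
      (postcomp SymmetricSpectrum.{u} A (underlyingIso e).hom) x) (sing u a) i j =
      e (x (sing u a) i j) :=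
  (ap_postcomp_sing _ x u a i j).trans (underlyingIso_apply e _)

lemma ap_precomp_underlyingIso_sing {n : ℕ} {ℓ : SimplexCategoryᵒᵖ} (A B C : AlgCat.{u} k)
    (e : A ≃ₐ[k] B) (x : MtrcEl k B C n ℓ) (u : Fin n → S1 ℓ) (a : A) (i j : Fin n → Fin 2) :
    MtrcEl.ofEl (A := A) (B := C) (ap (X := mtrc k B C) (Y := mtrc k A C)
      (precomp SymmetricSpectrum.{u} (underlyingIso e).hom C) x) (sing u a) i j =
      x (sing u (e a)) i j := by
  refine (ap_precomp_sing _ x u a i j).trans ?_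
  rw [underlyingIso_apply]

/-- Both sides are maps out of the sphere spectrum, hence are compared as homomorphisms on pure
tensors. -/
lemma mtrcTensorHom_id (A B : AlgCat.{u} k) :
    (λ_ (𝟙_ SymmetricSpectrum.{u})).inv ≫
      (eId SymmetricSpectrum.{u} A ⊗ₘ eId SymmetricSpectrum.{u} B) ≫ mtrcTensorHom A B A B =
      eId SymmetricSpectrum.{u} (algTensor k A B) :=
  levelZeroHom_injective <| NonUnitalAlgHom.ext_tmul fun a b => by
    refine (levelZeroHom_tensor _ _ a b).trans ?_
    have h (A : AlgCat.{u} k) (a : A) :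
      levelZeroHom (A := A) (B := A) (eId SymmetricSpectrum.{u} A) a = a :=
      DFunLike.congr_fun (levelZeroHom_mtrcOfHom (NonUnitalAlgHom.id k A)) a
    rw [h, h]
    exact (h (algTensor k A B) _).symm

lemma mtrcTensorHom_comp (A A' A'' B B' B'' : AlgCat.{u} k) :
    tensorμ (mtrc k A A') (mtrc k A' A'') (mtrc k B B') (mtrc k B' B'') ≫
      (mtrcTensorHom A B A' B' ⊗ₘ mtrcTensorHom A' B' A'' B'') ≫
        (mtrcEnrichment k).comp (algTensor k A B) (algTensor k A' B') (algTensor k A'' B'') =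
    ((mtrcEnrichment k).comp A A' A'' ⊗ₘ (mtrcEnrichment k).comp B B' B'') ≫
      mtrcTensorHom A B A'' B'' :=
  smash_hom_ext fun e v w => by
    induction v using smash_ind with
    | @h p q e₁ x y =>
    induction w using smash_ind with
    | @h r s e₂ z w =>
    refine (ap_comp_of_eq _ (ap_tensorμ e e₁ e₂ x y z w)).trans ?_
    exact MtrcEl.matComp_matTensor e e₁ e₂ x y z w

/-- Postcomposition acts on entries and precomposition on arguments, so enriched naturality is the
entrywise identity `matTensor_assoc_sing`. The other naturality squares are obtained in the same
manner. -/
lemma mtrcTensorHom_assoc (A A' B B' D D' : AlgCat.{u} k) :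
    (mtrcTensorHom A B A' B' ▷ mtrc k D D') ≫
        mtrcTensorHom (algTensor k A B) D (algTensor k A' B') D' ≫
        postcomp SymmetricSpectrum.{u} (algTensor k (algTensor k A B) D)
          (underlyingIso (A := algTensor k (algTensor k A' B') D')
            (B := algTensor k A' (algTensor k B' D'))
            (Algebra.TensorProduct.assoc k k k A' B' D')).hom =
      (α_ (mtrc k A A') (mtrc k B B') (mtrc k D D')).hom ≫
        (mtrc k A A' ◁ mtrcTensorHom B D B' D') ≫
        mtrcTensorHom A (algTensor k B D) A' (algTensor k B' D') ≫
        precomp SymmetricSpectrum.{u} (underlyingIso (A := algTensor k (algTensor k A B) D)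
            (B := algTensor k A (algTensor k B D))
            (Algebra.TensorProduct.assoc k k k A B D)).hom (algTensor k A' (algTensor k B' D')) :=
  smash_hom_ext fun {m r n ℓ} e v z => by
    induction v using smash_ind with
    | @h p q e' x y =>
    refine Eq.trans ?_ (ap_comp_of_eq _ (ap_associator_hom e e' x y z)).symm
    refine MtrcEl.ext_sing_tmul_tmul fun u _ a b d i j => ?_
    refine (ap_postcomp_underlyingIso_sing (algTensor k (algTensor k A B) D)
      (algTensor k (algTensor k A' B') D') (algTensor k A' (algTensor k B' D'))
      (Algebra.TensorProduct.assoc k k k A' B' D') (MtrcEl.matTensor e (MtrcEl.matTensor e' x y) z)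
      u (a ⊗ₜ b ⊗ₜ d) i j).trans ?_
    refine (MtrcEl.matTensor_assoc_sing e e' x y z u a b d i j).trans ?_
    exact (ap_precomp_underlyingIso_sing (algTensor k (algTensor k A B) D)
      (algTensor k A (algTensor k B D)) (algTensor k A' (algTensor k B' D'))
      (Algebra.TensorProduct.assoc k k k A B D) (MtrcEl.matTensor
        ((Equiv.sumCongr (Equiv.refl _) finSumFinEquiv.symm).trans
          ((Equiv.sumAssoc _ _ _).symm.trans ((Equiv.sumCongr e' (Equiv.refl _)).trans e))) x
        (MtrcEl.matTensor finSumFinEquiv y z)) u (a ⊗ₜ b ⊗ₜ d) i j).symm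

/-- The inverse unitor and the unit of `k` insert a level zero correspondence that acts as the
identity of `k`, the situation of `lid_matTensor_sing`. -/
lemma mtrcTensorHom_leftUnitor (A A' : AlgCat.{u} k) :
    (λ_ (mtrc k A A')).inv ≫ (eId SymmetricSpectrum.{u} (AlgCat.of k k) ▷ mtrc k A A') ≫
        mtrcTensorHom (AlgCat.of k k) A (AlgCat.of k k) A' ≫
        postcomp SymmetricSpectrum.{u} (algTensor k (AlgCat.of k k) A)
          (underlyingIso (A := algTensor k (AlgCat.of k k) A') (B := A')
            (Algebra.TensorProduct.lid k A')).hom =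
      precomp SymmetricSpectrum.{u} (underlyingIso (A := algTensor k (AlgCat.of k k) A) (B := A)
            (Algebra.TensorProduct.lid k A)).hom A' :=
  hom_ext' fun {n ℓ} x => MtrcEl.ext_sing_tmul fun u _ c a i j => by
    refine (ap_postcomp_underlyingIso_sing (algTensor k (AlgCat.of k k) A) (algTensor k (AlgCat.of k k) A') A'
      (Algebra.TensorProduct.lid k A') (MtrcEl.matTensor (Equiv.emptySum (Fin 0) (Fin n))
      (MtrcEl.ofEl (ap (mtrcOfHom (NonUnitalAlgHom.id k k)) (sph Fin.elim0))) x)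
      u (c ⊗ₜ a) i j).trans ?_
    exact (MtrcEl.lid_matTensor_sing (ap_mtrcOfHom_sing (NonUnitalAlgHom.id k k) Fin.elim0) x u c a i j).trans (ap_precomp_underlyingIso_sing (algTensor k (AlgCat.of k k) A) A A' (Algebra.TensorProduct.lid k A) x u
      (c ⊗ₜ a) i j).symm

lemma mtrcTensorHom_rightUnitor (A A' : AlgCat.{u} k) :
    (ρ_ (mtrc k A A')).inv ≫ (mtrc k A A' ◁ eId SymmetricSpectrum.{u} (AlgCat.of k k)) ≫
        mtrcTensorHom A (AlgCat.of k k) A' (AlgCat.of k k) ≫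
        postcomp SymmetricSpectrum.{u} (algTensor k A (AlgCat.of k k))
          (underlyingIso (A := algTensor k A' (AlgCat.of k k)) (B := A')
            (Algebra.TensorProduct.rid k k A')).hom =
      precomp SymmetricSpectrum.{u} (underlyingIso (A := algTensor k A (AlgCat.of k k)) (B := A)
            (Algebra.TensorProduct.rid k k A)).hom A' :=
  hom_ext' fun {n ℓ} x => MtrcEl.ext_sing_tmul fun u _ a c i j => by
    refine (ap_postcomp_underlyingIso_sing (algTensor k A (AlgCat.of k k)) (algTensor k A' (AlgCat.of k k)) A'
      (Algebra.TensorProduct.rid k k A') (MtrcEl.matTensor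
      ((Equiv.sumComm _ _).trans (Equiv.emptySum (Fin 0) (Fin n))) x
      (MtrcEl.ofEl (ap (mtrcOfHom (NonUnitalAlgHom.id k k)) (sph Fin.elim0))))
      u (a ⊗ₜ c) i j).trans ?_
    exact (MtrcEl.rid_matTensor_sing (ap_mtrcOfHom_sing (NonUnitalAlgHom.id k k) Fin.elim0) x u c a i j).trans (ap_precomp_underlyingIso_sing (algTensor k A (AlgCat.of k k)) A A' (Algebra.TensorProduct.rid k k A) x u
      (a ⊗ₜ c) i j).symm

/-- The symmetry of the smash product exchanges the two blocks of positions, in step with the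
exchange of the tensor factors. -/
lemma mtrcTensorHom_braiding (A A' B B' : AlgCat.{u} k) :
    mtrcTensorHom A B A' B' ≫ postcomp SymmetricSpectrum.{u} (algTensor k A B)
        (underlyingIso (A := algTensor k A' B') (B := algTensor k B' A')
          (Algebra.TensorProduct.comm k A' B')).hom =
      (β_ (mtrc k A A') (mtrc k B B')).hom ≫ mtrcTensorHom B A B' A' ≫
        precomp SymmetricSpectrum.{u} (underlyingIso (A := algTensor k A B) (B := algTensor k B A)
          (Algebra.TensorProduct.comm k A B)).hom (algTensor k B' A') :=
  smash_hom_ext fun {p q n ℓ} e x y => by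
    refine Eq.trans ?_ (ap_comp_of_eq _ (ap_braiding_hom e x y)).symm
    refine MtrcEl.ext_sing_tmul fun u _ a b i j => ?_
    refine (ap_postcomp_underlyingIso_sing (algTensor k A B) (algTensor k A' B')
      (algTensor k B' A') (Algebra.TensorProduct.comm k A' B') (MtrcEl.matTensor e x y) u
      (a ⊗ₜ b) i j).trans ?_
    refine (MtrcEl.matTensor_comm_sing e x y u a b i j).trans ?_
    exact (ap_precomp_underlyingIso_sing (algTensor k A B) (algTensor k B A) (algTensor k B' A')
      (Algebra.TensorProduct.comm k A B) (MtrcEl.matTensor ((Equiv.sumComm _ _).trans e) y x) u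
      (a ⊗ₜ b) i j).symm

lemma underlyingHom_assoc (A B D : AlgCat.{u} k) (a : A) (b : B) (d : D) :
    underlyingHom (underlyingIso (A := algTensor k (algTensor k A B) D)
      (B := algTensor k A (algTensor k B D)) (Algebra.TensorProduct.assoc k k k A B D)).hom
      (a ⊗ₜ[k] b ⊗ₜ[k] d) = a ⊗ₜ[k] (b ⊗ₜ[k] d) :=
  underlyingIso_apply _ _

lemma underlyingHom_comm (A B : AlgCat.{u} k) (a : A) (b : B) :
    underlyingHom (underlyingIso (A := algTensor k A B) (B := algTensor k B A)
      (Algebra.TensorProduct.comm k A B)).hom (a ⊗ₜ[k] b) = b ⊗ₜ[k] a :=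
  underlyingIso_apply _ _

lemma underlyingHom_lid (A : AlgCat.{u} k) (c : k) (a : A) :
    underlyingHom (underlyingIso (A := algTensor k (AlgCat.of k k) A) (B := A)
      (Algebra.TensorProduct.lid k A)).hom (c ⊗ₜ[k] a) = c • a :=
  underlyingIso_apply _ _

lemma underlyingHom_rid (A : AlgCat.{u} k) (a : A) (c : k) :
    underlyingHom (underlyingIso (A := algTensor k A (AlgCat.of k k)) (B := A)
      (Algebra.TensorProduct.rid k k A)).hom (a ⊗ₜ[k] c) = c • a :=
  underlyingIso_apply _ _

variable (k) in
/-- The symmetric monoidal structure on the spectral category of matrix transfers. -/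
noncomputable def mtrcSymmetricMonoidal :
    (mtrcEnrichment k).SymmetricMonoidal (algTensor k) (AlgCat.of k k) where
  tensorHom A A' B B' := mtrcTensorHom A B A' B'
  tensor_id := mtrcTensorHom_id
  tensor_comp := mtrcTensorHom_comp
  associator A B D := underlyingIso (A := algTensor k (algTensor k A B) D)
    (B := algTensor k A (algTensor k B D)) (Algebra.TensorProduct.assoc k k k A B D)
  leftUnitor A := underlyingIso (A := algTensor k (AlgCat.of k k) A) (B := A)
    (Algebra.TensorProduct.lid k A)
  rightUnitor A := underlyingIso (A := algTensor k A (AlgCat.of k k)) (B := A)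
    (Algebra.TensorProduct.rid k k A)
  braiding A B := underlyingIso (A := algTensor k A B) (B := algTensor k B A)
    (Algebra.TensorProduct.comm k A B)
  associator_naturality A A' B B' D D' := mtrcTensorHom_assoc A A' B B' D D'
  leftUnitor_naturality := mtrcTensorHom_leftUnitor
  rightUnitor_naturality := mtrcTensorHom_rightUnitor
  braiding_naturality := mtrcTensorHom_braiding
  -- Both composites send `((a ⊗ b) ⊗ d) ⊗ c` to `a ⊗ (b ⊗ (d ⊗ c))`.
  pentagon A B D E := underlyingHom_injective <| NonUnitalAlgHom.ext_tmul_tmul_tmul fun a b d c => by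
    rw [underlyingHom_comp, underlyingHom_comp, underlyingHom_comp, NonUnitalAlgHom.comp_apply,
      NonUnitalAlgHom.comp_apply, NonUnitalAlgHom.comp_apply]
    rw [underlyingHom_tensor, underlyingHom_assoc, underlyingHom_id]
    refine (congrArg _ (underlyingHom_assoc A (algTensor k B D) E a (b ⊗ₜ[k] d) c)).trans ?_
    refine Eq.trans ?_
      (congrArg _ (underlyingHom_assoc (algTensor k A B) D E (a ⊗ₜ[k] b) d c)).symm
    rw [underlyingHom_tensor, underlyingHom_assoc, underlyingHom_id]
    exact (underlyingHom_assoc A B (algTensor k D E) a b (d ⊗ₜ[k] c)).symm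
  triangle A B := underlyingHom_injective <| NonUnitalAlgHom.ext_tmul_tmul fun a c b => by
    rw [underlyingHom_comp, NonUnitalAlgHom.comp_apply, underlyingHom_assoc, underlyingHom_tensor,
      underlyingHom_tensor, underlyingHom_lid, underlyingHom_rid, underlyingHom_id,
      underlyingHom_id]
    -- The scalar `c` has been moved into `b` on one side and into `a` on the other; the tensor
    -- product is balanced over `k`.
    exact (TensorProduct.smul_tmul c a b).symm
  -- Both composites send `(a ⊗ b) ⊗ d` to `b ⊗ (d ⊗ a)`.
  hexagon A B D := underlyingHom_injective <| NonUnitalAlgHom.ext_tmul_tmul fun a b d => by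
    rw [underlyingHom_comp, underlyingHom_comp, underlyingHom_comp, underlyingHom_comp,
      NonUnitalAlgHom.comp_apply, NonUnitalAlgHom.comp_apply, NonUnitalAlgHom.comp_apply,
      NonUnitalAlgHom.comp_apply, underlyingHom_assoc, underlyingHom_comm, underlyingHom_assoc]
    rw [underlyingHom_tensor, underlyingHom_comm, underlyingHom_assoc, underlyingHom_id,
      underlyingHom_tensor, underlyingHom_comm, underlyingHom_id]
    rfl
  symmetry A B := underlyingHom_injective <| NonUnitalAlgHom.ext_tmul fun a b => by
    rw [underlyingHom_comp, underlyingHom_id, NonUnitalAlgHom.comp_apply, underlyingHom_comm,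
      underlyingHom_comm]
    rfl

end Mtrc

/-! ### The explicit formulas for composition and tensor product, and the theorem. -/

section Mtrc

open TensorProduct Odot

variable {k : Type u} [CommRing k] {A B C A' B' : AlgCat.{u} k} {p q : ℕ} {ℓ : SimplexCategoryᵒᵖ}

/-- Along the standard bijection `join` is the smash product of simplices, so `slice` is the
prescribed `f ⊙ S^q`. -/
lemma isMatrixComposition_matComp (f : MtrcEl k A B p ℓ) (g : MtrcEl k B C q ℓ) :
    IsMatrixComposition f g (MtrcEl.matComp finSumFinEquiv f g) := fun a i j => by
  rw [MtrcEl.matComp_apply]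
  refine congrArg (fun b => g b (i ∘ Fin.natAdd p) (j ∘ Fin.natAdd p)) (funext fun t => ?_)
  exact congrArg (fun φ : sphPt p ℓ ⟶ sphPt (p + q) ℓ => f (odotMap k A φ a)
    (i ∘ Fin.castAdd q) (j ∘ Fin.castAdd q)) (sphJoinHom_finSumFinEquiv t.1)

/-- Each `w₁ ∧ ⋯ ∧ w_{p+q}` is the smash product of its first `p` and last `q` letters, so the
hypothesis on `c` gives all coordinates that `matTensor_of_coord` needs. -/
lemma isMatrixTensor_matTensor (f : MtrcEl k A A' p ℓ) (g : MtrcEl k B B' q ℓ) :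
    IsMatrixTensor f g (MtrcEl.matTensor finSumFinEquiv f g) := fun a b c h i j => by
  refine MtrcEl.matTensor_of_coord finSumFinEquiv f g c a b (fun w => ?_) i j
  refine Eq.trans (congrArg c.comp ?_) (h (Sph.mk (w ∘ Fin.castAdd q)) (Sph.mk (w ∘ Fin.natAdd p)))
  rw [← Sph.join_finSumFinEquiv, Sph.join_mk]
  exact congrArg Sph.mk ((Sph.eq_elim_comp_symm finSumFinEquiv w _ _).2 ⟨rfl, rfl⟩).symm

end Mtrc

theorem theorem3 (k : Type u) [CommRing k] :
    ∃ E : Enrichment SymmetricSpectrum.{u} (AlgCat.{u} k) (mtrc k),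
      -- the unit `𝕊 → Mtrc_*(A, A)` is determined by `id_A`
      (∀ A : AlgCat.{u} k, levelZeroHom (E.id A) = NonUnitalAlgHom.id k A) ∧
      -- the composition is the composition of matrix correspondences
      (∀ (A B C : AlgCat.{u} k) (p q : ℕ) (ℓ : SimplexCategoryᵒᵖ)
        (f : MtrcEl k A B p ℓ) (g : MtrcEl k B C q ℓ),
        IsMatrixComposition f g
          (SymmetricSpectrum.ap (E.comp A B C)
            (SymmetricSpectrum.elt (X := mtrc k A B) (Y := mtrc k B C) finSumFinEquiv f g))) ∧
      -- the underlying category is that of unital algebras and non-unital homomorphisms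
      (∀ A B : AlgCat.{u} k, Function.Bijective
        (levelZeroHom : (𝟙_ SymmetricSpectrum.{u} ⟶ mtrc k A B) → (A →ₙₐ[k] B))) ∧
      (∀ (A B C : AlgCat.{u} k) (φ : 𝟙_ SymmetricSpectrum.{u} ⟶ mtrc k A B)
        (ψ : 𝟙_ SymmetricSpectrum.{u} ⟶ mtrc k B C),
        levelZeroHom ((λ_ (𝟙_ SymmetricSpectrum.{u})).inv ≫ (φ ⊗ₘ ψ) ≫ E.comp A B C) =
          (levelZeroHom ψ).comp (levelZeroHom φ)) ∧
      -- the spectral category is symmetric monoidal under the tensor product of algebras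
      letI := E.toEnrichedCategory
      ∃ M : E.SymmetricMonoidal (algTensor k) (AlgCat.of k k),
        (∀ (A A' B B' : AlgCat.{u} k) (p q : ℕ) (ℓ : SimplexCategoryᵒᵖ)
          (f : MtrcEl k A A' p ℓ) (g : MtrcEl k B B' q ℓ),
          IsMatrixTensor f g
            (SymmetricSpectrum.ap (M.tensorHom A A' B B')
              (SymmetricSpectrum.elt (X := mtrc k A A') (Y := mtrc k B B')
                finSumFinEquiv f g))) ∧
        (∀ A B C : AlgCat.{u} k,
          levelZeroHom (A := algTensor k (algTensor k A B) C) (B := algTensor k A (algTensor k B C))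
              (ForgetEnrichment.homTo SymmetricSpectrum.{u} (M.associator A B C).hom) =
            ((Algebra.TensorProduct.assoc k k k A B C).toAlgHom : _ →ₙₐ[k] _)) ∧
        (∀ A : AlgCat.{u} k,
          levelZeroHom (A := algTensor k (AlgCat.of k k) A) (B := A)
              (ForgetEnrichment.homTo SymmetricSpectrum.{u} (M.leftUnitor A).hom) =
            ((Algebra.TensorProduct.lid k A).toAlgHom : _ →ₙₐ[k] _)) ∧
        (∀ A : AlgCat.{u} k,
          levelZeroHom (A := algTensor k A (AlgCat.of k k)) (B := A)
              (ForgetEnrichment.homTo SymmetricSpectrum.{u} (M.rightUnitor A).hom) =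
            ((Algebra.TensorProduct.rid k k A).toAlgHom : _ →ₙₐ[k] _)) ∧
        (∀ A B : AlgCat.{u} k,
          levelZeroHom (A := algTensor k A B) (B := algTensor k B A)
              (ForgetEnrichment.homTo SymmetricSpectrum.{u} (M.braiding A B).hom) =
            ((Algebra.TensorProduct.comm k A B).toAlgHom : _ →ₙₐ[k] _)) := 
  ⟨mtrcEnrichment k, fun _ => levelZeroHom_mtrcOfHom _,
    fun _ _ _ _ _ _ f g => isMatrixComposition_matComp f g, fun _ _ => levelZeroHom_bijective,
    fun _ _ _ φ ψ => levelZeroHom_comp φ ψ, mtrcSymmetricMonoidal k,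
    fun _ _ _ _ _ _ _ f g => isMatrixTensor_matTensor f g,
    fun A B C => underlyingHom_underlyingIso (A := algTensor k (algTensor k A B) C)
      (B := algTensor k A (algTensor k B C)) _,
    fun A => underlyingHom_underlyingIso (A := algTensor k (AlgCat.of k k) A) (B := A) _,
    fun A => underlyingHom_underlyingIso (A := algTensor k A (AlgCat.of k k)) (B := A) _,
    fun A B => underlyingHom_underlyingIso (A := algTensor k A B) (B := algTensor k B A) _⟩
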